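/- Consider the higher-order $\pi$-calculus with passivation, with processes and terms $$P,Q ::= 0 \mid a(X).P \mid \bar a\langle M\rangle.P \mid (P\mid Q) \mid a[P] \mid \nu a.P \mid {!}P \mid \mathit{run}(M),\qquad M,N ::= X \mid {`P}$$ (up to renaming of bound names and variables). Its labelled transition system has the usual rules for input $a(X).P\xrightarrow{a(M)}P\{M/X\}$, output, parallel composition, replication, communication, restriction and scope extrusion, together with $a[P]\xrightarrow{\alpha}a[P']$ whenever $P\xrightarrow{\alpha}P'$ (the bound names of $\alpha$ being different from $a$), $a[P]\xrightarrow{\bar a\langle `P\rangle}0$, and $\mathit{run}(`P)\xrightarrow{\tau}P$. Let $\Rightarrow$ be the reflexive transitive closure of $\xrightarrow{\tau}$, and let $\xRightarrow{\alpha}$ be ${\Rightarrow}\xrightarrow{\alpha}{\Rightarrow}$ for $\alpha\neq\tau$. Let $\equiv$ be structural congruence: the least congruence (on processes and terms) containing the commutative monoid laws of $\mid$ and $0$, ${!}P\equiv P\mid{!}P$, $\nu a.0\equiv 0$, $\nu a.\nu b.P\equiv\nu b.\nu a.P$, and $\nu a.(P\mid Q)\equiv P\mid\nu a.Q$ for $a\notin\mathit{fn}(P)$.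 An environmental relation $\mathcal X$ is a set of quadruples $(r,\mathcal E,P,Q)$, where $r$ is a finite set of names, $\mathcal E$ is a binary relation with finitely many free names on variable-closed terms, and $P,Q$ are variable-closed processes. For such $r$ and $\mathcal E$, let $(\mathcal E;r)^{\circ}$ be the set of pairs $(C[\tilde M],C[\tilde N])$ of variable-closed processes, where $C$ is a context with zero or more holes for terms, $\mathit{fn}(C)\subseteq r$, $C$ binds no name in $\mathit{fn}(\mathcal E,r)$, and $\tilde M\,\mathcal E\,\tilde N$; let $(\mathcal E;r)^{\star}=\mathcal E\cup\{(`P,`Q)\mid(P,Q)\in(\mathcal E;r)^{\circ}\}$. Write $\mathcal E_1,\mathcal E_2$ for the two projections of $\mathcal E$. Let $\mathcal X^{\star}$ be the set of $(r,\mathcal E,P,Q)$ such that $P\equiv\nu\tilde c.(P_0\mid P_1)$, $Q\equiv\nu\tilde d.(Q_0\mid Q_1)$, $(r',\mathcal E',P_0,Q_0)\in\mathcal X$, $(P_1,Q_1)\in(\mathcal E';r')^{\circ}$, $\mathcal E\subseteq(\mathcal E';r')^{\star}$, $r\subseteq r'$, $\{\tilde c\}\cap\mathit{fn}(r,\mathcal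 E_1)=\emptyset$ and $\{\tilde d\}\cap\mathit{fn}(r,\mathcal E_2)=\emptyset$, for some $\tilde c,\tilde d,P_0,Q_0,P_1,Q_1,r',\mathcal E'$. An environmental relation $\mathcal X$ is an environmental bisimulation up-to context if $(r,\mathcal E,P,Q)\in\mathcal X$ implies: 1. if $P\xrightarrow{\tau}P'$, then $Q\Rightarrow Q'$ and $(r,\mathcal E,P',Q')\in\mathcal X^{\star}$ for some $Q'$; 2. if $P\xrightarrow{a(M)}P'$ with $a\in r$ and $(M,N)\in(\mathcal E;r)^{\star}$, then $Q\xRightarrow{a(N)}Q'$ and $(r,\mathcal E,P',Q')\in\mathcal X^{\star}$ for some $Q'$; 3. if $P\xrightarrow{\nu\tilde b.\bar a\langle M\rangle}P'$ with $a\in r$ and $\{\tilde b\}\cap\mathit{fn}(r,\mathcal E_1)=\emptyset$, then $Q\xRightarrow{\nu\tilde c.\bar a\langle N\rangle}Q'$ with $\{\tilde c\}\cap\mathit{fn}(r,\mathcal E_2)=\emptyset$ and $(r,\{(M,N)\}\cup\mathcal E,P',Q')\in\mathcal X^{\star}$, for some $\tilde c,N,Q'$; 4. for all $(`P_1,`Q_1)\in\mathcal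 E$ and $a\in r$, $(r,\mathcal E,P\mid a[P_1],Q\mid a[Q_1])\in\mathcal X^{\star}$; 5. for all $n\notin\mathit{fn}(\mathcal E,P,Q)$, $(\{n\}\cup r,\mathcal E,P,Q)\in\mathcal X$; 6. the converses of 1, 2 and 3 for the transitions of $Q$. A process is simple if none of its subprocesses (including those inside quotations) has the form $\nu a.P$, or $a(X).P$ with $X$ free in $P$; $\mathcal X$ is simple if all the processes in all its environments are simple. Write $P\le Q$ if $P$ is obtained from $Q$ by replacing, possibly repeatedly, zero or more subprocesses $\mathit{run}(`R)$ with $R$, and similarly for terms; let $\mathcal X^{-}$ be the set of $(r,\mathcal E,P,Q)$ such that $P\le P'$, $Q\le Q'$ and $(r,{\le}\mathcal E{\ge},P',Q')\in\mathcal X^{\star}$ for some $P',Q'$, where ${\le}\mathcal E{\ge}=\{(M,N)\mid M\le M',\ N\le N',\ (M',N')\in\mathcal E\text{ for some }M',N'\}$. Reduction-closed barbed congruence $\approx_c$ is the largest symmetric relation $\mathcal R$ on variable-closed processes such that $P\mathrel{\mathcal R}Q$ implies: if $P\xrightarrow{\tau}P'$, then $Q\Rightarrow Q'$ and $P'\mathrel{\mathcal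 R}Q'$ for some $Q'$; if $P$ can input (respectively output) on a name $a$, then $Q\Rightarrow Q'$ for some $Q'$ that can input (respectively output) on $a$; and $C[P]\mathrel{\mathcal R}C[Q]$ for every context $C$ (possibly binding names of $P$ and $Q$) such that $C[P]$ and $C[Q]$ are variable-closed. **Corollary.** Let $\mathcal Y$ be a simple environmental bisimulation up-to context, let $a$ be a name and let $P,Q$ be processes. If $(\{a\}\cup\mathit{fn}(P,Q),\ \emptyset,\ \bar a\langle `P\rangle.0,\ \bar a\langle `Q\rangle.0)\in\mathcal Y^{-}$, then $P\approx_c Q$. -/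

import Mathlib

namespace HOPiP

/-! ## Syntax

Processes are taken up to renaming of bound names and variables: a bound name or a bound variable is
a de Bruijn index, a free name is an atom.  The usual named restriction is the derived operation
`nu a P` below. -/

/-- Names, used both for channels and for locations (a countably infinite set). -/
abbrev Name := ℕ

/-- An occurrence of a name: a free name, or a reference to an enclosing restriction. -/
inductive Chan where
  | free (a : Name)
  | bound (i : ℕ)

mutual
/-- `0`, `a(X).P`, `ā⟨M⟩.P`, `P | Q`, `a[P]`, `νa.P`, `!P` and `run(M)`; `inp` binds the variable
with index `0` and `new` binds the name with index `0`. -/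
inductive Proc where
  | nil
  | inp (a : Chan) (P : Proc)
  | out (a : Chan) (M : Term) (P : Proc)
  | par (P Q : Proc)
  | loc (a : Chan) (P : Proc)
  | new (P : Proc)
  | rep (P : Proc)
  | run (M : Term)
/-- A variable `X`, or a quoted process. -/
inductive Term where
  | var (i : ℕ)
  | quote (P : Proc)
end

def Chan.fn : Chan → Finset Name
  | .free a => {a}
  | .bound _ => ∅

mutual
/-- Free names. -/
def Proc.fn : Proc → Finset Name
  | .nil => ∅
  | .inp a P => a.fn ∪ P.fn
  | .out a M P => a.fn ∪ M.fn ∪ P.fn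
  | .par P Q => P.fn ∪ Q.fn
  | .loc a P => a.fn ∪ P.fn
  | .new P => P.fn
  | .rep P => P.fn
  | .run M => M.fn
def Term.fn : Term → Finset Name
  | .var _ => ∅
  | .quote P => P.fn
end

def Chan.Scoped (k : ℕ) : Chan → Prop
  | .free _ => True
  | .bound i => i < k

mutual
/-- All name indices point below `k` enclosing restrictions, all variable indices below `m`
enclosing inputs. -/
def Proc.Scoped : ℕ → ℕ → Proc → Prop
  | _, _, .nil => True
  | k, m, .inp a P => a.Scoped k ∧ P.Scoped k (m + 1)
  | k, m, .out a M P => a.Scoped k ∧ M.Scoped k m ∧ P.Scoped k m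
  | k, m, .par P Q => P.Scoped k m ∧ Q.Scoped k m
  | k, m, .loc a P => a.Scoped k ∧ P.Scoped k m
  | k, m, .new P => P.Scoped (k + 1) m
  | k, m, .rep P => P.Scoped k m
  | k, m, .run M => M.Scoped k m
def Term.Scoped : ℕ → ℕ → Term → Prop
  | _, m, .var i => i < m
  | k, m, .quote P => P.Scoped k m
end

/-- Variable-closed processes (with no dangling name index either). -/
def Proc.Closed (P : Proc) : Prop := P.Scoped 0 0

/-- Variable-closed terms. -/
def Term.Closed (M : Term) : Prop := M.Scoped 0 0

mutual
/-- Substitution of a closed term `M` for the variable with index `k`. -/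
def Proc.subst (M : Term) : ℕ → Proc → Proc
  | _, .nil => .nil
  | k, .inp a P => .inp a (P.subst M (k + 1))
  | k, .out a N P => .out a (Term.subst M k N) (P.subst M k)
  | k, .par P Q => .par (P.subst M k) (Q.subst M k)
  | k, .loc a P => .loc a (P.subst M k)
  | k, .new P => .new (P.subst M k)
  | k, .rep P => .rep (P.subst M k)
  | k, .run N => .run (Term.subst M k N)
def Term.subst (M : Term) : ℕ → Term → Term
  | k, .var i => if i = k then M else if k < i then .var (i - 1) else .var i
  | k, .quote P => .quote (P.subst M k)
end

/-- Abstraction of the free name `a` below `k` restrictions. -/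
def Chan.abs (a : Name) (k : ℕ) : Chan → Chan
  | .free b => if b = a then .bound k else .free b
  | .bound i => if i < k then .bound i else .bound (i + 1)

mutual
def Proc.abs (a : Name) : ℕ → Proc → Proc
  | _, .nil => .nil
  | k, .inp c P => .inp (c.abs a k) (P.abs a k)
  | k, .out c M P => .out (c.abs a k) (M.abs a k) (P.abs a k)
  | k, .par P Q => .par (P.abs a k) (Q.abs a k)
  | k, .loc c P => .loc (c.abs a k) (P.abs a k)
  | k, .new P => .new (P.abs a (k + 1))
  | k, .rep P => .rep (P.abs a k)
  | k, .run M => .run (M.abs a k)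
def Term.abs (a : Name) : ℕ → Term → Term
  | _, .var i => .var i
  | k, .quote P => .quote (P.abs a k)
end

/-- The restriction `νa.P` of a free name `a` of `P`. -/
def nu (a : Name) (P : Proc) : Proc := .new (P.abs a 0)

/-- `νb₁.….νbₙ.P`. -/
def nus (bs : List Name) (P : Proc) : Proc := bs.foldr nu P

/-! ## Labelled transitions -/

/-- The actions `τ`, `a(M)` and `(νb₁,…,bₙ) ā⟨M⟩`. -/
inductive Act where
  | tau
  | inp (a : Name) (M : Term)
  | out (bs : List Name) (a : Name) (M : Term)

/-- Bound names of an action. -/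
def Act.bn : Act → Finset Name
  | .tau => ∅
  | .inp _ _ => ∅
  | .out bs _ _ => bs.toFinset

/-- All names of an action. -/
def Act.names : Act → Finset Name
  | .tau => ∅
  | .inp a M => insert a M.fn
  | .out bs a M => insert a (bs.toFinset ∪ M.fn)

/-- The labelled transition system.  The condition in `transp` is the usual convention that bound
names of an action differ from the free names around it. -/
inductive Step : Proc → Act → Proc → Prop
  | inp (a : Name) (P : Proc) (M : Term) (hM : M.Closed) :
      Step (.inp (.free a) P) (.inp a M) (P.subst M 0)
  | out (a : Name) (M : Term) (P : Proc) :
      Step (.out (.free a) M P) (.out [] a M) P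
  | parL {P₁ P₂ P₁' : Proc} {α : Act} (h : Step P₁ α P₁') (hb : Disjoint α.bn P₂.fn) :
      Step (.par P₁ P₂) α (.par P₁' P₂)
  | parR {P₁ P₂ P₂' : Proc} {α : Act} (h : Step P₂ α P₂') (hb : Disjoint α.bn P₁.fn) :
      Step (.par P₁ P₂) α (.par P₁ P₂')
  | rep {P P' : Proc} {α : Act} (h : Step (.par (.rep P) P) α P') : Step (.rep P) α P'
  | reactL {P₁ P₂ P₁' P₂' : Proc} {bs : List Name} {a : Name} {M : Term}
      (h₁ : Step P₁ (.out bs a M) P₁') (h₂ : Step P₂ (.inp a M) P₂')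
      (hb : ∀ b ∈ bs, b ∉ P₂.fn) :
      Step (.par P₁ P₂) .tau (nus bs (.par P₁' P₂'))
  | reactR {P₁ P₂ P₁' P₂' : Proc} {bs : List Name} {a : Name} {M : Term}
      (h₁ : Step P₁ (.inp a M) P₁') (h₂ : Step P₂ (.out bs a M) P₂')
      (hb : ∀ b ∈ bs, b ∉ P₁.fn) :
      Step (.par P₁ P₂) .tau (nus bs (.par P₁' P₂'))
  | guard {P P' : Proc} {α : Act} {a : Name} (h : Step P α P') (ha : a ∉ α.names) :
      Step (nu a P) α (nu a P')
  | extr {P P' : Proc} {bs : List Name} {a c : Name} {M : Term}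
      (h : Step P (.out bs a M) P') (hca : c ≠ a) (hcM : c ∈ M.fn) (hcb : c ∉ bs) :
      Step (nu c P) (.out (bs ++ [c]) a M) P'
  | transp {P P' : Proc} {α : Act} {a : Name} (h : Step P α P') (ha : a ∉ α.bn) :
      Step (.loc (.free a) P) α (.loc (.free a) P')
  | passiv (a : Name) (P : Proc) :
      Step (.loc (.free a) P) (.out [] a (.quote P)) .nil
  | run (P : Proc) : Step (.run (.quote P)) .tau P

/-- Weak internal transitions: zero or more `τ` steps. -/
def Weak : Proc → Proc → Prop := Relation.ReflTransGen (fun P Q => Step P .tau Q)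

/-- Weak transitions for an action `α ≠ τ`. -/
def WeakAct (P : Proc) (α : Act) (Q : Proc) : Prop :=
  ∃ P₁ P₂, Weak P P₁ ∧ Step P₁ α P₂ ∧ Weak P₂ Q

/-! ## Structural congruence -/

mutual
/-- Structural congruence: the least congruence containing the commutative monoid laws of parallel
composition, unfolding of replication and the laws of restriction. -/
inductive SCong : Proc → Proc → Prop
  | refl (P : Proc) : SCong P P
  | symm {P Q : Proc} (h : SCong P Q) : SCong Q P
  | trans {P Q R : Proc} (h₁ : SCong P Q) (h₂ : SCong Q R) : SCong P R
  | parNil (P : Proc) : SCong (.par P .nil) P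
  | parComm (P Q : Proc) : SCong (.par P Q) (.par Q P)
  | parAssoc (P Q R : Proc) : SCong (.par (.par P Q) R) (.par P (.par Q R))
  | repUnfold (P : Proc) : SCong (.rep P) (.par P (.rep P))
  | nuNil (a : Name) : SCong (nu a .nil) .nil
  | nuSwap (a b : Name) (P : Proc) : SCong (nu a (nu b P)) (nu b (nu a P))
  | nuPar (a : Name) (P Q : Proc) (ha : a ∉ P.fn) :
      SCong (nu a (.par P Q)) (.par P (nu a Q))
  | inp (a : Chan) {P Q : Proc} (h : SCong P Q) : SCong (.inp a P) (.inp a Q)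
  | out (a : Chan) {M N : Term} {P Q : Proc} (hM : TSCong M N) (h : SCong P Q) :
      SCong (.out a M P) (.out a N Q)
  | par {P P' Q Q' : Proc} (h₁ : SCong P P') (h₂ : SCong Q Q') :
      SCong (.par P Q) (.par P' Q')
  | loc (a : Chan) {P Q : Proc} (h : SCong P Q) : SCong (.loc a P) (.loc a Q)
  | nu (a : Name) {P Q : Proc} (h : SCong P Q) : SCong (nu a P) (nu a Q)
  | rep {P Q : Proc} (h : SCong P Q) : SCong (.rep P) (.rep Q)
  | run {M N : Term} (h : TSCong M N) : SCong (.run M) (.run N)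
inductive TSCong : Term → Term → Prop
  | var (i : ℕ) : TSCong (.var i) (.var i)
  | quote {P Q : Proc} (h : SCong P Q) : TSCong (.quote P) (.quote Q)
end

/-! ## Environments and their context closures -/

/-- Environments: binary relations on terms. -/
abbrev Env := Set (Term × Term)

/-- Free names of the first projection of an environment. -/
def fnFst (E : Env) : Set Name := {n | ∃ p ∈ E, n ∈ p.1.fn}

/-- Free names of the second projection of an environment. -/
def fnSnd (E : Env) : Set Name := {n | ∃ p ∈ E, n ∈ p.2.fn}

/-- Free names of an environment. -/
def fnEnv (E : Env) : Set Name := fnFst E ∪ fnSnd E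

mutual
/-- `PCtxRel r E P Q`: there are a context `C` with holes for terms, with free names in `r`, and
sequences of terms related pointwise by `E`, such that filling the holes of `C` with the left (right)
terms gives `P` (`Q`).  A derivation is such a context: `hole` is a hole with the pair of terms filled
in.  Restrictions of `C` are nameless, so they capture no free name of a term put in a hole. -/
inductive PCtxRel (r : Finset Name) (E : Env) : Proc → Proc → Prop
  | nil : PCtxRel r E .nil .nil
  | inp {a : Chan} {P Q : Proc} (ha : a.fn ⊆ r) (h : PCtxRel r E P Q) :
      PCtxRel r E (.inp a P) (.inp a Q)
  | out {a : Chan} {M N : Term} {P Q : Proc} (ha : a.fn ⊆ r) (hM : TCtxRel r E M N)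
      (h : PCtxRel r E P Q) : PCtxRel r E (.out a M P) (.out a N Q)
  | par {P P' Q Q' : Proc} (h₁ : PCtxRel r E P Q) (h₂ : PCtxRel r E P' Q') :
      PCtxRel r E (.par P P') (.par Q Q')
  | loc {a : Chan} {P Q : Proc} (ha : a.fn ⊆ r) (h : PCtxRel r E P Q) :
      PCtxRel r E (.loc a P) (.loc a Q)
  | new {P Q : Proc} (h : PCtxRel r E P Q) : PCtxRel r E (.new P) (.new Q)
  | rep {P Q : Proc} (h : PCtxRel r E P Q) : PCtxRel r E (.rep P) (.rep Q)
  | run {M N : Term} (h : TCtxRel r E M N) : PCtxRel r E (.run M) (.run N)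
inductive TCtxRel (r : Finset Name) (E : Env) : Term → Term → Prop
  | hole {M N : Term} (h : (M, N) ∈ E) : TCtxRel r E M N
  | var (i : ℕ) : TCtxRel r E (.var i) (.var i)
  | quote {P Q : Proc} (h : PCtxRel r E P Q) : TCtxRel r E (.quote P) (.quote Q)
end

/-- The process context closure of `E` with known names `r`, on closed processes. -/
def ProcClosure (r : Finset Name) (E : Env) (P Q : Proc) : Prop :=
  PCtxRel r E P Q ∧ P.Closed ∧ Q.Closed

/-- The term context closure of `E`: the pairs in `E` and the quoted pairs of the process context
closure. -/
def TermClosure (r : Finset Name) (E : Env) (M N : Term) : Prop :=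
  (M, N) ∈ E ∨ ∃ P Q, M = .quote P ∧ N = .quote Q ∧ ProcClosure r E P Q

/-! ## Environmental bisimulations up-to context -/

/-- Sets of quadruples `(r, E, P, Q)`. -/
abbrev QuadRel := Finset Name → Env → Proc → Proc → Prop

/-- Environmental relations. -/
def IsEnvRel (X : QuadRel) : Prop :=
  ∀ r E P Q, X r E P Q →
    (∀ p ∈ E, p.1.Closed ∧ p.2.Closed) ∧ (fnEnv E).Finite ∧ P.Closed ∧ Q.Closed

/-- The up-to context closure of `X`: `P` and `Q` are, up to structural congruence and under
restrictions, parallel compositions of processes related by `X` with processes related by the process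
context closure. -/
def UpTo (X : QuadRel) : QuadRel := fun r E P Q =>
  ∃ (cs ds : List Name) (P₀ Q₀ P₁ Q₁ : Proc) (r' : Finset Name) (E' : Env),
    SCong P (nus cs (.par P₀ P₁)) ∧ SCong Q (nus ds (.par Q₀ Q₁)) ∧
    X r' E' P₀ Q₀ ∧ ProcClosure r' E' P₁ Q₁ ∧
    (∀ p ∈ E, TermClosure r' E' p.1 p.2) ∧ r ⊆ r' ∧
    (∀ c ∈ cs, c ∉ r ∧ c ∉ fnFst E) ∧ (∀ d ∈ ds, d ∉ r ∧ d ∉ fnSnd E)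

/-- Environmental bisimulations up-to context. -/
structure IsBisimUpTo (X : QuadRel) : Prop where
  envRel : IsEnvRel X
  tau : ∀ {r E P Q}, X r E P Q → ∀ {P'}, Step P .tau P' →
    ∃ Q', Weak Q Q' ∧ UpTo X r E P' Q'
  input : ∀ {r E P Q}, X r E P Q → ∀ {a M N P'}, Step P (.inp a M) P' → a ∈ r →
    TermClosure r E M N → ∃ Q', WeakAct Q (.inp a N) Q' ∧ UpTo X r E P' Q'
  output : ∀ {r E P Q}, X r E P Q → ∀ {bs a M P'}, Step P (.out bs a M) P' → a ∈ r →
    (∀ b ∈ bs, b ∉ r ∧ b ∉ fnFst E) →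
    ∃ cs N Q', WeakAct Q (.out cs a N) Q' ∧ (∀ c ∈ cs, c ∉ r ∧ c ∉ fnSnd E) ∧
      UpTo X r (insert (M, N) E) P' Q'
  spawn : ∀ {r E P Q}, X r E P Q → ∀ {P₁ Q₁ a}, (Term.quote P₁, Term.quote Q₁) ∈ E → a ∈ r →
    UpTo X r E (.par P (.loc (.free a) P₁)) (.par Q (.loc (.free a) Q₁))
  fresh : ∀ {r E P Q}, X r E P Q → ∀ {n}, n ∉ fnEnv E → n ∉ P.fn → n ∉ Q.fn →
    X (insert n r) E P Q
  tau_conv : ∀ {r E P Q}, X r E P Q → ∀ {Q'}, Step Q .tau Q' →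
    ∃ P', Weak P P' ∧ UpTo X r E P' Q'
  input_conv : ∀ {r E P Q}, X r E P Q → ∀ {a M N Q'}, Step Q (.inp a N) Q' → a ∈ r →
    TermClosure r E M N → ∃ P', WeakAct P (.inp a M) P' ∧ UpTo X r E P' Q'
  output_conv : ∀ {r E P Q}, X r E P Q → ∀ {bs a N Q'}, Step Q (.out bs a N) Q' → a ∈ r →
    (∀ b ∈ bs, b ∉ r ∧ b ∉ fnSnd E) →
    ∃ cs M P', WeakAct P (.out cs a M) P' ∧ (∀ c ∈ cs, c ∉ r ∧ c ∉ fnFst E) ∧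
      UpTo X r (insert (M, N) E) P' Q'

mutual
/-- The variable with index `k` occurs. -/
def Proc.Occurs : ℕ → Proc → Prop
  | _, .nil => False
  | k, .inp _ P => P.Occurs (k + 1)
  | k, .out _ M P => M.Occurs k ∨ P.Occurs k
  | k, .par P Q => P.Occurs k ∨ Q.Occurs k
  | k, .loc _ P => P.Occurs k
  | k, .new P => P.Occurs k
  | k, .rep P => P.Occurs k
  | k, .run M => M.Occurs k
def Term.Occurs : ℕ → Term → Prop
  | k, .var i => i = k
  | k, .quote P => P.Occurs k
end

mutual
/-- Simple processes: no subprocess is a restriction `νa.P`, or an input `a(X).P` with `X` free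
in `P`. -/
def Proc.Simple : Proc → Prop
  | .nil => True
  | .inp _ P => ¬ P.Occurs 0 ∧ P.Simple
  | .out _ M P => M.Simple ∧ P.Simple
  | .par P Q => P.Simple ∧ Q.Simple
  | .loc _ P => P.Simple
  | .new _ => False
  | .rep P => P.Simple
  | .run M => M.Simple
def Term.Simple : Term → Prop
  | .var _ => True
  | .quote P => P.Simple
end

/-- All environments of the relation are simple. -/
def IsSimpleRel (X : QuadRel) : Prop :=
  ∀ r E P Q, X r E P Q → ∀ p ∈ E, p.1.Simple ∧ p.2.Simple

mutual
/-- Run-erasure `P ≤ Q`: `P` is obtained from `Q` by replacing, possibly repeatedly, zero or more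
subprocesses of the form `run` of a quoted process `R` with `R`. -/
inductive Erase : Proc → Proc → Prop
  | erase {P R : Proc} (h : Erase P R) : Erase P (.run (.quote R))
  | nil : Erase .nil .nil
  | inp (a : Chan) {P Q : Proc} (h : Erase P Q) : Erase (.inp a P) (.inp a Q)
  | out (a : Chan) {M N : Term} {P Q : Proc} (hM : TErase M N) (h : Erase P Q) :
      Erase (.out a M P) (.out a N Q)
  | par {P P' Q Q' : Proc} (h₁ : Erase P P') (h₂ : Erase Q Q') : Erase (.par P Q) (.par P' Q')
  | loc (a : Chan) {P Q : Proc} (h : Erase P Q) : Erase (.loc a P) (.loc a Q)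
  | new {P Q : Proc} (h : Erase P Q) : Erase (.new P) (.new Q)
  | rep {P Q : Proc} (h : Erase P Q) : Erase (.rep P) (.rep Q)
  | run {M N : Term} (h : TErase M N) : Erase (.run M) (.run N)
inductive TErase : Term → Term → Prop
  | var (i : ℕ) : TErase (.var i) (.var i)
  | quote {P Q : Proc} (h : Erase P Q) : TErase (.quote P) (.quote Q)
end

/-- The relation composition `≤ E ≥`. -/
def eraseEnv (E : Env) : Env := {p | ∃ q ∈ E, TErase p.1 q.1 ∧ TErase p.2 q.2}

/-- The up-to context closure of `X`, further closed under run-erasure. -/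
def UpToRun (X : QuadRel) : QuadRel := fun r E P Q =>
  ∃ P' Q', Erase P P' ∧ Erase Q Q' ∧ UpTo X r (eraseEnv E) P' Q'

/-! ## Reduction-closed barbed congruence -/

/-- Contexts with a hole for a process, in any position; `nu a` captures the free name `a` of the
process in the hole. -/
inductive Ctx where
  | hole
  | inp (a : Name) (C : Ctx)
  | outCont (a : Name) (M : Term) (C : Ctx)
  | outMsg (a : Name) (C : Ctx) (R : Proc)
  | parL (C : Ctx) (R : Proc)
  | parR (R : Proc) (C : Ctx)
  | loc (a : Name) (C : Ctx)
  | nu (a : Name) (C : Ctx)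
  | rep (C : Ctx)
  | run (C : Ctx)

/-- `C[P]`, for a closed process `P`. -/
def Ctx.fill (P : Proc) : Ctx → Proc
  | .hole => P
  | .inp a C => .inp (.free a) (C.fill P)
  | .outCont a M C => .out (.free a) M (C.fill P)
  | .outMsg a C R => .out (.free a) (.quote (C.fill P)) R
  | .parL C R => .par (C.fill P) R
  | .parR R C => .par R (C.fill P)
  | .loc a C => .loc (.free a) (C.fill P)
  | .nu a C => HOPiP.nu a (C.fill P)
  | .rep C => .rep (C.fill P)
  | .run C => .run (.quote (C.fill P))

/-- `P` can input on `a`. -/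
def InBarb (P : Proc) (a : Name) : Prop := ∃ M P', Step P (.inp a M) P'

/-- `P` can output on `a`. -/
def OutBarb (P : Proc) (a : Name) : Prop := ∃ bs M P', Step P (.out bs a M) P'

/-- Symmetric relations on closed processes that are reduction-closed, preserve barbs, and are
preserved by all contexts. -/
structure IsBarbedCong (R : Proc → Proc → Prop) : Prop where
  closed : ∀ {P Q}, R P Q → P.Closed ∧ Q.Closed
  symm : ∀ {P Q}, R P Q → R Q P
  red : ∀ {P Q P'}, R P Q → Step P .tau P' → ∃ Q', Weak Q Q' ∧ R P' Q'
  inBarb : ∀ {P Q a}, R P Q → InBarb P a → ∃ Q', Weak Q Q' ∧ InBarb Q' a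
  outBarb : ∀ {P Q a}, R P Q → OutBarb P a → ∃ Q', Weak Q Q' ∧ OutBarb Q' a
  ctx : ∀ {P Q}, R P Q → ∀ C : Ctx, (C.fill P).Closed → (C.fill Q).Closed →
    R (C.fill P) (C.fill Q)

/-- Reduction-closed barbed congruence: the largest such relation. -/
def BarbedCong (P Q : Proc) : Prop := ∃ R, IsBarbedCong R ∧ R P Q

end HOPiP

/-!
The relation `LocRel Y` consists of the pairs of closed simple processes that `Y` relates inside a
location `l[·]`, with `l` a known name fresh for both. It is a weak bisimulation up to context, and the
messages of the two given outputs are in its contextual closure.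

*Why `LocRel Y` is a bisimulation.* A transition of `P` is one of `l[P]`, and `Y` answers it by a
transition of `l[Q]` into the up-to context closure `UpTo Y`. A process `l[P']` has a single top-level
component, and no restriction can reach it, so it cannot be split by the decomposition in `UpTo`
(`UpTo.split`): either `Y` relates the locations again, or the locations come from the context closure
of an environment for which `Y` relates null processes. In the latter case every quotation in the
environment can be spawned in a fresh location, and the same dichotomy applies to the result; as the
quotation depth decreases, `tcong_of_mem_env` concludes that the processes are in the contextual closure
of `LocRel Y`. Messages sent are added to the environment; passivation of `l` then leads to null
processes, and the same lemma applies (`UpTo.tcong_of_loc`). Simplicity enters three times: simple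
processes extrude no names, their inputs ignore the message received (so that no larger environment is
needed for inputs), and all their free names become observable, whence related processes have the same
free names (`LocRel.fn_trunc_subset`).

*Why it is preserved by contexts.* Equality of free names makes scope extrusion harmless: for a symmetric
bisimulation `B` up to context that preserves free names, the contextual closure `Clo B`, whose holes may
be under binders capturing names of the processes put in them, is a weak bisimulation up to structural
congruence (`Clo.matches`), because structural congruence is itself a strong bisimulation
(`SCong.sims`). The transitive closure of `Cong B` on closed processes is then a reduction-closed barbed
congruence (`Progressing.isBarbedCong`). Run-erasure is included in `Clo B`, since `run` of a
quotation reduces to the quoted process.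

*Conclusion.* The two outputs of the quoted `P` and `Q` are, up to run-erasure, in `UpTo Y`. After the
superfluous `run`s are executed, either the outputs are in the context closure of an environment with
null processes, or the outputs are performed and null processes are reached. Both ways the messages are
related by the contextual closure of `LocRel Y`.
-/

namespace HOPiP

/-! ### Renaming of name occurrences -/

/-- Shift of the references to restrictions, for passing below one more restriction. -/
def Chan.shift : Chan → Chan
  | .free a => .free a
  | .bound i => .bound (i + 1)

/-- The action below a restriction of a map on name occurrences. -/
def Chan.lift (f : Chan → Chan) : Chan → Chan
  | .free a => (f (.free a)).shift
  | .bound 0 => .bound 0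
  | .bound (i + 1) => (f (.bound i)).shift

mutual
/-- Replacement of all the name occurrences that are not bound in the process, by an arbitrary map.
Abstraction, opening of a restriction and permutation of free names are all of this form. -/
def Proc.ren (f : Chan → Chan) : Proc → Proc
  | .nil => .nil
  | .inp c P => .inp (f c) (P.ren f)
  | .out c M P => .out (f c) (M.ren f) (P.ren f)
  | .par P Q => .par (P.ren f) (Q.ren f)
  | .loc c P => .loc (f c) (P.ren f)
  | .new P => .new (P.ren (Chan.lift f))
  | .rep P => .rep (P.ren f)
  | .run M => .run (M.ren f)
/-- Renaming of the name occurrences of a term. -/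
def Term.ren (f : Chan → Chan) : Term → Term
  | .var i => .var i
  | .quote P => .quote (P.ren f)
end

theorem Chan.lift_comp (f g : Chan → Chan) :
    Chan.lift f ∘ Chan.lift g = Chan.lift (f ∘ g) := by
  have h : ∀ c : Chan, Chan.lift f c.shift = (f c).shift := by rintro (a | i) <;> rfl
  funext c
  rcases c with a | _ | i
  · exact h _
  · rfl
  · exact h _

theorem Chan.lift_id : Chan.lift id = id := by
  funext c
  rcases c with a | _ | i <;> rfl

mutual
theorem Proc.ren_ren (f g : Chan → Chan) : ∀ P : Proc, (P.ren g).ren f = P.ren (f ∘ g)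
  | .nil => rfl
  | .inp c P => by simp [Proc.ren, Proc.ren_ren f g P]
  | .out c M P => by simp [Proc.ren, Proc.ren_ren f g P, Term.ren_ren f g M]
  | .par P Q => by simp [Proc.ren, Proc.ren_ren f g P, Proc.ren_ren f g Q]
  | .loc c P => by simp [Proc.ren, Proc.ren_ren f g P]
  | .new P => by simp [Proc.ren, Proc.ren_ren (Chan.lift f) (Chan.lift g) P, Chan.lift_comp]
  | .rep P => by simp [Proc.ren, Proc.ren_ren f g P]
  | .run M => by simp [Proc.ren, Term.ren_ren f g M]
theorem Term.ren_ren (f g : Chan → Chan) : ∀ M : Term, (M.ren g).ren f = M.ren (f ∘ g)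
  | .var i => rfl
  | .quote P => by simp [Term.ren, Proc.ren_ren f g P]
end

mutual
theorem Proc.ren_id : ∀ P : Proc, P.ren id = P
  | .nil => rfl
  | .inp c P => by simp [Proc.ren, Proc.ren_id P]
  | .out c M P => by simp [Proc.ren, Proc.ren_id P, Term.ren_id M]
  | .par P Q => by simp [Proc.ren, Proc.ren_id P, Proc.ren_id Q]
  | .loc c P => by simp [Proc.ren, Proc.ren_id P]
  | .new P => by simp [Proc.ren, Proc.ren_id P, Chan.lift_id]
  | .rep P => by simp [Proc.ren, Proc.ren_id P]
  | .run M => by simp [Proc.ren, Term.ren_id M]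
theorem Term.ren_id : ∀ M : Term, M.ren id = M
  | .var i => rfl
  | .quote P => by simp [Term.ren, Proc.ren_id P]
end

theorem Chan.ren_congr {f g : Chan → Chan} {s : Finset Name}
    (hs : ∀ a ∈ s, f (.free a) = g (.free a)) (hb : ∀ i, f (.bound i) = g (.bound i)) {c : Chan}
    (hc : c.fn ⊆ s) : f c = g c := by
  rcases c with a | i
  · exact hs a (hc (by simp [Chan.fn]))
  · exact hb i

theorem Chan.lift_congr_bound {f g : Chan → Chan} (hb : ∀ i, f (.bound i) = g (.bound i)) :
    ∀ i, Chan.lift f (.bound i) = Chan.lift g (.bound i)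
  | 0 => rfl
  | i + 1 => by simp [Chan.lift, hb i]

mutual
theorem Proc.ren_congr_aux : ∀ (P : Proc) (f g : Chan → Chan) (s : Finset Name), P.fn ⊆ s →
    (∀ a ∈ s, f (.free a) = g (.free a)) → (∀ i, f (.bound i) = g (.bound i)) →
    P.ren f = P.ren g
  | .nil, _, _, _, _, _, _ => rfl
  | .inp c P, f, g, s, h, hs, hb => by
    simp only [Proc.fn, Finset.union_subset_iff] at h
    simp [Proc.ren, Proc.ren_congr_aux P f g s h.2 hs hb, Chan.ren_congr hs hb h.1]
  | .out c M P, f, g, s, h, hs, hb => by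
    simp only [Proc.fn, Finset.union_subset_iff] at h
    simp [Proc.ren, Proc.ren_congr_aux P f g s h.2 hs hb, Chan.ren_congr hs hb h.1.1,
      Term.ren_congr_aux M f g s h.1.2 hs hb]
  | .par P Q, f, g, s, h, hs, hb => by
    simp only [Proc.fn, Finset.union_subset_iff] at h
    simp [Proc.ren, Proc.ren_congr_aux P f g s h.1 hs hb, Proc.ren_congr_aux Q f g s h.2 hs hb]
  | .loc c P, f, g, s, h, hs, hb => by
    simp only [Proc.fn, Finset.union_subset_iff] at h
    simp [Proc.ren, Proc.ren_congr_aux P f g s h.2 hs hb, Chan.ren_congr hs hb h.1]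
  | .new P, f, g, s, h, hs, hb => by
    simp only [Proc.ren]
    rw [Proc.ren_congr_aux P (Chan.lift f) (Chan.lift g) s h
      (fun a ha => by simp [Chan.lift, hs a ha]) (Chan.lift_congr_bound hb)]
  | .rep P, f, g, s, h, hs, hb => by simp [Proc.ren, Proc.ren_congr_aux P f g s h hs hb]
  | .run M, f, g, s, h, hs, hb => by simp [Proc.ren, Term.ren_congr_aux M f g s h hs hb]
theorem Term.ren_congr_aux : ∀ (M : Term) (f g : Chan → Chan) (s : Finset Name), M.fn ⊆ s →
    (∀ a ∈ s, f (.free a) = g (.free a)) → (∀ i, f (.bound i) = g (.bound i)) →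
    M.ren f = M.ren g
  | .var _, _, _, _, _, _, _ => rfl
  | .quote P, f, g, s, h, hs, hb => by simp [Term.ren, Proc.ren_congr_aux P f g s h hs hb]
end

theorem Proc.ren_congr {P : Proc} {f g : Chan → Chan}
    (hs : ∀ a ∈ P.fn, f (.free a) = g (.free a)) (hb : ∀ i, f (.bound i) = g (.bound i)) :
    P.ren f = P.ren g := Proc.ren_congr_aux P f g _ subset_rfl hs hb

theorem Term.ren_congr {M : Term} {f g : Chan → Chan}
    (hs : ∀ a ∈ M.fn, f (.free a) = g (.free a)) (hb : ∀ i, f (.bound i) = g (.bound i)) :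
    M.ren f = M.ren g := Term.ren_congr_aux M f g _ subset_rfl hs hb

mutual
theorem Proc.ren_congr_scoped_aux : ∀ (P : Proc) (f g : Chan → Chan) (s : Finset Name) (k m : ℕ),
    P.Scoped k m → P.fn ⊆ s → (∀ a ∈ s, f (.free a) = g (.free a)) →
    (∀ i < k, f (.bound i) = g (.bound i)) → P.ren f = P.ren g
  | .nil, _, _, _, _, _, _, _, _, _ => rfl
  | .inp c P, f, g, s, k, m, hk, h, hs, hb => by
    simp only [Proc.fn, Finset.union_subset_iff] at h
    simp only [Proc.Scoped] at hk
    have hc : f c = g c := by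
      rcases c with a | i
      · exact hs a (h.1 (by simp [Chan.fn]))
      · exact hb i hk.1
    simp [Proc.ren, Proc.ren_congr_scoped_aux P f g s k _ hk.2 h.2 hs hb, hc]
  | .out c M P, f, g, s, k, m, hk, h, hs, hb => by
    simp only [Proc.fn, Finset.union_subset_iff] at h
    simp only [Proc.Scoped] at hk
    have hc : f c = g c := by
      rcases c with a | i
      · exact hs a (h.1.1 (by simp [Chan.fn]))
      · exact hb i hk.1
    simp [Proc.ren, Proc.ren_congr_scoped_aux P f g s k m hk.2.2 h.2 hs hb, hc,
      Term.ren_congr_scoped_aux M f g s k m hk.2.1 h.1.2 hs hb]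
  | .par P Q, f, g, s, k, m, hk, h, hs, hb => by
    simp only [Proc.fn, Finset.union_subset_iff] at h
    simp only [Proc.Scoped] at hk
    simp [Proc.ren, Proc.ren_congr_scoped_aux P f g s k m hk.1 h.1 hs hb,
      Proc.ren_congr_scoped_aux Q f g s k m hk.2 h.2 hs hb]
  | .loc c P, f, g, s, k, m, hk, h, hs, hb => by
    simp only [Proc.fn, Finset.union_subset_iff] at h
    simp only [Proc.Scoped] at hk
    have hc : f c = g c := by
      rcases c with a | i
      · exact hs a (h.1 (by simp [Chan.fn]))
      · exact hb i hk.1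
    simp [Proc.ren, Proc.ren_congr_scoped_aux P f g s k _ hk.2 h.2 hs hb, hc]
  | .new P, f, g, s, k, m, hk, h, hs, hb => by
    simp only [Proc.ren]
    rw [Proc.ren_congr_scoped_aux P (Chan.lift f) (Chan.lift g) s (k + 1) m hk h
      (fun a ha => by simp [Chan.lift, hs a ha]) ?_]
    rintro (_ | i) hi
    · rfl
    · simp [Chan.lift, hb i (by omega)]
  | .rep P, f, g, s, k, m, hk, h, hs, hb => by
    simp [Proc.ren, Proc.ren_congr_scoped_aux P f g s k m hk h hs hb]
  | .run M, f, g, s, k, m, hk, h, hs, hb => by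
    simp [Proc.ren, Term.ren_congr_scoped_aux M f g s k m hk h hs hb]
theorem Term.ren_congr_scoped_aux : ∀ (M : Term) (f g : Chan → Chan) (s : Finset Name) (k m : ℕ),
    M.Scoped k m → M.fn ⊆ s → (∀ a ∈ s, f (.free a) = g (.free a)) →
    (∀ i < k, f (.bound i) = g (.bound i)) → M.ren f = M.ren g
  | .var _, _, _, _, _, _, _, _, _, _ => rfl
  | .quote P, f, g, s, k, m, hk, h, hs, hb => by
    simp [Term.ren, Proc.ren_congr_scoped_aux P f g s k m hk h hs hb]
end

/-- On a process without dangling references to restrictions, a renaming is determined by its values on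
the free names. -/
theorem Proc.ren_congr_scoped {P : Proc} {m : ℕ} (hP : P.Scoped 0 m) {f g : Chan → Chan}
    (hs : ∀ a ∈ P.fn, f (.free a) = g (.free a)) : P.ren f = P.ren g :=
  Proc.ren_congr_scoped_aux P f g _ 0 m hP subset_rfl hs (by simp)

theorem Term.ren_congr_scoped {M : Term} {m : ℕ} (hM : M.Scoped 0 m) {f g : Chan → Chan}
    (hs : ∀ a ∈ M.fn, f (.free a) = g (.free a)) : M.ren f = M.ren g :=
  Term.ren_congr_scoped_aux M f g _ 0 m hM subset_rfl hs (by simp)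

theorem Chan.lift_abs (a : Name) (k : ℕ) :
    Chan.lift (Chan.abs a k) = Chan.abs a (k + 1) := by
  funext c
  rcases c with b | _ | i
  · by_cases h : b = a <;> simp [Chan.lift, Chan.abs, Chan.shift, h]
  · simp [Chan.lift, Chan.abs]
  · by_cases h : i < k <;> simp [Chan.lift, Chan.abs, Chan.shift, h]

mutual
theorem Proc.abs_eq_ren (a : Name) : ∀ (k : ℕ) (P : Proc), P.abs a k = P.ren (Chan.abs a k)
  | _, .nil => rfl
  | k, .inp c P => by simp [Proc.ren, Proc.abs, Proc.abs_eq_ren a k P]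
  | k, .out c M P => by
    simp [Proc.ren, Proc.abs, Proc.abs_eq_ren a k P, Term.abs_eq_ren a k M]
  | k, .par P Q => by simp [Proc.ren, Proc.abs, Proc.abs_eq_ren a k P, Proc.abs_eq_ren a k Q]
  | k, .loc c P => by simp [Proc.ren, Proc.abs, Proc.abs_eq_ren a k P]
  | k, .new P => by simp [Proc.ren, Proc.abs, Proc.abs_eq_ren a (k + 1) P, Chan.lift_abs]
  | k, .rep P => by simp [Proc.ren, Proc.abs, Proc.abs_eq_ren a k P]
  | k, .run M => by simp [Proc.ren, Proc.abs, Term.abs_eq_ren a k M]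
theorem Term.abs_eq_ren (a : Name) : ∀ (k : ℕ) (M : Term), M.abs a k = M.ren (Chan.abs a k)
  | _, .var i => rfl
  | k, .quote P => by simp [Term.ren, Term.abs, Proc.abs_eq_ren a k P]
end

theorem nu_eq (a : Name) (P : Proc) : nu a P = .new (P.ren (Chan.abs a 0)) := by
  rw [nu, Proc.abs_eq_ren]

/-- Instantiation of the outermost bound name by the free name `a`. -/
def Chan.opn (a : Name) : Chan → Chan
  | .free b => .free b
  | .bound 0 => .free a
  | .bound (i + 1) => .bound i

theorem Chan.opn_comp_abs (a : Name) : Chan.opn a ∘ Chan.abs a 0 = id := by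
  funext c
  rcases c with b | i
  · by_cases h : b = a <;> simp [Chan.opn, Chan.abs, h]
  · simp [Chan.opn, Chan.abs]

theorem Proc.opn_abs (a : Name) (P : Proc) :
    (P.ren (Chan.abs a 0)).ren (Chan.opn a) = P := by
  rw [Proc.ren_ren, Chan.opn_comp_abs, Proc.ren_id]

theorem Proc.abs_opn {a : Name} {P : Proc} (ha : a ∉ P.fn) :
    (P.ren (Chan.opn a)).ren (Chan.abs a 0) = P := by
  rw [Proc.ren_ren]
  conv_rhs => rw [← Proc.ren_id P]
  apply Proc.ren_congr
  · intro b hb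
    have : b ≠ a := fun h => ha (h ▸ hb)
    simp [Chan.opn, Chan.abs, this]
  · rintro (_ | i) <;> simp [Chan.opn, Chan.abs]

theorem new_eq_nu {a : Name} {P : Proc} (ha : a ∉ P.fn) :
    Proc.new P = nu a (P.ren (Chan.opn a)) := by
  rw [nu_eq, Proc.abs_opn ha]

theorem nu_injective {a : Name} {P Q : Proc} (h : nu a P = nu a Q) : P = Q := by
  rw [nu_eq, nu_eq] at h
  injection h with h
  rw [← Proc.opn_abs a P, h, Proc.opn_abs]

/-! ### Permutations of free names -/

/-- The action of a permutation of names on a name occurrence. -/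
def Chan.perm (π : Equiv.Perm Name) : Chan → Chan
  | .free a => .free (π a)
  | .bound i => .bound i

theorem Chan.lift_perm (π : Equiv.Perm Name) : Chan.lift (Chan.perm π) = Chan.perm π := by
  funext c
  rcases c with a | _ | i <;> rfl

/-- The action of a permutation of names on processes. -/
abbrev Proc.perm (π : Equiv.Perm Name) (P : Proc) : Proc := P.ren (Chan.perm π)

/-- The action of a permutation of names on terms. -/
abbrev Term.perm (π : Equiv.Perm Name) (M : Term) : Term := M.ren (Chan.perm π)

theorem Chan.perm_comp (π σ : Equiv.Perm Name) :
    Chan.perm π ∘ Chan.perm σ = Chan.perm (π * σ) := by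
  funext c
  rcases c with a | i <;> rfl

theorem Proc.perm_perm (π σ : Equiv.Perm Name) (P : Proc) :
    (P.perm σ).perm π = P.perm (π * σ) := by rw [Proc.perm, Proc.ren_ren, Chan.perm_comp]

theorem Term.perm_perm (π σ : Equiv.Perm Name) (M : Term) :
    (M.perm σ).perm π = M.perm (π * σ) := by rw [Term.perm, Term.ren_ren, Chan.perm_comp]

theorem Proc.perm_eq_self {π : Equiv.Perm Name} {P : Proc} (h : ∀ a ∈ P.fn, π a = a) :
    P.perm π = P := by
  conv_rhs => rw [← Proc.ren_id P]
  exact Proc.ren_congr (fun a ha => by simp [Chan.perm, h a ha]) (fun i => rfl)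

theorem Term.perm_eq_self {π : Equiv.Perm Name} {M : Term} (h : ∀ a ∈ M.fn, π a = a) :
    M.perm π = M := by
  conv_rhs => rw [← Term.ren_id M]
  exact Term.ren_congr (fun a ha => by simp [Chan.perm, h a ha]) (fun i => rfl)

theorem Proc.perm_one (P : Proc) : P.perm 1 = P := Proc.perm_eq_self (by simp)

theorem Term.perm_one (M : Term) : M.perm 1 = M := Term.perm_eq_self (by simp)

theorem Proc.perm_inv_perm (π : Equiv.Perm Name) (P : Proc) : (P.perm π).perm π⁻¹ = P := by
  rw [Proc.perm_perm, inv_mul_cancel, Proc.perm_one]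

theorem Proc.perm_perm_inv (π : Equiv.Perm Name) (P : Proc) : (P.perm π⁻¹).perm π = P := by
  rw [Proc.perm_perm, mul_inv_cancel, Proc.perm_one]

theorem Term.perm_inv_perm (π : Equiv.Perm Name) (M : Term) : (M.perm π).perm π⁻¹ = M := by
  rw [Term.perm_perm, inv_mul_cancel, Term.perm_one]

theorem Term.perm_perm_inv (π : Equiv.Perm Name) (M : Term) : (M.perm π⁻¹).perm π = M := by
  rw [Term.perm_perm, mul_inv_cancel, Term.perm_one]

/-! ### Free names and scoping under renaming -/

mutual
theorem Proc.mem_fn_ren : ∀ (P : Proc) (f : Chan → Chan) (b : Name),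
    (∀ i c, f (.bound i) = .free c → c ≠ b) →
    (b ∈ (P.ren f).fn ↔ ∃ a ∈ P.fn, f (.free a) = .free b)
  | .nil, f, b, h => by simp [Proc.ren, Proc.fn]
  | .inp c P, f, b, h => by
    simp only [Proc.ren, Proc.fn, Finset.mem_union, Chan.mem_fn_map f b h c,
      Proc.mem_fn_ren P f b h]
    grind
  | .out c M P, f, b, h => by
    simp only [Proc.ren, Proc.fn, Finset.mem_union, Chan.mem_fn_map f b h c,
      Proc.mem_fn_ren P f b h, Term.mem_fn_ren M f b h]
    grind
  | .par P Q, f, b, h => by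
    simp only [Proc.ren, Proc.fn, Finset.mem_union, Proc.mem_fn_ren P f b h,
      Proc.mem_fn_ren Q f b h]
    grind
  | .loc c P, f, b, h => by
    simp only [Proc.ren, Proc.fn, Finset.mem_union, Chan.mem_fn_map f b h c,
      Proc.mem_fn_ren P f b h]
    grind
  | .new P, f, b, h => by
    have hs : ∀ (x : Chan) (c : Name), x.shift = .free c ↔ x = .free c := by
      rintro (a | i) c <;> simp [Chan.shift]
    simp only [Proc.ren, Proc.fn]
    rw [Proc.mem_fn_ren P (Chan.lift f) b]
    · simp [Chan.lift, hs]
    · rintro (_ | i) c hc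
      · cases hc
      · exact h i c ((hs _ _).1 hc)
  | .rep P, f, b, h => by simp only [Proc.ren, Proc.fn, Proc.mem_fn_ren P f b h]
  | .run M, f, b, h => by simp only [Proc.ren, Proc.fn, Term.mem_fn_ren M f b h]
theorem Term.mem_fn_ren : ∀ (M : Term) (f : Chan → Chan) (b : Name),
    (∀ i c, f (.bound i) = .free c → c ≠ b) →
    (b ∈ (M.ren f).fn ↔ ∃ a ∈ M.fn, f (.free a) = .free b)
  | .var i, f, b, h => by simp [Term.ren, Term.fn]
  | .quote P, f, b, h => by simp only [Term.ren, Term.fn, Proc.mem_fn_ren P f b h]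
theorem Chan.mem_fn_map (f : Chan → Chan) (b : Name) (h : ∀ i c, f (.bound i) = .free c → c ≠ b) :
    ∀ c : Chan, b ∈ (f c).fn ↔ ∃ a ∈ c.fn, f (.free a) = .free b
  | .free a => by
    cases hf : f (.free a) <;> simp [Chan.fn, hf, eq_comm]
  | .bound i => by
    cases hf : f (.bound i) with
    | free c => simpa [Chan.fn, eq_comm] using h i c hf
    | bound j => simp [Chan.fn]
end

theorem Proc.mem_fn_perm {π : Equiv.Perm Name} {P : Proc} {b : Name} :
    b ∈ (P.perm π).fn ↔ π⁻¹ b ∈ P.fn := by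
  rw [Proc.mem_fn_ren _ _ _ (by simp [Chan.perm])]
  constructor
  · rintro ⟨a, ha, h⟩
    simp only [Chan.perm, Chan.free.injEq] at h
    simpa [← h] using ha
  · intro h
    exact ⟨_, h, by simp [Chan.perm]⟩

theorem Term.mem_fn_perm {π : Equiv.Perm Name} {M : Term} {b : Name} :
    b ∈ (M.perm π).fn ↔ π⁻¹ b ∈ M.fn := by
  rcases M with i | P
  · simp [Term.ren, Term.fn]
  · simpa [Term.ren, Term.fn] using Proc.mem_fn_perm (P := P)

theorem Proc.apply_mem_fn_perm {π : Equiv.Perm Name} {P : Proc} {b : Name} :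
    π b ∈ (P.perm π).fn ↔ b ∈ P.fn := by simp [Proc.mem_fn_perm]

theorem Term.apply_mem_fn_perm {π : Equiv.Perm Name} {M : Term} {b : Name} :
    π b ∈ (M.perm π).fn ↔ b ∈ M.fn := by simp [Term.mem_fn_perm]

theorem fn_nu (a : Name) (P : Proc) : (nu a P).fn = P.fn.erase a := by
  ext b
  rw [nu_eq, Proc.fn, Proc.mem_fn_ren _ _ _ (by simp [Chan.abs]), Finset.mem_erase]
  constructor
  · rintro ⟨c, hc, h⟩
    by_cases hca : c = a <;> simp [Chan.abs, hca] at h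
    exact h ▸ ⟨hca, hc⟩
  · rintro ⟨h, hb⟩
    exact ⟨b, hb, by simp [Chan.abs, h]⟩

theorem mem_fn_nu {a b : Name} {P : Proc} : b ∈ (nu a P).fn ↔ b ≠ a ∧ b ∈ P.fn := by
  rw [fn_nu, Finset.mem_erase]

theorem mem_fn_nus {b : Name} {P : Proc} : ∀ {bs : List Name},
    b ∈ (nus bs P).fn ↔ b ∉ bs ∧ b ∈ P.fn
  | [] => by simp [nus]
  | c :: bs => by
    have := mem_fn_nus (b := b) (P := P) (bs := bs)
    simp only [nus, List.foldr_cons, mem_fn_nu, List.mem_cons, not_or] at this ⊢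
    rw [this]; tauto

theorem nus_cons (c : Name) (bs : List Name) (P : Proc) : nus (c :: bs) P = nu c (nus bs P) := rfl

theorem nus_append (bs cs : List Name) (P : Proc) : nus (bs ++ cs) P = nus bs (nus cs P) := by
  simp [nus]

theorem perm_nu (π : Equiv.Perm Name) (a : Name) (P : Proc) :
    (nu a P).perm π = nu (π a) (P.perm π) := by
  simp only [nu_eq, Proc.perm, Proc.ren, Chan.lift_perm, Proc.ren_ren]
  congr 2
  funext c
  rcases c with b | i
  · by_cases h : b = a <;> simp [Chan.abs, Chan.perm, h]
  · simp [Chan.abs, Chan.perm]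

theorem perm_nus (π : Equiv.Perm Name) (P : Proc) : ∀ bs : List Name,
    (nus bs P).perm π = nus (bs.map π) (P.perm π)
  | [] => rfl
  | b :: bs => by rw [nus_cons, perm_nu, perm_nus π P bs]; rfl

/-- Conversion of a restricted name to a fresh one. -/
theorem nu_alpha {a b : Name} {P : Proc} (hb : b ∉ (nu a P).fn) :
    nu a P = nu b (P.perm (Equiv.swap a b)) := by
  conv_lhs => rw [← Proc.perm_eq_self (π := Equiv.swap a b) (P := nu a P) (by
    intro c hc
    rw [Equiv.swap_apply_of_ne_of_ne]
    · exact (mem_fn_nu.1 hc).1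
    · rintro rfl; exact hb hc)]
  rw [perm_nu, Equiv.swap_apply_left]

theorem nu_eq_nu {a b : Name} {P Q : Proc} (h : nu a P = nu b Q) :
    Q = P.perm (Equiv.swap a b) := by
  have hb : b ∉ (nu a P).fn := by rw [h, fn_nu]; simp
  exact nu_injective (h.symm.trans (nu_alpha hb))

theorem Chan.scoped_mono {k k' : ℕ} (hk : k ≤ k') {c : Chan} (h : c.Scoped k) : c.Scoped k' := by
  rcases c with a | i
  · trivial
  · exact lt_of_lt_of_le h hk

mutual
theorem Proc.scoped_mono : ∀ (P : Proc) {k k' m m' : ℕ}, k ≤ k' → m ≤ m' → P.Scoped k m →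
    P.Scoped k' m'
  | .nil, _, _, _, _, _, _, _ => trivial
  | .inp _ P, _, _, _, _, hk, hm, h =>
    ⟨Chan.scoped_mono hk h.1, P.scoped_mono hk (Nat.succ_le_succ hm) h.2⟩
  | .out _ M P, _, _, _, _, hk, hm, h =>
    ⟨Chan.scoped_mono hk h.1, M.scoped_mono hk hm h.2.1, P.scoped_mono hk hm h.2.2⟩
  | .par P Q, _, _, _, _, hk, hm, h => ⟨P.scoped_mono hk hm h.1, Q.scoped_mono hk hm h.2⟩
  | .loc _ P, _, _, _, _, hk, hm, h => ⟨Chan.scoped_mono hk h.1, P.scoped_mono hk hm h.2⟩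
  | .new P, _, _, _, _, hk, hm, h => P.scoped_mono (k := _ + 1) (Nat.succ_le_succ hk) hm h
  | .rep P, k, _, m, _, hk, hm, h => P.scoped_mono (k := k) (m := m) hk hm h
  | .run M, k, _, m, _, hk, hm, h => M.scoped_mono (k := k) (m := m) hk hm h
theorem Term.scoped_mono : ∀ (M : Term) {k k' m m' : ℕ}, k ≤ k' → m ≤ m' → M.Scoped k m →
    M.Scoped k' m'
  | .var _, _, _, _, _, _, hm, h => lt_of_lt_of_le (α := ℕ) h hm
  | .quote P, k, _, m, _, hk, hm, h => P.scoped_mono (k := k) (m := m) hk hm h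
end

theorem Chan.scoped_lift {f : Chan → Chan} {k k' : ℕ}
    (h : ∀ c : Chan, (f c).Scoped k' ↔ c.Scoped k) (c : Chan) :
    (Chan.lift f c).Scoped (k' + 1) ↔ c.Scoped (k + 1) := by
  have hs : ∀ x : Chan, x.shift.Scoped (k' + 1) ↔ x.Scoped k' := by
    rintro (a | i) <;> simp [Chan.shift, Chan.Scoped]
  rcases c with a | _ | i
  · exact (hs _).trans (h _)
  · simp [Chan.lift, Chan.Scoped]
  · exact ((hs _).trans (h _)).trans Nat.succ_lt_succ_iff.symm

mutual
theorem Proc.scoped_ren : ∀ (P : Proc) {f : Chan → Chan} {k k' m : ℕ},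
    (∀ c : Chan, (f c).Scoped k' ↔ c.Scoped k) → ((P.ren f).Scoped k' m ↔ P.Scoped k m)
  | .nil, _, _, _, _, _ => by simp [Proc.ren, Proc.Scoped]
  | .inp c P, _, _, _, _, h => by simp [Proc.ren, Proc.Scoped, h, P.scoped_ren h]
  | .out c M P, _, _, _, _, h => by
    simp [Proc.ren, Proc.Scoped, h, P.scoped_ren h, M.scoped_ren h]
  | .par P Q, _, _, _, _, h => by simp [Proc.ren, Proc.Scoped, P.scoped_ren h, Q.scoped_ren h]
  | .loc c P, _, _, _, _, h => by simp [Proc.ren, Proc.Scoped, h, P.scoped_ren h]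
  | .new P, _, _, _, _, h => by
    simp [Proc.ren, Proc.Scoped, P.scoped_ren (Chan.scoped_lift h)]
  | .rep P, _, _, _, _, h => by simp [Proc.ren, Proc.Scoped, P.scoped_ren h]
  | .run M, _, _, _, _, h => by simp [Proc.ren, Proc.Scoped, M.scoped_ren h]
theorem Term.scoped_ren : ∀ (M : Term) {f : Chan → Chan} {k k' m : ℕ},
    (∀ c : Chan, (f c).Scoped k' ↔ c.Scoped k) → ((M.ren f).Scoped k' m ↔ M.Scoped k m)
  | .var i, _, _, _, _, _ => by simp [Term.ren, Term.Scoped]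
  | .quote P, _, _, _, _, h => by simp [Term.ren, Term.Scoped, P.scoped_ren h]
end

theorem Term.scoped_perm {π : Equiv.Perm Name} {M : Term} {k m : ℕ} :
    (M.perm π).Scoped k m ↔ M.Scoped k m :=
  M.scoped_ren (by rintro (a | i) <;> simp [Chan.perm, Chan.Scoped])

theorem scoped_nu {a : Name} {P : Proc} {k m : ℕ} :
    (nu a P).Scoped k m ↔ P.Scoped k m := by
  rw [nu_eq, Proc.Scoped]
  refine P.scoped_ren ?_
  rintro (b | i)
  · by_cases h : b = a <;> simp [Chan.abs, Chan.Scoped, h]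
  · simp [Chan.abs, Chan.Scoped]

theorem scoped_nus {P : Proc} {k m : ℕ} : ∀ {bs : List Name},
    (nus bs P).Scoped k m ↔ P.Scoped k m
  | [] => Iff.rfl
  | b :: bs => by rw [nus_cons, scoped_nu, scoped_nus]

/-! ### Substitution -/

mutual
theorem Proc.ren_subst_of_scoped (M : Term) : ∀ (P : Proc) (f : Chan → Chan) {j k m : ℕ},
    P.Scoped j m → m ≤ k → (P.ren f).subst M k = P.ren f
  | .nil, _, _, _, _, _, _ => rfl
  | .inp _ P, f, _, _, _, h, hk => by
    simp [Proc.ren, Proc.subst, P.ren_subst_of_scoped M f h.2 (Nat.succ_le_succ hk)]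
  | .out _ N P, f, _, _, _, h, hk => by
    simp [Proc.ren, Proc.subst, P.ren_subst_of_scoped M f h.2.2 hk,
      Term.ren_subst_of_scoped M N f h.2.1 hk]
  | .par P Q, f, _, _, _, h, hk => by
    simp [Proc.ren, Proc.subst, P.ren_subst_of_scoped M f h.1 hk,
      Q.ren_subst_of_scoped M f h.2 hk]
  | .loc _ P, f, _, _, _, h, hk => by
    simp [Proc.ren, Proc.subst, P.ren_subst_of_scoped M f h.2 hk]
  | .new P, f, j, _, m, h, hk => by
    simp [Proc.ren, Proc.subst, P.ren_subst_of_scoped M _ (j := j + 1) (m := m) h hk]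
  | .rep P, f, j, _, m, h, hk => by
    simp [Proc.ren, Proc.subst, P.ren_subst_of_scoped M f (j := j) (m := m) h hk]
  | .run N, f, j, _, m, h, hk => by
    simp [Proc.ren, Proc.subst, Term.ren_subst_of_scoped M N f (j := j) (m := m) h hk]
theorem Term.ren_subst_of_scoped (M : Term) : ∀ (N : Term) (f : Chan → Chan) {j k m : ℕ},
    N.Scoped j m → m ≤ k → Term.subst M k (N.ren f) = N.ren f
  | .var i, _, _, k, m, h, hk => by
    have h : i < m := h
    simp [Term.ren, Term.subst, show i ≠ k by omega, show ¬ k < i by omega]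
  | .quote P, f, j, _, m, h, hk => by
    simp [Term.ren, Term.subst, P.ren_subst_of_scoped M f (j := j) (m := m) h hk]
end

theorem Proc.subst_of_scoped (M : Term) (P : Proc) {j k m : ℕ} (h : P.Scoped j m) (hk : m ≤ k) :
    P.subst M k = P := by
  simpa only [Proc.ren_id] using P.ren_subst_of_scoped M id h hk

theorem Chan.lift_free {f : Chan → Chan} {a : Name} (h : ∃ b, f (.free a) = .free b) :
    Chan.lift f (.free a) = f (.free a) := by
  obtain ⟨b, hb⟩ := h
  simp [Chan.lift, hb, Chan.shift]

theorem Term.ren_lift {M : Term} {m : ℕ} (hM : M.Scoped 0 m) {f : Chan → Chan}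
    (hf : ∀ a ∈ M.fn, ∃ b, f (.free a) = .free b) : M.ren (Chan.lift f) = M.ren f :=
  Term.ren_congr_scoped hM fun a ha => Chan.lift_free (hf a ha)

mutual
theorem Proc.ren_subst {M : Term} (hM : M.Closed) : ∀ (P : Proc) (f : Chan → Chan) (k : ℕ),
    (∀ a ∈ M.fn, ∃ b, f (.free a) = .free b) →
    (P.subst M k).ren f = (P.ren f).subst (M.ren f) k
  | .nil, _, _, _ => rfl
  | .inp _ P, f, k, hf => by simp [Proc.subst, Proc.ren, Proc.ren_subst hM P f _ hf]
  | .out _ N P, f, k, hf => by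
    simp [Proc.subst, Proc.ren, Proc.ren_subst hM P f _ hf, Term.ren_subst hM N f _ hf]
  | .par P Q, f, k, hf => by
    simp [Proc.subst, Proc.ren, Proc.ren_subst hM P f _ hf, Proc.ren_subst hM Q f _ hf]
  | .loc _ P, f, k, hf => by simp [Proc.subst, Proc.ren, Proc.ren_subst hM P f _ hf]
  | .new P, f, k, hf => by
    simp only [Proc.subst, Proc.ren]
    rw [Proc.ren_subst hM P (Chan.lift f) k, Term.ren_lift hM hf]
    intro a ha
    obtain ⟨b, hb⟩ := hf a ha
    exact ⟨b, by rw [Chan.lift_free ⟨b, hb⟩, hb]⟩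
  | .rep P, f, k, hf => by simp [Proc.subst, Proc.ren, Proc.ren_subst hM P f _ hf]
  | .run N, f, k, hf => by simp [Proc.subst, Proc.ren, Term.ren_subst hM N f _ hf]
theorem Term.ren_subst {M : Term} (hM : M.Closed) : ∀ (N : Term) (f : Chan → Chan) (k : ℕ),
    (∀ a ∈ M.fn, ∃ b, f (.free a) = .free b) →
    (Term.subst M k N).ren f = Term.subst (M.ren f) k (N.ren f)
  | .var i, f, k, hf => by
    simp only [Term.subst, Term.ren]
    split_ifs <;> simp [Term.ren]
  | .quote P, f, k, hf => by simp [Term.subst, Term.ren, Proc.ren_subst hM P f _ hf]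
end

theorem Proc.perm_subst {M : Term} (hM : M.Closed) (P : Proc) (π : Equiv.Perm Name) (k : ℕ) :
    (P.subst M k).perm π = (P.perm π).subst (M.perm π) k :=
  Proc.ren_subst hM P _ k fun a _ => ⟨π a, rfl⟩

/-- Substitution of a closed term commutes with restriction of a name that is not free in the term. -/
theorem subst_nu {M : Term} (hM : M.Closed) {a : Name} (ha : a ∉ M.fn) (P : Proc) (k : ℕ) :
    (nu a P).subst M k = nu a (P.subst M k) := by
  have h : ∀ b ∈ M.fn, Chan.abs a 0 (.free b) = .free b := fun b hb => by
    have : b ≠ a := fun h => ha (h ▸ hb)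
    simp [Chan.abs, this]
  rw [nu_eq, nu_eq, Proc.subst, Proc.ren_subst hM P _ k fun b hb => ⟨b, h b hb⟩,
    Term.ren_congr_scoped hM (g := id) h, Term.ren_id]

mutual
theorem Proc.fn_subst_subset (M : Term) : ∀ (P : Proc) (k : ℕ), (P.subst M k).fn ⊆ P.fn ∪ M.fn
  | .nil, _ => by simp [Proc.subst, Proc.fn]
  | .inp _ P, k => by
    have := P.fn_subst_subset M (k + 1); simp only [Proc.subst, Proc.fn]; grind
  | .out _ N P, k => by
    have := P.fn_subst_subset M k; have := Term.fn_subst_subset M N k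
    simp only [Proc.subst, Proc.fn]; grind
  | .par P Q, k => by
    have := P.fn_subst_subset M k; have := Q.fn_subst_subset M k
    simp only [Proc.subst, Proc.fn]; grind
  | .loc _ P, k => by
    have := P.fn_subst_subset M k; simp only [Proc.subst, Proc.fn]; grind
  | .new P, k => P.fn_subst_subset M k
  | .rep P, k => P.fn_subst_subset M k
  | .run N, k => Term.fn_subst_subset M N k
theorem Term.fn_subst_subset (M : Term) : ∀ (N : Term) (k : ℕ), (Term.subst M k N).fn ⊆ N.fn ∪ M.fn
  | .var i, k => by
    simp only [Term.subst]
    split_ifs <;> simp [Term.fn]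
  | .quote P, k => P.fn_subst_subset M k
end

mutual
theorem Proc.scoped_subst {M : Term} (hM : M.Closed) : ∀ (P : Proc) {j k : ℕ},
    P.Scoped j (k + 1) → (P.subst M k).Scoped j k
  | .nil, _, _, _ => trivial
  | .inp _ P, _, _, h => ⟨h.1, P.scoped_subst hM h.2⟩
  | .out _ N P, _, _, h => ⟨h.1, Term.scoped_subst hM N h.2.1, P.scoped_subst hM h.2.2⟩
  | .par P Q, _, _, h => ⟨P.scoped_subst hM h.1, Q.scoped_subst hM h.2⟩
  | .loc _ P, _, _, h => ⟨h.1, P.scoped_subst hM h.2⟩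
  | .new P, j, _, h => P.scoped_subst hM (j := j + 1) h
  | .rep P, j, _, h => P.scoped_subst hM (j := j) h
  | .run N, j, _, h => Term.scoped_subst hM N (j := j) h
theorem Term.scoped_subst {M : Term} (hM : M.Closed) : ∀ (N : Term) {j k : ℕ},
    N.Scoped j (k + 1) → (Term.subst M k N).Scoped j k
  | .var i, j, k, h => by
    have h : i < k + 1 := h
    simp only [Term.subst]
    split_ifs
    · exact M.scoped_mono (Nat.zero_le _) (Nat.zero_le _) hM
    · omega
    · exact (show i < k by omega)
  | .quote P, j, _, h => P.scoped_subst hM (j := j) h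
end

theorem exists_fresh (s : Finset Name) : ∃ n : Name, n ∉ s := Infinite.exists_notMem_finset s

/-- A permutation that moves the names of `bs` away from `s` and fixes the other names of `s`. -/
theorem exists_perm_avoid (s : Finset Name) : ∀ bs : List Name,
    ∃ π : Equiv.Perm Name, (∀ b ∈ bs, π b ∉ s) ∧ ∀ n ∈ s, n ∉ bs → π n = n
  | [] => ⟨1, by simp, by simp⟩
  | c :: bs => by
    obtain ⟨π, h₁, h₂⟩ := exists_perm_avoid s bs
    by_cases hc : π c ∈ s
    · obtain ⟨d, hd⟩ := exists_fresh (s ∪ (c :: bs).toFinset.image π)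
      simp only [Finset.mem_union, Finset.mem_image, List.mem_toFinset, not_or, not_exists,
        not_and] at hd
      refine ⟨Equiv.swap (π c) d * π, ?_, ?_⟩
      · intro b hb
        by_cases hbc : b = c
        · subst hbc; simpa using hd.1
        · have hb' : b ∈ bs := by simpa [hbc] using hb
          rw [Equiv.Perm.mul_apply, Equiv.swap_apply_of_ne_of_ne]
          · exact h₁ b hb'
          · exact fun h => hbc (π.injective h)
          · exact hd.2 b hb
      · intro n hn hnb
        simp only [List.mem_cons, not_or] at hnb
        rw [Equiv.Perm.mul_apply, h₂ n hn hnb.2, Equiv.swap_apply_of_ne_of_ne]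
        · intro h
          apply hnb.1
          apply π.injective
          rw [← h, h₂ n hn hnb.2]
        · rintro rfl; exact hd.1 hn
    · refine ⟨π, ?_, fun n hn hnb => h₂ n hn fun h => hnb (List.mem_cons_of_mem _ h)⟩
      intro b hb
      rcases List.mem_cons.1 hb with rfl | hb
      · exact hc
      · exact h₁ b hb

/-! ### Structural congruence: invariants and closure properties -/

theorem TSCong.refl : ∀ M : Term, TSCong M M
  | .var i => .var i
  | .quote P => .quote (.refl P)

theorem TSCong.symm {M N : Term} : TSCong M N → TSCong N M
  | .var i => .var i
  | .quote h => .quote h.symm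

theorem TSCong.trans {L M N : Term} : TSCong L M → TSCong M N → TSCong L N
  | .var i, .var _ => .var i
  | .quote h, .quote h' => .quote (h.trans h')

theorem SCong.nilPar (P : Proc) : SCong (.par .nil P) P := (SCong.parComm _ _).trans (.parNil _)

mutual
theorem SCong.fn_eq {P Q : Proc} : SCong P Q → P.fn = Q.fn
  | .refl _ => rfl
  | .symm h => h.fn_eq.symm
  | .trans h₁ h₂ => h₁.fn_eq.trans h₂.fn_eq
  | .parNil _ => by simp [Proc.fn]
  | .parComm _ _ => Finset.union_comm _ _
  | .parAssoc _ _ _ => Finset.union_assoc _ _ _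
  | .repUnfold _ => by simp [Proc.fn]
  | .nuNil a => by simp [fn_nu, Proc.fn]
  | .nuSwap a b P => by simp only [fn_nu, Finset.erase_right_comm]
  | .nuPar a P Q ha => by
    simp only [fn_nu, Proc.fn, Finset.erase_union_distrib, Finset.erase_eq_of_notMem ha]
  | .inp _ h => by simp only [Proc.fn, h.fn_eq]
  | .out _ hM h => by simp only [Proc.fn, h.fn_eq, hM.fn_eq]
  | .par h₁ h₂ => by simp only [Proc.fn, h₁.fn_eq, h₂.fn_eq]
  | .loc _ h => by simp only [Proc.fn, h.fn_eq]
  | .nu a h => by simp only [fn_nu, h.fn_eq]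
  | .rep h => h.fn_eq (P := _)
  | .run h => h.fn_eq (M := _)
theorem TSCong.fn_eq {M N : Term} : TSCong M N → M.fn = N.fn
  | .var _ => rfl
  | .quote h => h.fn_eq (P := _)
end

mutual
theorem SCong.scoped_iff {P Q : Proc} : SCong P Q → ∀ k m : ℕ, P.Scoped k m ↔ Q.Scoped k m
  | .refl _ => fun _ _ => Iff.rfl
  | .symm h => fun k m => (h.scoped_iff k m).symm
  | .trans h₁ h₂ => fun k m => (h₁.scoped_iff k m).trans (h₂.scoped_iff k m)
  | .parNil _ => fun _ _ => by simp [Proc.Scoped]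
  | .parComm _ _ => fun _ _ => and_comm
  | .parAssoc _ _ _ => fun _ _ => and_assoc
  | .repUnfold _ => fun _ _ => by simp [Proc.Scoped]
  | .nuNil a => fun _ _ => by simp [scoped_nu, Proc.Scoped]
  | .nuSwap a b P => fun _ _ => by simp only [scoped_nu]
  | .nuPar a P Q ha => fun _ _ => by simp only [scoped_nu, Proc.Scoped]
  | .inp _ h => fun k m => by simp only [Proc.Scoped, h.scoped_iff k (m + 1)]
  | .out _ hM h => fun k m => by simp only [Proc.Scoped, h.scoped_iff k m, hM.scoped_iff k m]
  | .par h₁ h₂ => fun k m => by simp only [Proc.Scoped, h₁.scoped_iff k m, h₂.scoped_iff k m]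
  | .loc _ h => fun k m => by simp only [Proc.Scoped, h.scoped_iff k m]
  | .nu a h => fun k m => by simp only [scoped_nu, h.scoped_iff k m]
  | .rep h => fun k m => by simp only [Proc.Scoped, h.scoped_iff k m]
  | .run h => fun k m => by simp only [Proc.Scoped, h.scoped_iff k m]
theorem TSCong.scoped_iff {M N : Term} : TSCong M N → ∀ k m : ℕ, M.Scoped k m ↔ N.Scoped k m
  | .var _ => fun _ _ => Iff.rfl
  | .quote h => fun k m => by simp only [Term.Scoped, h.scoped_iff k m]
end

theorem SCong.closed_iff {P Q : Proc} (h : SCong P Q) : P.Closed ↔ Q.Closed := h.scoped_iff 0 0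

theorem TSCong.closed_iff {M N : Term} (h : TSCong M N) : M.Closed ↔ N.Closed := h.scoped_iff 0 0

/-- The map `f` with `a` sent to the free name `c` instead. -/
def Chan.upd (f : Chan → Chan) (a c : Name) : Chan → Chan
  | .free b => if b = a then .free c else f (.free b)
  | .bound i => f (.bound i)

theorem Chan.abs_of_ne {c : Name} {x : Chan} (h : x ≠ .free c) : Chan.abs c 0 x = x.shift := by
  rcases x with b | i
  · have : b ≠ c := fun e => h (by rw [e])
    simp [Chan.abs, Chan.shift, this]
  · simp [Chan.abs, Chan.shift]

/-- Renaming under a restriction; the restricted name becomes any name `c` that is not hit by the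
renaming. -/
theorem nu_ren {f : Chan → Chan} {a c : Name} {P : Proc}
    (hc : ∀ b ∈ P.fn, b ≠ a → f (.free b) ≠ .free c) (hb : ∀ i, f (.bound i) ≠ .free c) :
    (nu a P).ren f = nu c (P.ren (Chan.upd f a c)) := by
  simp only [nu_eq, Proc.ren, Proc.ren_ren]
  congr 1
  apply Proc.ren_congr
  · intro b hbP
    by_cases h : b = a
    · simp [Chan.upd, Chan.abs, h, Chan.lift]
    · simp only [Function.comp, Chan.upd, h, if_false, Chan.abs_of_ne (hc b hbP h)]
      simp [Chan.abs, h, Chan.lift]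
  · intro i
    simp only [Function.comp, Chan.upd, Chan.abs_of_ne (hb i)]
    simp [Chan.abs, Chan.lift]

/-- Only finitely many names are the images of references to restrictions, so that there are fresh
names for `f` even on processes with dangling references. -/
def Chan.FinBound (f : Chan → Chan) : Prop := ∃ s : Finset Name, ∀ i b, f (.bound i) = .free b → b ∈ s

theorem Chan.FinBound.upd {f : Chan → Chan} (h : FinBound f) (a c : Name) :
    FinBound (Chan.upd f a c) := h

theorem Chan.FinBound.exists_fresh {f : Chan → Chan} (h : FinBound f) (s t : Finset Name) :
    ∃ c : Name, c ∉ t ∧ (∀ b ∈ s, f (.free b) ≠ .free c) ∧ ∀ i, f (.bound i) ≠ .free c := by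
  obtain ⟨u, hu⟩ := h
  obtain ⟨c, hc⟩ := HOPiP.exists_fresh (t ∪ u ∪ s.biUnion fun b => (f (.free b)).fn)
  simp only [Finset.mem_union, Finset.mem_biUnion, not_or, not_exists, not_and] at hc
  refine ⟨c, hc.1.1, fun b hb h => hc.2 b hb ?_, fun i h => hc.1.2 (hu i c h)⟩
  simp [h, Chan.fn]

mutual
theorem Proc.exists_scoped : ∀ P : Proc, ∃ k m, P.Scoped k m
  | .nil => ⟨0, 0, trivial⟩
  | .inp c P => by
    obtain ⟨k, m, h⟩ := P.exists_scoped
    obtain ⟨j, hj⟩ := c.exists_scoped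
    exact ⟨j + k, m, Chan.scoped_mono (by omega) hj, P.scoped_mono (by omega) (by omega) h⟩
  | .out c M P => by
    obtain ⟨k, m, h⟩ := P.exists_scoped
    obtain ⟨k', m', h'⟩ := M.exists_scoped
    obtain ⟨j, hj⟩ := c.exists_scoped
    exact ⟨j + k + k', m + m', Chan.scoped_mono (by omega) hj,
      M.scoped_mono (by omega) (by omega) h', P.scoped_mono (by omega) (by omega) h⟩
  | .par P Q => by
    obtain ⟨k, m, h⟩ := P.exists_scoped
    obtain ⟨k', m', h'⟩ := Q.exists_scoped
    exact ⟨k + k', m + m', P.scoped_mono (by omega) (by omega) h,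
      Q.scoped_mono (by omega) (by omega) h'⟩
  | .loc c P => by
    obtain ⟨k, m, h⟩ := P.exists_scoped
    obtain ⟨j, hj⟩ := c.exists_scoped
    exact ⟨j + k, m, Chan.scoped_mono (by omega) hj, P.scoped_mono (by omega) (by omega) h⟩
  | .new P => by
    obtain ⟨k, m, h⟩ := P.exists_scoped
    exact ⟨k, m, P.scoped_mono (k := k) (by omega) le_rfl h⟩
  | .rep P => P.exists_scoped
  | .run M => M.exists_scoped
theorem Term.exists_scoped : ∀ M : Term, ∃ k m, M.Scoped k m
  | .var i => ⟨0, i + 1, Nat.lt_succ_self i⟩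
  | .quote P => P.exists_scoped
theorem Chan.exists_scoped : ∀ c : Chan, ∃ k, c.Scoped k
  | .free _ => ⟨0, trivial⟩
  | .bound i => ⟨i + 1, Nat.lt_succ_self i⟩
end

mutual
/-- Structural congruence is preserved by simultaneous renaming and substitution.  The statement
quantifies over the renaming so that a restricted name can be refreshed along the way. -/
theorem SCong.ren_subst {M : Term} (hM : M.Closed) {P Q : Proc} : SCong P Q →
    ∀ (f : Chan → Chan) (k : ℕ), Chan.FinBound f →
      SCong ((P.ren f).subst M k) ((Q.ren f).subst M k)
  | .refl _ => fun _ _ _ => .refl _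
  | .symm h => fun f k hf => (h.ren_subst hM f k hf).symm
  | .trans h₁ h₂ => fun f k hf => (h₁.ren_subst hM f k hf).trans (h₂.ren_subst hM f k hf)
  | .parNil _ => fun _ _ _ => .parNil _
  | .parComm _ _ => fun _ _ _ => .parComm _ _
  | .parAssoc _ _ _ => fun _ _ _ => .parAssoc _ _ _
  | .repUnfold _ => fun _ _ _ => .repUnfold _
  | .nuNil a => fun _ _ _ => .nuNil a
  | .nuSwap a b P => fun f k hf => by
    by_cases hab : a = b
    · subst hab; exact .refl _
    obtain ⟨c, hcM, hc, hc'⟩ := hf.exists_fresh P.fn M.fn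
    obtain ⟨d, hdM, hd, hd'⟩ := hf.exists_fresh P.fn (insert c M.fn)
    simp only [Finset.mem_insert, not_or] at hdM
    rw [nu_ren (c := c) (fun x hx _ => hc x (mem_fn_nu.1 hx).2) hc',
      nu_ren (a := b) (c := d) (f := Chan.upd f a c) (P := P) _ hd',
      nu_ren (c := d) (fun x hx _ => hd x (mem_fn_nu.1 hx).2) hd',
      nu_ren (a := a) (c := c) (f := Chan.upd f b d) (P := P) _ hc', subst_nu hM hcM, subst_nu hM hdM.2, subst_nu hM hdM.2, subst_nu hM hcM]
    · have : Chan.upd (Chan.upd f a c) b d = Chan.upd (Chan.upd f b d) a c := by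
        funext x
        rcases x with x | i
        · by_cases hxa : x = a
          · subst hxa; simp [Chan.upd, hab]
          · simp [Chan.upd, hxa]
        · rfl
      rw [this]
      exact .nuSwap _ _ _
    · intro x hx hxa
      by_cases hxb : x = b
      · simp [Chan.upd, hxb, hdM.1]
      · simp [Chan.upd, hxb, hc x hx]
    · intro x hx hxb
      by_cases hxa : x = a
      · simp [Chan.upd, hxa, Ne.symm hdM.1]
      · simp [Chan.upd, hxa, hd x hx]
  | .nuPar a P Q ha => fun f k hf => by
    obtain ⟨c, hcM, hc, hc'⟩ := hf.exists_fresh (P.fn ∪ Q.fn) M.fn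
    rw [nu_ren (P := .par P Q) (c := c) (fun x hx _ => hc x hx) hc', subst_nu hM hcM]
    simp only [Proc.ren, Proc.subst]
    rw [nu_ren (c := c) (fun x hx _ => hc x (Finset.mem_union_right _ hx)) hc', subst_nu hM hcM]
    have : P.ren (Chan.upd f a c) = P.ren f := Proc.ren_congr (fun b hb => by
      have : b ≠ a := fun h => ha (h ▸ hb)
      simp [Chan.upd, this]) (fun i => rfl)
    rw [this]
    refine .nuPar _ _ _ fun h => ?_
    rcases Finset.mem_union.1 (Proc.fn_subst_subset M _ k h) with h | h
    · rw [Proc.mem_fn_ren _ _ _ fun i d hd (e : d = c) => hc' i (by rw [hd, e])] at h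
      obtain ⟨b, hb, h⟩ := h
      exact hc b (Finset.mem_union_left _ hb) h
    · exact hcM h
  | .inp _ h => fun f k hf => .inp _ (h.ren_subst hM f (k + 1) hf)
  | .out _ hN h => fun f k hf => .out _ (hN.ren_subst hM f k hf) (h.ren_subst hM f k hf)
  | .par h₁ h₂ => fun f k hf => .par (h₁.ren_subst hM f k hf) (h₂.ren_subst hM f k hf)
  | .loc _ h => fun f k hf => .loc _ (h.ren_subst hM f k hf)
  | .nu (P := P) (Q := Q) a h => fun f k hf => by
    obtain ⟨c, hcM, hc, hc'⟩ := hf.exists_fresh (P.fn ∪ Q.fn) M.fn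
    rw [nu_ren (c := c) (fun x hx _ => hc x (Finset.mem_union_left _ hx)) hc',
      nu_ren (c := c) (fun x hx _ => hc x (Finset.mem_union_right _ hx)) hc',
      subst_nu hM hcM, subst_nu hM hcM]
    exact .nu _ (h.ren_subst hM _ k (hf.upd a c))
  | .rep h => fun f k hf => .rep (h.ren_subst hM f k hf)
  | .run h => fun f k hf => .run (h.ren_subst hM f k hf)
theorem TSCong.ren_subst {M : Term} (hM : M.Closed) {L N : Term} : TSCong L N →
    ∀ (f : Chan → Chan) (k : ℕ), Chan.FinBound f →
      TSCong (Term.subst M k (L.ren f)) (Term.subst M k (N.ren f))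
  | .var _ => fun _ _ _ => .refl _
  | .quote h => fun f k hf => .quote (h.ren_subst hM f k hf)
end

theorem SCong.ren {P Q : Proc} (h : SCong P Q) {f : Chan → Chan} (hf : Chan.FinBound f) :
    SCong (P.ren f) (Q.ren f) := by
  -- Substitution for a variable that does not occur is the identity.
  obtain ⟨k, m, h₁⟩ := (P.ren f).exists_scoped
  obtain ⟨k', m', h₂⟩ := (Q.ren f).exists_scoped
  have := h.ren_subst (M := .quote .nil) trivial f (m + m') hf
  rwa [Proc.subst_of_scoped _ _ h₁ (by omega), Proc.subst_of_scoped _ _ h₂ (by omega)] at this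

theorem Chan.finBound_perm (π : Equiv.Perm Name) : Chan.FinBound (Chan.perm π) :=
  ⟨∅, fun _ _ h => by cases h⟩

theorem Chan.finBound_opn (a : Name) : Chan.FinBound (Chan.opn a) :=
  ⟨{a}, by rintro (_ | i) b h <;> simp_all [Chan.opn]⟩

theorem SCong.perm {P Q : Proc} (h : SCong P Q) (π : Equiv.Perm Name) :
    SCong (P.perm π) (Q.perm π) := h.ren (Chan.finBound_perm π)

theorem TSCong.perm {M N : Term} (h : TSCong M N) (π : Equiv.Perm Name) :
    TSCong (M.perm π) (N.perm π) := by
  cases h with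
  | var i => exact .var i
  | quote h => exact .quote (h.perm π)

theorem SCong.subst {M : Term} (hM : M.Closed) {P Q : Proc} (h : SCong P Q) (k : ℕ) :
    SCong (P.subst M k) (Q.subst M k) := by
  simpa only [Proc.ren_id] using h.ren_subst hM id k ⟨∅, fun _ _ h => by cases h⟩

/-- Structural congruence is a congruence for nameless restrictions too. -/
theorem SCong.new {P Q : Proc} (h : SCong P Q) : SCong (.new P) (.new Q) := by
  obtain ⟨a, ha⟩ := exists_fresh (P.fn ∪ Q.fn)
  simp only [Finset.mem_union, not_or] at ha
  rw [new_eq_nu ha.1, new_eq_nu ha.2]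
  exact .nu a (h.ren (Chan.finBound_opn a))

mutual
theorem Proc.subst_scong {M N : Term} (h : TSCong M N) : ∀ (P : Proc) (k : ℕ),
    SCong (P.subst M k) (P.subst N k)
  | .nil, _ => .refl _
  | .inp _ P, k => .inp _ (P.subst_scong h (k + 1))
  | .out _ L P, k => .out _ (Term.subst_scong h L k) (P.subst_scong h k)
  | .par P Q, k => .par (P.subst_scong h k) (Q.subst_scong h k)
  | .loc _ P, k => .loc _ (P.subst_scong h k)
  | .new P, k => .new (P.subst_scong h k)
  | .rep P, k => .rep (P.subst_scong h k)
  | .run L, k => .run (Term.subst_scong h L k)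
theorem Term.subst_scong {M N : Term} (h : TSCong M N) : ∀ (L : Term) (k : ℕ),
    TSCong (Term.subst M k L) (Term.subst N k L)
  | .var i, k => by
    simp only [Term.subst]
    split_ifs
    · exact h
    · exact .refl _
    · exact .refl _
  | .quote P, k => .quote (P.subst_scong h k)
end

/-! ### Laws of restriction -/

theorem SCong.nus {P Q : Proc} (h : SCong P Q) : ∀ bs : List Name, SCong (nus bs P) (nus bs Q)
  | [] => h
  | b :: bs => .nu b (h.nus bs)

theorem SCong.nus_perm {P : Proc} {bs cs : List Name} (h : bs.Perm cs) :
    SCong (HOPiP.nus bs P) (HOPiP.nus cs P) := by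
  induction h with
  | nil => exact .refl _
  | cons b _ ih => exact .nu b ih
  | swap b c l => exact .nuSwap c b _
  | trans _ _ ih₁ ih₂ => exact ih₁.trans ih₂

theorem SCong.nu_of_notMem {a : Name} {P : Proc} (ha : a ∉ P.fn) : SCong (HOPiP.nu a P) P :=
  (SCong.nu a (SCong.parNil P).symm).trans <| (SCong.nuPar a P .nil ha).trans <|
    (SCong.par (.refl P) (.nuNil a)).trans (.parNil P)

theorem SCong.nus_of_notMem {P : Proc} : ∀ {bs : List Name}, (∀ b ∈ bs, b ∉ P.fn) →
    SCong (HOPiP.nus bs P) P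
  | [], _ => .refl _
  | b :: _, h =>
    (SCong.nu b (SCong.nus_of_notMem fun c hc => h c (List.mem_cons_of_mem _ hc))).trans
      (SCong.nu_of_notMem (h b List.mem_cons_self))

/-- Scope extrusion to the left, for several names. -/
theorem SCong.nus_par {P Q : Proc} : ∀ {bs : List Name}, (∀ b ∈ bs, b ∉ P.fn) →
    SCong (HOPiP.nus bs (.par P Q)) (.par P (HOPiP.nus bs Q))
  | [], _ => .refl _
  | b :: _, h =>
    (SCong.nu b (SCong.nus_par fun c hc => h c (List.mem_cons_of_mem _ hc))).trans
      (.nuPar b _ _ (h b List.mem_cons_self))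

theorem SCong.nus_par_right {P Q : Proc} {bs : List Name} (h : ∀ b ∈ bs, b ∉ Q.fn) :
    SCong (HOPiP.nus bs (.par P Q)) (.par (HOPiP.nus bs P) Q) :=
  ((SCong.parComm _ _).nus bs).trans <| (SCong.nus_par h).trans (.parComm _ _)

theorem SCong.nu_nus (a : Name) (bs : List Name) (P : Proc) :
    SCong (HOPiP.nu a (HOPiP.nus bs P)) (HOPiP.nus bs (HOPiP.nu a P)) := by
  have h := SCong.nus_perm (P := P) (List.perm_append_singleton a bs)
  rw [nus_append] at h
  exact h.symm

/-! ### Transitions: free names, scoping and permutations of names -/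

/-- The action of a permutation of names on actions. -/
def Act.perm (π : Equiv.Perm Name) : Act → Act
  | .tau => .tau
  | .inp a M => .inp (π a) (M.perm π)
  | .out bs a M => .out (bs.map π) (π a) (M.perm π)

theorem Act.apply_mem_bn_perm {π : Equiv.Perm Name} {α : Act} {a : Name} :
    π a ∈ (α.perm π).bn ↔ a ∈ α.bn := by
  cases α <;> simp [Act.perm, Act.bn]

theorem Act.apply_mem_names_perm {π : Equiv.Perm Name} {α : Act} {a : Name} :
    π a ∈ (α.perm π).names ↔ a ∈ α.names := by
  cases α <;> simp [Act.perm, Act.names, Term.apply_mem_fn_perm]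

theorem Act.perm_eq_self {π : Equiv.Perm Name} {α : Act} (h : ∀ a ∈ α.names, π a = a) :
    α.perm π = α := by
  rcases α with _ | ⟨a, M⟩ | ⟨bs, a, M⟩
  · rfl
  · simp only [Act.names, Finset.mem_insert, forall_eq_or_imp] at h
    simp only [Act.perm, h.1, Term.perm_eq_self h.2]
  · simp only [Act.names, Finset.mem_insert, forall_eq_or_imp, Finset.mem_union,
      List.mem_toFinset] at h
    simp only [Act.perm, h.1, Term.perm_eq_self fun c hc => h.2 c (.inr hc)]
    rw [List.map_congr_left (g := id) fun b hb => h.2 b (.inl hb), List.map_id]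

theorem Act.bn_subset_names (α : Act) : α.bn ⊆ α.names := by
  cases α <;> simp only [Act.bn, Act.names] <;> grind

theorem Step.perm (π : Equiv.Perm Name) {P P' : Proc} {α : Act} (h : Step P α P') :
    Step (P.perm π) (α.perm π) (P'.perm π) := by
  have disj : ∀ {α : Act} {P : Proc}, Disjoint α.bn P.fn → Disjoint (α.perm π).bn (P.perm π).fn := by
    intro α P h
    rw [Finset.disjoint_left] at h ⊢
    intro b hb hb'
    obtain ⟨c, rfl⟩ := π.surjective b
    exact h (Act.apply_mem_bn_perm.1 hb) (Proc.apply_mem_fn_perm.1 hb')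
  have disj' : ∀ {bs : List Name} {P : Proc}, (∀ b ∈ bs, b ∉ P.fn) →
      ∀ b ∈ bs.map π, b ∉ (P.perm π).fn := by
    intro bs P h b hb
    obtain ⟨c, hc, rfl⟩ := List.mem_map.1 hb
    exact fun h' => h c hc (Proc.apply_mem_fn_perm.1 h')
  induction h with
  | inp a P M hM =>
    rw [Proc.perm_subst hM]
    exact .inp _ _ _ (Term.scoped_perm.2 hM)
  | out a M P => exact .out _ _ _
  | parL h hb ih => exact .parL ih (disj hb)
  | parR h hb ih => exact .parR ih (disj hb)
  | rep h ih => exact .rep ih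
  | reactL h₁ h₂ hb ih₁ ih₂ =>
    rw [perm_nus]
    exact .reactL ih₁ ih₂ (disj' hb)
  | reactR h₁ h₂ hb ih₁ ih₂ =>
    rw [perm_nus]
    exact .reactR ih₁ ih₂ (disj' hb)
  | guard h ha ih =>
    rw [perm_nu, perm_nu]
    exact .guard ih (fun h => ha (Act.apply_mem_names_perm.1 h))
  | extr h hca hcM hcb ih =>
    rw [perm_nu]
    have := Step.extr ih (c := π _) (fun h => hca (π.injective h))
      (Term.apply_mem_fn_perm.2 hcM) (by simpa using hcb)
    simpa [Act.perm] using this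
  | transp h ha ih => exact .transp ih (fun h => ha (Act.apply_mem_bn_perm.1 h))
  | passiv a P => exact .passiv _ _
  | run P => exact .run _

/-- What a transition with a given action between processes with free names `s` and `t` says about
free names. -/
def Act.FnSpec (s t : Finset Name) : Act → Prop
  | .tau => t ⊆ s
  | .inp a M => a ∈ s ∧ t ⊆ s ∪ M.fn
  | .out bs a M => a ∈ s ∧ (∀ b ∈ bs, b ∉ s) ∧ (∀ x ∈ M.fn, x ∈ s ∨ x ∈ bs) ∧
      ∀ x ∈ t, x ∈ s ∨ x ∈ bs

theorem Step.fnSpec {P P' : Proc} {α : Act} (h : Step P α P') : α.FnSpec P.fn P'.fn := by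
  induction h with
  | inp a P M hM =>
    have := P.fn_subst_subset M 0
    simp only [Act.FnSpec, Proc.fn, Chan.fn]
    grind
  | out a M P =>
    simp only [Act.FnSpec, Proc.fn, Chan.fn]
    grind
  | @parL _ _ _ α h hb ih =>
    cases α <;> simp only [Act.FnSpec, Proc.fn, Act.bn, Finset.disjoint_left,
      List.mem_toFinset] at * <;> grind
  | @parR _ _ _ α h hb ih =>
    cases α <;> simp only [Act.FnSpec, Proc.fn, Act.bn, Finset.disjoint_left,
      List.mem_toFinset] at * <;> grind
  | @rep _ _ α h ih =>
    cases α <;> simp only [Act.FnSpec, Proc.fn] at * <;> grind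
  | reactL h₁ h₂ hb ih₁ ih₂ =>
    simp only [Act.FnSpec, Proc.fn] at *
    intro x hx
    rw [mem_fn_nus] at hx
    simp only [Proc.fn] at hx
    grind
  | reactR h₁ h₂ hb ih₁ ih₂ =>
    simp only [Act.FnSpec, Proc.fn] at *
    intro x hx
    rw [mem_fn_nus] at hx
    simp only [Proc.fn] at hx
    grind
  | @guard _ _ α _ h ha ih =>
    cases α <;> simp only [Act.FnSpec, fn_nu, Act.names] at * <;> grind
  | extr h hca hcM hcb ih =>
    simp only [Act.FnSpec, fn_nu] at *
    grind
  | @transp _ _ α _ h ha ih =>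
    cases α <;> simp only [Act.FnSpec, Proc.fn, Chan.fn, Act.bn] at * <;>
      grind [List.mem_toFinset]
  | passiv a P =>
    simp only [Act.FnSpec, Proc.fn, Term.fn, Chan.fn]
    grind
  | run P => exact subset_rfl

theorem Step.fn_subset {P P' : Proc} {α : Act} (h : Step P α P') : P'.fn ⊆ P.fn ∪ α.names := by
  have := h.fnSpec
  cases α <;> simp only [Act.FnSpec, Act.names] at * <;> grind [List.mem_toFinset]

theorem Step.bn_disjoint {P P' : Proc} {α : Act} (h : Step P α P') : Disjoint α.bn P.fn := by
  have := h.fnSpec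
  cases α <;> simp only [Act.FnSpec, Act.bn, Finset.disjoint_left] at * <;>
    grind [List.mem_toFinset]

theorem Step.closed {P P' : Proc} {α : Act} (h : Step P α P') (hP : P.Closed) :
    P'.Closed ∧ ∀ bs a M, α = .out bs a M → M.Closed := by
  unfold Proc.Closed at *
  induction h with
  | inp a P M hM => exact ⟨P.scoped_subst hM hP.2, by simp⟩
  | out a M P => exact ⟨hP.2.2, by rintro _ _ _ ⟨⟩; exact hP.2.1⟩
  | parL h hb ih => exact ⟨⟨(ih hP.1).1, hP.2⟩, (ih hP.1).2⟩
  | parR h hb ih => exact ⟨⟨hP.1, (ih hP.2).1⟩, (ih hP.2).2⟩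
  | rep h ih => exact ih ⟨hP, hP⟩
  | reactL h₁ h₂ hb ih₁ ih₂ => exact ⟨scoped_nus.2 ⟨(ih₁ hP.1).1, (ih₂ hP.2).1⟩, by simp⟩
  | reactR h₁ h₂ hb ih₁ ih₂ => exact ⟨scoped_nus.2 ⟨(ih₁ hP.1).1, (ih₂ hP.2).1⟩, by simp⟩
  | guard h ha ih =>
    have := ih (scoped_nu.1 hP)
    exact ⟨scoped_nu.2 this.1, this.2⟩
  | extr h hca hcM hcb ih =>
    have := ih (scoped_nu.1 hP)
    refine ⟨this.1, ?_⟩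
    rintro _ _ _ ⟨⟩
    exact this.2 _ _ _ rfl
  | transp h ha ih => exact ⟨⟨trivial, (ih hP.2).1⟩, (ih hP.2).2⟩
  | passiv a P => exact ⟨trivial, by rintro _ _ _ ⟨⟩; exact hP.2⟩
  | run P => exact ⟨hP, by simp⟩

theorem Step.inp_closed {P P' : Proc} {a : Name} {M : Term} (h : Step P (.inp a M) P') :
    M.Closed := by
  generalize hα : Act.inp a M = α at h
  induction h with
  | inp _ _ _ hM => cases hα; exact hM
  | parL _ _ ih => exact ih hα
  | parR _ _ ih => exact ih hα
  | rep _ ih => exact ih hα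
  | guard _ _ ih => exact ih hα
  | transp _ _ ih => exact ih hα
  | _ => cases hα

/-- A transition of `νa.P` comes from a transition of `P` under the restriction, or extrudes the restricted
name, renamed to some `c`. -/
theorem Step.nu_inv {a : Name} {P R : Proc} {α : Act} (h : Step (nu a P) α R) (ha : a ∉ α.names) :
    (∃ P', Step P α P' ∧ R = nu a P') ∨
    ∃ bs c d M, α = .out (bs ++ [c]) d M ∧ c ∉ (nu a P).fn ∧ c ≠ a ∧
      Step (P.perm (Equiv.swap a c)) (.out bs d M) R ∧ c ≠ d ∧ c ∈ M.fn ∧ c ∉ bs := by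
  generalize hX : nu a P = X at h
  cases h with
  | @guard P₂ P₂' _ c h hc =>
    left
    have hP := nu_eq_nu hX
    have h' := h.perm (Equiv.swap a c)
    rw [hP, Proc.perm_perm, Equiv.swap_mul_self, Proc.perm_one, Act.perm_eq_self] at h'
    · refine ⟨_, h', ?_⟩
      rw [Equiv.swap_comm]
      refine nu_alpha fun ha' => ?_
      rw [mem_fn_nu] at ha'
      rcases Finset.mem_union.1 (h.fn_subset ha'.2) with h | h
      · have : a ∈ (nu c P₂).fn := mem_fn_nu.2 ⟨ha'.1, h⟩
        rw [← hX, mem_fn_nu] at this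
        exact this.1 rfl
      · exact ha h
    · intro b hb
      exact Equiv.swap_apply_of_ne_of_ne (fun e => ha (e ▸ hb)) (fun e => hc (e ▸ hb))
  | extr h hca hcM hcb =>
    refine .inr ⟨_, _, _, _, rfl, ?_, ?_, nu_eq_nu hX ▸ h, hca, hcM, hcb⟩
    · simp [mem_fn_nu]
    · rintro rfl
      simp [Act.names] at ha
  | _ => cases hX

/-- The bound names of an output can be chosen away from any finite set. -/
theorem Step.out_avoid {P P' : Proc} {bs : List Name} {a : Name} {M : Term}
    (h : Step P (.out bs a M) P') (s : Finset Name) :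
    ∃ π : Equiv.Perm Name, (∀ n ∈ P.fn, π n = n) ∧ (∀ n ∈ s, n ∉ bs → π n = n) ∧
      (∀ b ∈ bs.map π, b ∉ s) ∧ Step P (.out (bs.map π) a (M.perm π)) (P'.perm π) := by
  obtain ⟨π, h₁, h₂⟩ := exists_perm_avoid (s ∪ P.fn) bs
  have hP : ∀ n ∈ P.fn, π n = n := fun n hn =>
    h₂ n (Finset.mem_union_right _ hn) fun hb => h.fnSpec.2.1 n hb hn
  refine ⟨π, hP, fun n hn hb => h₂ n (Finset.mem_union_left _ hn) hb, ?_, ?_⟩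
  · intro b hb
    obtain ⟨c, hc, rfl⟩ := List.mem_map.1 hb
    exact fun h => h₁ c hc (Finset.mem_union_left _ h)
  · have h' := h.perm π
    rwa [Proc.perm_eq_self hP, Act.perm, hP a h.fnSpec.1] at h'

/-- The bound names exchanged in a communication can be chosen away from any finite set. -/
theorem Step.react_avoid {P P' Q Q' : Proc} {bs : List Name} {a : Name} {M : Term}
    (h₁ : Step P (.out bs a M) P') (h₂ : Step Q (.inp a M) Q') (hb : ∀ b ∈ bs, b ∉ Q.fn)
    (s : Finset Name) :
    ∃ bs' M' P'' Q'', Step P (.out bs' a M') P'' ∧ Step Q (.inp a M') Q'' ∧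
      (∀ b ∈ bs', b ∉ s ∧ b ∉ Q.fn) ∧ nus bs (.par P' Q') = nus bs' (.par P'' Q'') ∧
      nus bs (.par Q' P') = nus bs' (.par Q'' P'') := by
  obtain ⟨π, hP, hs, hbs, h⟩ := h₁.out_avoid (s ∪ Q.fn)
  have hQ : ∀ n ∈ Q.fn, π n = n := fun n hn =>
    hs n (Finset.mem_union_right _ hn) fun h => hb n h hn
  have h' := h₂.perm π
  rw [Proc.perm_eq_self hQ, Act.perm, hP a h₁.fnSpec.1] at h'
  have fix : ∀ n, n ∉ bs → n ∈ P'.fn ∪ Q'.fn → π n = n := by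
    intro n hnb hn
    have s₁ := h₁.fnSpec
    have s₂ := h₂.fnSpec
    simp only [Act.FnSpec] at s₁ s₂
    have : n ∈ P.fn ∨ n ∈ Q.fn := by grind
    exact this.elim (hP n) (hQ n)
  refine ⟨_, _, _, _, h, h', fun b hb => ?_, ?_, ?_⟩
  · have := hbs b hb
    simpa only [Finset.mem_union, not_or] using this
  · rw [← Proc.perm_eq_self (π := π) (P := nus bs (.par P' Q')), perm_nus]
    · rfl
    · intro n hn
      rw [mem_fn_nus] at hn
      exact fix n hn.1 hn.2
  · rw [← Proc.perm_eq_self (π := π) (P := nus bs (.par Q' P')), perm_nus]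
    · rfl
    · intro n hn
      rw [mem_fn_nus] at hn
      exact fix n hn.1 (by rw [Finset.union_comm]; exact hn.2)

theorem Step.inp_scong {P P' : Proc} {a : Name} {M N : Term} (h : Step P (.inp a M) P')
    (hMN : TSCong M N) : ∃ P'', Step P (.inp a N) P'' ∧ SCong P' P'' := by
  generalize hα : Act.inp a M = α at h
  induction h with
  | inp a P _ hM =>
    cases hα
    exact ⟨_, .inp _ _ _ (hMN.closed_iff.1 hM), P.subst_scong hMN 0⟩
  | parL _ hb ih =>
    obtain ⟨P'', h, hs⟩ := ih hα
    exact ⟨_, .parL h (by simp [Act.bn]), hs.par (.refl _)⟩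
  | parR _ _ ih =>
    obtain ⟨P'', h, hs⟩ := ih hα
    exact ⟨_, .parR h (by simp [Act.bn]), .par (.refl _) hs⟩
  | rep _ ih =>
    obtain ⟨P'', h, hs⟩ := ih hα
    exact ⟨_, .rep h, hs⟩
  | guard _ ha ih =>
    subst hα
    obtain ⟨P'', h, hs⟩ := ih rfl
    refine ⟨_, .guard h ?_, .nu _ hs⟩
    simpa only [Act.names, hMN.fn_eq] using ha
  | transp _ _ ih =>
    obtain ⟨P'', h, hs⟩ := ih hα
    exact ⟨_, .transp h (by simp [Act.bn]), .loc _ hs⟩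
  | _ => cases hα

/-! ### Structural congruence is a strong bisimulation -/

/-- Congruence of actions; the order of the extruded names is immaterial. -/
inductive ActCong : Act → Act → Prop
  | tau : ActCong .tau .tau
  | inp (a : Name) (M : Term) : ActCong (.inp a M) (.inp a M)
  | out {bs cs : List Name} (a : Name) {M N : Term} (hb : bs.Perm cs) (hM : TSCong M N) :
      ActCong (.out bs a M) (.out cs a N)

theorem ActCong.refl : ∀ α : Act, ActCong α α
  | .tau => .tau
  | .inp a M => .inp a M
  | .out _ a M => .out a (.refl _) (.refl M)

theorem ActCong.trans {α β γ : Act} : ActCong α β → ActCong β γ → ActCong α γ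
  | .tau, .tau => .tau
  | .inp a M, .inp _ _ => .inp a M
  | .out a hb hM, .out _ hb' hM' => .out a (hb.trans hb') (hM.trans hM')

theorem ActCong.perm {α β : Act} (π : Equiv.Perm Name) : ActCong α β → ActCong (α.perm π) (β.perm π)
  | .tau => .tau
  | .inp _ _ => .inp _ _
  | .out _ hb hM => .out _ (hb.map π) (hM.perm π)

theorem ActCong.bn_eq {α β : Act} : ActCong α β → α.bn = β.bn
  | .tau => rfl
  | .inp _ _ => rfl
  | .out _ hb _ => List.toFinset_eq_of_perm _ _ hb

theorem ActCong.names_eq {α β : Act} : ActCong α β → α.names = β.names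
  | .tau => rfl
  | .inp _ _ => rfl
  | .out _ hb hM => by simp only [Act.names, hM.fn_eq, List.toFinset_eq_of_perm _ _ hb]

/-- Every transition of `P` is matched by `Q`, up to structural congruence. -/
def Sim (P Q : Proc) : Prop :=
  ∀ α P', Step P α P' → ∃ β Q', ActCong α β ∧ Step Q β Q' ∧ SCong P' Q'

theorem Sim.refl (P : Proc) : Sim P P := fun α P' h => ⟨α, P', .refl α, h, .refl P'⟩

theorem Sim.trans {P Q R : Proc} (h₁ : Sim P Q) (h₂ : Sim Q R) : Sim P R := by
  intro α P' h
  obtain ⟨β, Q', hβ, hQ, hs⟩ := h₁ α P' h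
  obtain ⟨γ, R', hγ, hR, hs'⟩ := h₂ β Q' hQ
  exact ⟨γ, R', hβ.trans hγ, hR, hs.trans hs'⟩

theorem Act.perm_perm_inv (π : Equiv.Perm Name) (α : Act) : (α.perm π⁻¹).perm π = α := by
  rcases α with _ | ⟨a, M⟩ | ⟨bs, a, M⟩ <;> simp [Act.perm, Term.perm_perm_inv, List.map_map]

theorem Sim.perm {P Q : Proc} (h : Sim P Q) (π : Equiv.Perm Name) : Sim (P.perm π) (Q.perm π) := by
  intro α P' hP
  have h' := hP.perm π⁻¹
  rw [Proc.perm_inv_perm] at h'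
  obtain ⟨β, Q', hβ, hQ, hs⟩ := h _ _ h'
  refine ⟨_, _, ?_, hQ.perm π, ?_⟩
  · have := hβ.perm π
    rwa [Act.perm_perm_inv] at this
  · have := hs.perm π
    rwa [Proc.perm_perm_inv] at this

theorem Sim.out {P Q P' : Proc} {bs : List Name} {a : Name} {M : Term} (h : Sim P Q)
    (hP : Step P (.out bs a M) P') :
    ∃ cs N Q', bs.Perm cs ∧ TSCong M N ∧ Step Q (.out cs a N) Q' ∧ SCong P' Q' := by
  obtain ⟨_, Q', hβ, hQ, hs⟩ := h _ _ hP
  cases hβ with | out _ hb hM => exact ⟨_, _, _, hb, hM, hQ, hs⟩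

theorem Sim.inp {P Q P' : Proc} {a : Name} {M N : Term} (h : Sim P Q)
    (hP : Step P (.inp a M) P') (hMN : TSCong M N) :
    ∃ Q', Step Q (.inp a N) Q' ∧ SCong P' Q' := by
  obtain ⟨_, Q', hβ, hQ, hs⟩ := h _ _ hP
  cases hβ
  obtain ⟨Q'', hQ', hs'⟩ := hQ.inp_scong hMN
  exact ⟨Q'', hQ', hs.trans hs'⟩

theorem Sim.tau {P Q P' : Proc} (h : Sim P Q) (hP : Step P .tau P') :
    ∃ Q', Step Q .tau Q' ∧ SCong P' Q' := by
  obtain ⟨_, Q', hβ, hQ, hs⟩ := h _ _ hP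
  cases hβ
  exact ⟨Q', hQ, hs⟩

theorem Sim.parNil (P : Proc) : Sim (.par P .nil) P := by
  intro α P' h
  cases h with
  | parL h hb => exact ⟨α, _, .refl α, h, .parNil _⟩
  | parR h hb => cases h
  | reactL h₁ h₂ hb => cases h₂
  | reactR h₁ h₂ hb => cases h₂

theorem Sim.parNil_symm (P : Proc) : Sim P (.par P .nil) := fun α _ h =>
  ⟨α, _, .refl α, .parL h (by simp [Proc.fn]), (SCong.parNil _).symm⟩

theorem Sim.parComm (P Q : Proc) : Sim (.par P Q) (.par Q P) := by
  intro α P' h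
  cases h with
  | parL h hb => exact ⟨α, _, .refl α, .parR h hb, .parComm _ _⟩
  | parR h hb => exact ⟨α, _, .refl α, .parL h hb, .parComm _ _⟩
  | reactL h₁ h₂ hb => exact ⟨_, _, .tau, .reactR h₂ h₁ hb, (SCong.parComm _ _).nus _⟩
  | reactR h₁ h₂ hb => exact ⟨_, _, .tau, .reactL h₂ h₁ hb, (SCong.parComm _ _).nus _⟩

theorem Sim.par {P P₁ Q Q₁ : Proc} (hP : SCong P P₁) (hQ : SCong Q Q₁) (sP : Sim P P₁)
    (sQ : Sim Q Q₁) : Sim (.par P Q) (.par P₁ Q₁) := by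
  intro α P' h
  cases h with
  | parL h hb =>
    obtain ⟨β, R, hβ, hR, hs⟩ := sP _ _ h
    exact ⟨β, _, hβ, .parL hR (by rwa [← hβ.bn_eq, ← hQ.fn_eq]), hs.par hQ⟩
  | parR h hb =>
    obtain ⟨β, R, hβ, hR, hs⟩ := sQ _ _ h
    exact ⟨β, _, hβ, .parR hR (by rwa [← hβ.bn_eq, ← hP.fn_eq]), hP.par hs⟩
  | reactL h₁ h₂ hb =>
    obtain ⟨cs, N, R, hcs, hN, hR, hs⟩ := sP.out h₁
    obtain ⟨R', hR', hs'⟩ := sQ.inp h₂ hN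
    refine ⟨_, _, .tau, .reactL hR hR' fun b hb' => ?_, ((hs.par hs').nus _).trans (.nus_perm hcs)⟩
    rw [← hQ.fn_eq]
    exact hb b (hcs.mem_iff.2 hb')
  | reactR h₁ h₂ hb =>
    obtain ⟨cs, N, R, hcs, hN, hR, hs⟩ := sQ.out h₂
    obtain ⟨R', hR', hs'⟩ := sP.inp h₁ hN
    refine ⟨_, _, .tau, .reactR hR' hR fun b hb' => ?_, ((hs'.par hs).nus _).trans (.nus_perm hcs)⟩
    rw [← hP.fn_eq]
    exact hb b (hcs.mem_iff.2 hb')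

theorem Sim.parAssoc (P Q R : Proc) : Sim (.par (.par P Q) R) (.par P (.par Q R)) := by
  intro α X h
  cases h with
  | parL h hR =>
    cases h with
    | parL h hb =>
      refine ⟨α, _, .refl α, .parL h ?_, .parAssoc _ _ _⟩
      rw [Proc.fn, Finset.disjoint_union_right]
      exact ⟨hb, hR⟩
    | parR h hb => exact ⟨α, _, .refl α, .parR (.parL h hR) hb, .parAssoc _ _ _⟩
    | reactL h₁ h₂ hb =>
      obtain ⟨cs, N, P', Q', h₁, h₂, hcs, e, -⟩ := h₁.react_avoid h₂ hb R.fn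
      rw [e]
      refine ⟨_, _, .tau, .reactL h₁ (.parL h₂ (by simp [Act.bn])) fun c hc => ?_,
        (SCong.nus_par_right fun c hc => (hcs c hc).1).symm.trans ((SCong.parAssoc _ _ _).nus _)⟩
      simpa [Proc.fn] using (hcs c hc).symm
    | reactR h₁ h₂ hb =>
      obtain ⟨cs, N, Q', P', h₁, h₂, hcs, -, e⟩ := h₂.react_avoid h₁ hb R.fn
      rw [e]
      refine ⟨_, _, .tau, .reactR h₂ (.parL h₁ ?_) fun c hc => (hcs c hc).2,
        (SCong.nus_par_right fun c hc => (hcs c hc).1).symm.trans ((SCong.parAssoc _ _ _).nus _)⟩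
      rw [Finset.disjoint_left]
      intro c hc
      exact (hcs c (by simpa [Act.bn] using hc)).1
  | parR h hb =>
    rw [Proc.fn, Finset.disjoint_union_right] at hb
    exact ⟨α, _, .refl α, .parR (.parR h hb.2) hb.1, .parAssoc _ _ _⟩
  | reactL h₁ h₂ hR =>
    cases h₁ with
    | parL h hb =>
      refine ⟨_, _, .tau, .reactL h (.parR h₂ (by simp [Act.bn])) fun c hc => ?_,
        (SCong.parAssoc _ _ _).nus _⟩
      have := Finset.disjoint_left.mp hb (by simpa [Act.bn] using hc : c ∈ _)
      simpa [Proc.fn] using And.intro this (hR c hc)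
    | parR h hb =>
      refine ⟨_, _, .tau, .parR (.reactL h h₂ hR) (by simp [Act.bn]),
        ((SCong.parAssoc _ _ _).nus _).trans (SCong.nus_par fun c hc => ?_)⟩
      exact Finset.disjoint_left.mp hb (by simpa [Act.bn] using hc : c ∈ _)
  | reactR h₁ h₂ hR =>
    simp only [Proc.fn, Finset.mem_union, not_or] at hR
    cases h₁ with
    | parL h hb =>
      refine ⟨_, _, .tau, .reactR h (.parR h₂ ?_) fun c hc => (hR c hc).1,
        (SCong.parAssoc _ _ _).nus _⟩
      rw [Finset.disjoint_left]
      intro c hc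
      exact (hR c (by simpa [Act.bn] using hc)).2
    | parR h hb =>
      exact ⟨_, _, .tau, .parR (.reactR h h₂ fun c hc => (hR c hc).2) (by simp [Act.bn]),
        ((SCong.parAssoc _ _ _).nus _).trans (SCong.nus_par fun c hc => (hR c hc).1)⟩

theorem Sim.parAssoc_symm (P Q R : Proc) : Sim (.par P (.par Q R)) (.par (.par P Q) R) :=
  (Sim.parComm _ _).trans <|
    (Sim.par (.parComm _ _) (.refl _) (.parComm _ _) (.refl _)).trans <|
      (Sim.parAssoc _ _ _).trans <| (Sim.par (.refl _) (.parComm _ _) (.refl _) (.parComm _ _)).trans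
        (.parComm _ _)

/-- A transition of a restriction that extrudes the restricted name. -/
theorem Step.extr_nu {a c d : Name} {P R : Proc} {bs : List Name} {M : Term}
    (hc : c ∉ (nu a P).fn) (h : Step (P.perm (Equiv.swap a c)) (.out bs d M) R) (hcd : c ≠ d)
    (hcM : c ∈ M.fn) (hcb : c ∉ bs) : Step (nu a P) (.out (bs ++ [c]) d M) R := by
  rw [nu_alpha hc]
  exact .extr h hcd hcM hcb

/-- The restricted name is assumed not to occur in the action; it can always be renamed so. -/
theorem Sim.nu_aux {a : Name} {P Q : Proc} (hPQ : SCong P Q) (s : Sim P Q) {α : Act}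
    (ha : a ∉ α.names) {R : Proc} (h : Step (HOPiP.nu a P) α R) :
    ∃ β Q', ActCong α β ∧ Step (HOPiP.nu a Q) β Q' ∧ SCong R Q' := by
  replace h := h.nu_inv ha
  rcases h with ⟨P', hP', rfl⟩ | ⟨bs, c, d, M, rfl, hc, -, h, hcd, hcM, hcb⟩
  · obtain ⟨β, Q', hβ, hQ, hs⟩ := s _ _ hP'
    exact ⟨β, _, hβ, .guard hQ (by rwa [← hβ.names_eq]), .nu a hs⟩
  · obtain ⟨cs, N, Q', hcs, hN, hQ, hs⟩ := (s.perm _).out h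
    refine ⟨_, _, .out d (hcs.append_right [c]) hN, Step.extr_nu ?_ hQ hcd ?_ ?_, hs⟩
    · rwa [← (SCong.nu a hPQ).fn_eq]
    · rwa [← hN.fn_eq]
    · rwa [← hcs.mem_iff]

theorem Sim.nu {a : Name} {P Q : Proc} (hPQ : SCong P Q) (s : Sim P Q) :
    Sim (HOPiP.nu a P) (HOPiP.nu a Q) := by
  intro α R h
  obtain ⟨b, hb⟩ := exists_fresh (α.names ∪ (HOPiP.nu a P).fn)
  simp only [Finset.mem_union, not_or] at hb
  rw [nu_alpha hb.2] at h
  rw [nu_alpha (a := a) (b := b) (P := Q) (by rw [← (SCong.nu a hPQ).fn_eq]; exact hb.2)]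
  exact Sim.nu_aux (hPQ.perm _) (s.perm _) hb.1 h

theorem nu_nil (a : Name) : nu a .nil = .new .nil := rfl

theorem Sim.nuNil (a : Name) : Sim (HOPiP.nu a .nil) .nil := by
  intro α R h
  obtain ⟨b, hb⟩ := exists_fresh α.names
  rw [nu_nil, ← nu_nil b] at h
  rcases h.nu_inv hb with ⟨P', hP', rfl⟩ | ⟨bs, c, d, M, rfl, hc, -, h, hcd, hcM, hcb⟩
  · cases hP'
  · cases h

theorem Sim.nuSwap_aux {a b : Name} (hab : a ≠ b) {P R : Proc} {α : Act} (ha : a ∉ α.names)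
    (hb : b ∉ α.names) (h : Step (HOPiP.nu a (HOPiP.nu b P)) α R) :
    ∃ β Q', ActCong α β ∧ Step (HOPiP.nu b (HOPiP.nu a P)) β Q' ∧ SCong R Q' := by
  replace h := h.nu_inv ha
  rcases h with ⟨P', hP', rfl⟩ | ⟨bs, c, d, M, rfl, hc, hca, h, hcd, hcM, hcb⟩
  · rcases hP'.nu_inv hb with ⟨P'', hP'', rfl⟩ | ⟨bs, c, d, M, rfl, hc, hcb', h, hcd, hcM, hcb⟩
    · exact ⟨α, _, .refl α, .guard (.guard hP'' ha) hb, .nuSwap _ _ _⟩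
    · have hca : a ≠ c := by rintro rfl; simp [Act.names] at ha
      refine ⟨_, _, .refl _, Step.extr_nu (P := HOPiP.nu a P) ?_ ?_ hcd hcM hcb, .refl _⟩
      · rw [← (SCong.nuSwap a b P).fn_eq, mem_fn_nu]
        exact fun h => hc h.2
      · rw [perm_nu, Equiv.swap_apply_of_ne_of_ne hab hca]
        refine .guard h ?_
        simp only [Act.names, List.toFinset_append] at ha ⊢
        grind
  · have hcb' : b ≠ c := by rintro rfl; simp [Act.names] at hb
    have hbn : b ∉ (Act.out bs d M).names := by
      simp only [Act.names, List.toFinset_append] at hb ⊢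
      grind
    rw [perm_nu, Equiv.swap_apply_of_ne_of_ne hab.symm hcb'] at h
    rcases h.nu_inv hbn with ⟨P'', hP'', rfl⟩ | ⟨bs, e, d, M, e', he, heb, h, hed, heM, heb'⟩
    · refine ⟨_, _, .refl _, .guard (Step.extr_nu (c := c) ?_ hP'' hcd hcM hcb) hb, .refl _⟩
      intro hc'
      refine hc ?_
      rw [(SCong.nuSwap a b P).fn_eq, mem_fn_nu]
      exact ⟨hcb'.symm, hc'⟩
    · cases e'
      simp only [List.mem_append, List.mem_singleton, not_or] at hcb
      have hea : a ≠ e := by rintro rfl; simp [Act.names] at ha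
      have hcP : c ∉ (HOPiP.nu a P).fn := by
        intro hc'
        refine hc ?_
        rw [(SCong.nuSwap a b P).fn_eq, mem_fn_nu]
        exact ⟨hcb'.symm, hc'⟩
      have key : HOPiP.nu b (HOPiP.nu a P) =
          HOPiP.nu e (HOPiP.nu c ((P.perm (Equiv.swap a c)).perm (Equiv.swap b e))) := by
        rw [nu_alpha hcP, nu_alpha (a := b) (b := e), perm_nu,
          Equiv.swap_apply_of_ne_of_ne hcb'.symm hcb.2]
        rw [mem_fn_nu] at he ⊢
        simp only [mem_fn_nu] at he ⊢
        tauto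
      rw [key]
      refine ⟨_, _, .out d ?_ (.refl M), .extr (.extr h hcd hcM hcb.1) hed heM ?_, .refl R⟩
      · rw [List.append_assoc, List.append_assoc]
        exact List.Perm.append_left _ (.swap _ _ _)
      · simpa using ⟨heb', Ne.symm hcb.2⟩

theorem Sim.nuSwap (a b : Name) (P : Proc) :
    Sim (HOPiP.nu a (HOPiP.nu b P)) (HOPiP.nu b (HOPiP.nu a P)) := by
  by_cases hab : a = b
  · subst hab; exact .refl _
  intro α R h
  -- Refresh both restricted names, away from the action.
  obtain ⟨π, h₁, h₂⟩ := exists_perm_avoid (α.names ∪ (HOPiP.nu a (HOPiP.nu b P)).fn) [a, b]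
  have fix : ∀ n ∈ (HOPiP.nu a (HOPiP.nu b P)).fn, π n = n := by
    intro n hn
    refine h₂ n (Finset.mem_union_right _ hn) ?_
    simp only [mem_fn_nu] at hn
    simp [hn.1, hn.2.1]
  have fix' := fix
  rw [(SCong.nuSwap a b P).fn_eq] at fix'
  rw [← Proc.perm_eq_self fix, perm_nu, perm_nu] at h
  rw [← Proc.perm_eq_self fix', perm_nu, perm_nu]
  refine Sim.nuSwap_aux (fun e => hab (π.injective e)) (fun h => ?_) (fun h => ?_) h
  · exact h₁ a (by simp) (Finset.mem_union_left _ h)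
  · exact h₁ b (by simp) (Finset.mem_union_left _ h)

theorem Sim.nuPar_aux {a : Name} {P Q R : Proc} (haP : a ∉ P.fn) {α : Act} (ha : a ∉ α.names)
    (h : Step (HOPiP.nu a (.par P Q)) α R) :
    ∃ β Q', ActCong α β ∧ Step (.par P (HOPiP.nu a Q)) β Q' ∧ SCong R Q' := by
  replace h := h.nu_inv ha
  rcases h with ⟨R', h, rfl⟩ | ⟨bs, c, d, M, rfl, hc, hca, h, hcd, hcM, hcb⟩
  · cases h with
    | parL h hb =>
      refine ⟨α, _, .refl α, .parL h ?_, .nuPar _ _ _ fun ha' => ?_⟩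
      · rw [fn_nu]
        exact hb.mono_right (Finset.erase_subset _ _)
      · have := h.fn_subset ha'
        grind
    | parR h hb => exact ⟨α, _, .refl α, .parR (.guard h ha) hb, .nuPar _ _ _ haP⟩
    | reactL h₁ h₂ hb =>
      obtain ⟨cs, N, P', Q', h₁, h₂, hcs, e, -⟩ := h₁.react_avoid h₂ hb {a}
      rw [e]
      have s₁ := h₁.fnSpec
      have hac : a ∉ cs := fun h => (hcs a h).1 (by simp)
      simp only [Act.FnSpec] at s₁
      have haN : a ∉ N.fn := by grind
      have haP' : a ∉ P'.fn := by grind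
      refine ⟨_, _, .tau, .reactL h₁ (.guard h₂ ?_) fun c hc => ?_,
        (SCong.nu_nus _ _ _).trans ((SCong.nuPar _ _ _ haP').nus _)⟩
      · have : a ≠ _ := fun e => haP (e ▸ s₁.1)
        simp [Act.names, haN, this]
      · rw [mem_fn_nu]
        exact fun h => (hcs c hc).2 h.2
    | reactR h₁ h₂ hb =>
      obtain ⟨cs, N, Q', P', h₁, h₂, hcs, -, e⟩ := h₂.react_avoid h₁ hb {a}
      rw [e]
      have s₂ := h₂.fnSpec
      have hac : a ∉ cs := fun h => (hcs a h).1 (by simp)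
      simp only [Act.FnSpec] at s₂
      have had : a ≠ _ := fun e => haP (e ▸ s₂.1)
      by_cases haN : a ∈ N.fn
      · refine ⟨_, _, .tau, .reactR h₂ (.extr h₁ had haN hac) fun c hc => ?_, ?_⟩
        · simp only [List.mem_append, List.mem_singleton] at hc
          rcases hc with hc | rfl
          · exact (hcs c hc).2
          · exact haP
        · rw [nus_append]
          exact .nu_nus _ _ _
      · have haP' : a ∉ P'.fn := by grind
        refine ⟨_, _, .tau, .reactR h₂ (.guard h₁ ?_) fun c hc => (hcs c hc).2,
          (SCong.nu_nus _ _ _).trans ((SCong.nuPar _ _ _ haP').nus _)⟩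
        simp [Act.names, haN, hac, had]
  · have hcP : c ∉ P.fn := by
      simp only [mem_fn_nu, Proc.fn, Finset.mem_union] at hc
      tauto
    have hcQ : c ∉ (HOPiP.nu a Q).fn := by
      simp only [mem_fn_nu, Proc.fn, Finset.mem_union] at hc ⊢
      tauto
    have hP : P.perm (Equiv.swap a c) = P := Proc.perm_eq_self fun n hn =>
      Equiv.swap_apply_of_ne_of_ne (fun e => haP (e ▸ hn)) (fun e => hcP (e ▸ hn))
    simp only [Proc.perm, Proc.ren] at h hP
    rw [hP] at h
    cases h with
    | parL h hb =>
      have := h.fnSpec.2.2.1 c hcM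
      tauto
    | parR h hb =>
      refine ⟨_, _, .refl _, .parR (Step.extr_nu hcQ h hcd hcM hcb) ?_, .refl _⟩
      simp only [Act.bn, Finset.disjoint_left, List.mem_toFinset] at hb ⊢
      grind

theorem Sim.nuPar_symm_aux {a : Name} {P Q R : Proc} (haP : a ∉ P.fn) {α : Act} (ha : a ∉ α.names)
    (h : Step (.par P (HOPiP.nu a Q)) α R) :
    ∃ β Q', ActCong α β ∧ Step (HOPiP.nu a (.par P Q)) β Q' ∧ SCong R Q' := by
  cases h with
  | parL h hb =>
    refine ⟨α, _, .refl α, .guard (.parL h ?_) ha, (SCong.nuPar _ _ _ fun ha' => ?_).symm⟩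
    · rw [Finset.disjoint_left] at hb ⊢
      intro c hc hcQ
      refine hb hc (mem_fn_nu.2 ⟨?_, hcQ⟩)
      rintro rfl
      exact ha (α.bn_subset_names hc)
    · have := h.fn_subset ha'
      grind
  | parR h hb =>
    replace h := h.nu_inv ha
    rcases h with ⟨R', h, rfl⟩ | ⟨bs, c, d, M, rfl, hc, hca, h, hcd, hcM, hcb⟩
    · exact ⟨α, _, .refl α, .guard (.parR h hb) ha, (SCong.nuPar _ _ _ haP).symm⟩
    · simp only [Act.bn, Finset.disjoint_left, List.toFinset_append] at hb
      have hcP : c ∉ P.fn := hb (by simp)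
      refine ⟨_, _, .refl _, Step.extr_nu (c := c) ?_ ?_ hcd hcM hcb, .refl _⟩
      · simp only [mem_fn_nu, Proc.fn, Finset.mem_union] at hc ⊢
        tauto
      · have hP : P.perm (Equiv.swap a c) = P := Proc.perm_eq_self fun n hn =>
          Equiv.swap_apply_of_ne_of_ne (fun e => haP (e ▸ hn)) (fun e => hcP (e ▸ hn))
        simp only [Proc.perm, Proc.ren] at h hP ⊢
        rw [hP]
        refine .parR h ?_
        rw [Finset.disjoint_left]
        exact fun x hx => hb (by simp_all [Act.bn])
  | reactL h₁ h₂ hb =>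
    obtain ⟨cs, N, P', Q', h₁, h₂, hcs, e, -⟩ := h₁.react_avoid h₂ hb {a}
    rw [e]
    have s₁ := h₁.fnSpec
    have hac : a ∉ cs := fun h => (hcs a h).1 (by simp)
    simp only [Act.FnSpec] at s₁
    have haN : a ∉ N.fn := by grind
    have had : a ≠ _ := fun e => haP (e ▸ s₁.1)
    rcases h₂.nu_inv (a := a) (by simp [Act.names, haN, had]) with
      ⟨R', h, rfl⟩ | ⟨bs, c, d, M, e', -⟩
    · refine ⟨_, _, .tau, .guard (.reactL h₁ h fun c hc hcQ => ?_) ha,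
        ((SCong.nuPar _ _ _ ?_).symm.nus _).trans (SCong.nu_nus _ _ _).symm⟩
      · refine (hcs c hc).2 (mem_fn_nu.2 ⟨?_, hcQ⟩)
        rintro rfl
        exact hac hc
      · grind
    · cases e'
  | reactR h₁ h₂ hb =>
    obtain ⟨cs, N, Q', P', h₂, h₁, hcs, -, e⟩ := h₂.react_avoid h₁ hb {a}
    rw [e]
    have s₁ := h₁.fnSpec
    have s₂ := h₂.fnSpec
    have hac : a ∉ cs := fun h => (hcs a h).1 (by simp)
    simp only [Act.FnSpec] at s₁ s₂
    have had : a ≠ _ := fun e => haP (e ▸ s₁.1)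
    have haN : a ∉ N.fn := fun h => by
      rcases s₂.2.2.1 a h with h | h
      · exact (mem_fn_nu.1 h).1 rfl
      · exact hac h
    rcases h₂.nu_inv (a := a) (by simp [Act.names, haN, had, hac]) with
      ⟨R', h, rfl⟩ | ⟨bs, c, d, M, e', hc, hca, h, hcd, hcM, hcb⟩
    · have haP' : a ∉ P'.fn := by grind
      exact ⟨_, _, .tau, .guard (.reactR h₁ h fun c hc => (hcs c hc).2) ha,
        ((SCong.nuPar _ _ _ haP').symm.nus _).trans (SCong.nu_nus _ _ _).symm⟩
    · cases e'
      have hcP : c ∉ P.fn := (hcs c (by simp)).2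
      have hP : P.perm (Equiv.swap a c) = P := Proc.perm_eq_self fun n hn =>
        Equiv.swap_apply_of_ne_of_ne (fun e => haP (e ▸ hn)) (fun e => hcP (e ▸ hn))
      rw [nu_alpha (a := a) (b := c) (P := .par P Q)]
      · simp only [Proc.perm, Proc.ren] at hP h ⊢
        rw [hP]
        refine ⟨_, _, .tau, .guard (.reactR h₁ h fun b hb => (hcs b (by simp [hb])).2)
          (by simp [Act.names]), ?_⟩
        rw [nus_append]
        exact (SCong.nu_nus _ _ _).symm
      · simp only [mem_fn_nu, Proc.fn, Finset.mem_union] at hc ⊢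
        tauto

/-- The name restricted by both sides of a scope extrusion can be chosen fresh. -/
theorem nuPar_rename {a : Name} {P Q : Proc} (haP : a ∉ P.fn) (s : Finset Name) :
    ∃ b Q', b ∉ s ∧ b ∉ P.fn ∧ HOPiP.nu a (.par P Q) = HOPiP.nu b (.par P Q') ∧
      HOPiP.nu a Q = HOPiP.nu b Q' := by
  obtain ⟨b, hb⟩ := exists_fresh (s ∪ P.fn ∪ Q.fn)
  simp only [Finset.mem_union, not_or] at hb
  refine ⟨b, _, hb.1.1, hb.1.2, ?_, nu_alpha fun h => hb.2 (mem_fn_nu.1 h).2⟩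
  rw [nu_alpha (a := a) (b := b)]
  · have hP : P.perm (Equiv.swap a b) = P := Proc.perm_eq_self fun n hn =>
      Equiv.swap_apply_of_ne_of_ne (fun e => haP (e ▸ hn)) (fun e => hb.1.2 (e ▸ hn))
    simp only [Proc.perm, Proc.ren] at hP ⊢
    rw [hP]
  · simp only [mem_fn_nu, Proc.fn, Finset.mem_union]
    tauto

theorem Sim.nuPar {a : Name} {P Q : Proc} (haP : a ∉ P.fn) :
    Sim (HOPiP.nu a (.par P Q)) (.par P (HOPiP.nu a Q)) := by
  intro α R h
  obtain ⟨b, Q', hb, hbP, e₁, e₂⟩ := nuPar_rename (Q := Q) haP α.names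
  rw [e₁] at h
  rw [e₂]
  exact Sim.nuPar_aux hbP hb h

theorem Sim.nuPar_symm {a : Name} {P Q : Proc} (haP : a ∉ P.fn) :
    Sim (.par P (HOPiP.nu a Q)) (HOPiP.nu a (.par P Q)) := by
  intro α R h
  obtain ⟨b, Q', hb, hbP, e₁, e₂⟩ := nuPar_rename (Q := Q) haP α.names
  rw [e₂] at h
  rw [e₁]
  exact Sim.nuPar_symm_aux hbP hb h

theorem SCong.rep_absorb (P : Proc) : SCong (.par (.rep P) P) (.rep P) :=
  (SCong.parComm _ _).trans (SCong.repUnfold P).symm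

/-- A transition of `!P` is a transition of one copy of `P`, or a communication of two copies. -/
theorem Step.rep_inv {P R : Proc} {α : Act} (h : Step (.rep P) α R) :
    (∃ P', Step P α P' ∧ SCong R (.par (.rep P) P')) ∨
    ∃ bs a M P₁ P₂, α = .tau ∧ Step P (.out bs a M) P₁ ∧ Step P (.inp a M) P₂ ∧
      SCong R (.par (.rep P) (nus bs (.par P₁ P₂))) := by
  suffices H : ∀ X α R, Step X α R → (X = .rep P ∨ X = .par (.rep P) P) →
      (∃ P', Step P α P' ∧ SCong R (.par (.rep P) P')) ∨
      ∃ bs a M P₁ P₂, α = .tau ∧ Step P (.out bs a M) P₁ ∧ Step P (.inp a M) P₂ ∧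
        SCong R (.par (.rep P) (HOPiP.nus bs (.par P₁ P₂))) from H _ _ _ h (.inl rfl)
  have absorb : ∀ {X Y : Proc}, SCong X (.par (.rep P) Y) →
      SCong (.par X P) (.par (.rep P) Y) := fun {X Y} h =>
    (h.par (.refl _)).trans <| (SCong.parAssoc _ _ _).trans <|
      (SCong.par (.refl _) (.parComm _ _)).trans <| (SCong.parAssoc _ _ _).symm.trans <|
        (SCong.rep_absorb P).par (.refl _)
  have pull : ∀ {bs : List Name} {X Y Z : Proc}, SCong X (.par (.rep P) Y) →
      (∀ b ∈ bs, b ∉ P.fn) →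
      SCong (HOPiP.nus bs (.par X Z)) (.par (.rep P) (HOPiP.nus bs (.par Y Z))) :=
    fun {bs X Y Z} h hb =>
      (((h.par (.refl _)).trans (.parAssoc _ _ _)).nus bs).trans (SCong.nus_par hb)
  intro X α R h
  induction h with
  | rep h ih =>
    rintro (e | e) <;> cases e
    exact ih (.inr rfl)
  | parL h hb ih =>
    rintro (e | e) <;> cases e
    rcases ih (.inl rfl) with ⟨P', hP', hs⟩ | ⟨bs, a, M, P₁, P₂, e, h₁, h₂, hs⟩
    · exact .inl ⟨P', hP', absorb hs⟩
    · exact .inr ⟨bs, a, M, P₁, P₂, e, h₁, h₂, absorb hs⟩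
  | parR h hb ih =>
    rintro (e | e) <;> cases e
    exact .inl ⟨_, h, .refl _⟩
  | reactL h₁ h₂ hb ih₁ ih₂ =>
    rintro (e | e) <;> cases e
    rcases ih₁ (.inl rfl) with ⟨P', hP', hs⟩ | ⟨_, _, _, _, _, e, -⟩
    · exact .inr ⟨_, _, _, _, _, rfl, hP', h₂, pull hs hb⟩
    · cases e
  | reactR h₁ h₂ hb ih₁ ih₂ =>
    rintro (e | e) <;> cases e
    rcases ih₁ (.inl rfl) with ⟨P', hP', hs⟩ | ⟨_, _, _, _, _, e, -⟩
    · exact .inr ⟨_, _, _, _, _, rfl, h₂, hP', (pull hs hb).trans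
        (.par (.refl _) ((SCong.parComm _ _).nus _))⟩
    · cases e
  | _ => rintro (e | e) <;> cases e

theorem Step.rep_copy {P P' : Proc} {α : Act} (h : Step P α P') :
    Step (.rep P) α (.par (.rep P) P') := .rep (.parR h h.bn_disjoint)

theorem Step.rep_react {P P₁ P₂ : Proc} {bs : List Name} {a : Name} {M : Term}
    (h₁ : Step P (.out bs a M) P₁) (h₂ : Step P (.inp a M) P₂) :
    Step (.rep P) .tau (nus bs (.par (.par (.rep P) P₁) P₂)) :=
  .rep (.reactL h₁.rep_copy h₂ h₁.fnSpec.2.1)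

theorem Sim.rep {P Q : Proc} (hPQ : SCong P Q) (s : Sim P Q) : Sim (.rep P) (.rep Q) := by
  intro α R h
  rcases h.rep_inv with ⟨P', hP', hs⟩ | ⟨bs, a, M, P₁, P₂, rfl, h₁, h₂, hs⟩
  · obtain ⟨β, Q', hβ, hQ, hs'⟩ := s _ _ hP'
    exact ⟨β, _, hβ, hQ.rep_copy, hs.trans (hPQ.rep.par hs')⟩
  · obtain ⟨cs, N, Q₁, hcs, hN, hQ₁, hs₁⟩ := s.out h₁
    obtain ⟨Q₂, hQ₂, hs₂⟩ := s.inp h₂ hN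
    refine ⟨_, _, .tau, hQ₁.rep_react hQ₂, hs.trans ?_⟩
    refine (hPQ.rep.par (((hs₁.par hs₂).nus bs).trans (.nus_perm hcs))).trans ?_
    exact (SCong.nus_par (P := .rep Q) hQ₁.fnSpec.2.1).symm.trans
      ((SCong.parAssoc _ _ _).symm.nus _)

theorem Sim.loc {c : Chan} {P Q : Proc} (hPQ : SCong P Q) (s : Sim P Q) :
    Sim (.loc c P) (.loc c Q) := by
  intro α R h
  cases h with
  | transp h ha =>
    obtain ⟨β, Q', hβ, hQ, hs⟩ := s _ _ h
    exact ⟨β, _, hβ, .transp hQ (by rwa [← hβ.bn_eq]), .loc _ hs⟩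
  | passiv a => exact ⟨_, _, .out a (.refl _) (.quote hPQ), .passiv a Q, .refl _⟩

theorem Sim.run {M N : Term} (h : TSCong M N) : Sim (.run M) (.run N) := by
  intro α R hR
  cases hR with
  | run P =>
    cases h with
    | quote h => exact ⟨_, _, .tau, .run _, h⟩

theorem Sim.inpPrefix {c : Chan} {P Q : Proc} (h : SCong P Q) : Sim (.inp c P) (.inp c Q) := by
  intro α R hR
  cases hR with
  | inp a _ M hM => exact ⟨_, _, .refl _, .inp a Q M hM, h.subst hM 0⟩

theorem Sim.outPrefix {c : Chan} {M N : Term} {P Q : Proc} (hM : TSCong M N) (h : SCong P Q) :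
    Sim (.out c M P) (.out c N Q) := by
  intro α R hR
  cases hR with
  | out a => exact ⟨_, _, .out a (.refl _) hM, .out a N Q, h⟩

/-- Structural congruence is a strong bisimulation. -/
theorem SCong.sims {P Q : Proc} : SCong P Q → Sim P Q ∧ Sim Q P
  | .refl P => ⟨.refl P, .refl P⟩
  | .symm h => h.sims.symm
  | .trans h₁ h₂ => ⟨h₁.sims.1.trans h₂.sims.1, h₂.sims.2.trans h₁.sims.2⟩
  | .parNil P => ⟨.parNil P, .parNil_symm P⟩
  | .parComm P Q => ⟨.parComm P Q, .parComm Q P⟩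
  | .parAssoc P Q R => ⟨.parAssoc P Q R, .parAssoc_symm P Q R⟩
  | .repUnfold P =>
    have h₁ : Sim (.rep P) (.par (.rep P) P) := fun α R h => by
      cases h with | rep h => exact ⟨α, R, .refl α, h, .refl R⟩
    have h₂ : Sim (.par (.rep P) P) (.rep P) := fun α R h => ⟨α, R, .refl α, .rep h, .refl R⟩
    ⟨h₁.trans (.parComm _ _), (Sim.parComm _ _).trans h₂⟩
  | .nuNil a => ⟨.nuNil a, fun _ _ h => by cases h⟩
  | .nuSwap a b P => ⟨.nuSwap a b P, .nuSwap b a P⟩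
  | .nuPar _ _ _ ha => ⟨.nuPar ha, .nuPar_symm ha⟩
  | .inp _ h => ⟨.inpPrefix h, .inpPrefix h.symm⟩
  | .out _ hM h => ⟨.outPrefix hM h, .outPrefix hM.symm h.symm⟩
  | .par h₁ h₂ => ⟨.par h₁ h₂ h₁.sims.1 h₂.sims.1, .par h₁.symm h₂.symm h₁.sims.2 h₂.sims.2⟩
  | .loc _ h => ⟨.loc h h.sims.1, .loc h.symm h.sims.2⟩
  | .nu _ h => ⟨.nu h h.sims.1, .nu h.symm h.sims.2⟩
  | .rep h => ⟨.rep h h.sims.1, .rep h.symm h.sims.2⟩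
  | .run h => ⟨.run h, .run h.symm⟩

theorem SCong.sim {P Q : Proc} (h : SCong P Q) : Sim P Q := h.sims.1

theorem SCong.weak {P Q P' : Proc} (h : SCong P Q) (hP : Weak P P') :
    ∃ Q', Weak Q Q' ∧ SCong P' Q' := by
  induction hP with
  | refl => exact ⟨Q, .refl, h⟩
  | tail _ hP ih =>
    obtain ⟨Q₁, hQ₁, hs⟩ := ih
    obtain ⟨Q', hQ', hs'⟩ := hs.sim.tau hP
    exact ⟨Q', hQ₁.tail hQ', hs'⟩

theorem SCong.weakAct_out {P Q P' : Proc} {bs : List Name} {a : Name} {M : Term}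
    (h : SCong P Q) (hP : WeakAct P (.out bs a M) P') :
    ∃ cs N Q', bs.Perm cs ∧ TSCong M N ∧ WeakAct Q (.out cs a N) Q' ∧ SCong P' Q' := by
  obtain ⟨P₁, P₂, h₁, h₂, h₃⟩ := hP
  obtain ⟨Q₁, hQ₁, hs₁⟩ := h.weak h₁
  obtain ⟨cs, N, Q₂, hcs, hN, hQ₂, hs₂⟩ := hs₁.sim.out h₂
  obtain ⟨Q₃, hQ₃, hs₃⟩ := hs₂.weak h₃
  exact ⟨cs, N, Q₃, hcs, hN, ⟨Q₁, Q₂, hQ₁, hQ₂, hQ₃⟩, hs₃⟩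

theorem SCong.weakAct_inp {P Q P' : Proc} {a : Name} {M N : Term}
    (h : SCong P Q) (hP : WeakAct P (.inp a M) P') (hMN : TSCong M N) :
    ∃ Q', WeakAct Q (.inp a N) Q' ∧ SCong P' Q' := by
  obtain ⟨P₁, P₂, h₁, h₂, h₃⟩ := hP
  obtain ⟨Q₁, hQ₁, hs₁⟩ := h.weak h₁
  obtain ⟨Q₂, hQ₂, hs₂⟩ := hs₁.sim.inp h₂ hMN
  obtain ⟨Q₃, hQ₃, hs₃⟩ := hs₂.weak h₃
  exact ⟨Q₃, ⟨Q₁, Q₂, hQ₁, hQ₂, hQ₃⟩, hs₃⟩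

/-! ### Weak transitions -/

theorem Weak.closed {P P' : Proc} (h : Weak P P') (hP : P.Closed) : P'.Closed := by
  induction h with
  | refl => exact hP
  | tail _ h ih => exact (h.closed ih).1

theorem Weak.fn_subset {P P' : Proc} (h : Weak P P') : P'.fn ⊆ P.fn := by
  induction h with
  | refl => exact subset_rfl
  | tail _ h ih =>
    have h' := h.fnSpec
    simp only [Act.FnSpec] at h'
    exact h'.trans ih

theorem Weak.perm {P P' : Proc} (h : Weak P P') (π : Equiv.Perm Name) :
    Weak (P.perm π) (P'.perm π) := by
  induction h with
  | refl => exact .refl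
  | tail _ h ih => exact ih.tail (h.perm π)

theorem Weak.parL {P P' : Proc} (Q : Proc) (h : Weak P P') : Weak (.par P Q) (.par P' Q) := by
  induction h with
  | refl => exact .refl
  | tail _ h ih => exact ih.tail (.parL h (by simp [Act.bn]))

theorem Weak.parR {Q Q' : Proc} (P : Proc) (h : Weak Q Q') : Weak (.par P Q) (.par P Q') := by
  induction h with
  | refl => exact .refl
  | tail _ h ih => exact ih.tail (.parR h (by simp [Act.bn]))

theorem Weak.nu {P P' : Proc} (a : Name) (h : Weak P P') : Weak (nu a P) (nu a P') := by
  induction h with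
  | refl => exact .refl
  | tail _ h ih => exact ih.tail (.guard h (by simp [Act.names]))

theorem Weak.nus {P P' : Proc} (h : Weak P P') : ∀ bs : List Name, Weak (nus bs P) (nus bs P')
  | [] => h
  | b :: bs => (h.nus bs).nu b

theorem Weak.loc {P P' : Proc} (a : Name) (h : Weak P P') :
    Weak (.loc (.free a) P) (.loc (.free a) P') := by
  induction h with
  | refl => exact .refl
  | tail _ h ih => exact ih.tail (.transp h (by simp [Act.bn]))

theorem Step.weakAct {P P' : Proc} {α : Act} (h : Step P α P') : WeakAct P α P' :=
  ⟨P, P', .refl, h, .refl⟩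

theorem Weak.weakAct {P Q R : Proc} {α : Act} (h : Weak P Q) (h' : WeakAct Q α R) :
    WeakAct P α R := by
  obtain ⟨Q₁, Q₂, h₁, h₂, h₃⟩ := h'
  exact ⟨Q₁, Q₂, Relation.ReflTransGen.trans h h₁, h₂, h₃⟩

theorem WeakAct.closed {P P' : Proc} {α : Act} (h : WeakAct P α P') (hP : P.Closed) :
    P'.Closed ∧ ∀ bs a M, α = .out bs a M → M.Closed := by
  obtain ⟨P₁, P₂, h₁, h₂, h₃⟩ := h
  have := h₂.closed (h₁.closed hP)
  exact ⟨h₃.closed this.1, this.2⟩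

theorem WeakAct.perm {P P' : Proc} {α : Act} (h : WeakAct P α P') (π : Equiv.Perm Name) :
    WeakAct (P.perm π) (α.perm π) (P'.perm π) := by
  obtain ⟨P₁, P₂, h₁, h₂, h₃⟩ := h
  exact ⟨_, _, h₁.perm π, h₂.perm π, h₃.perm π⟩

theorem WeakAct.parL {P P' Q : Proc} {α : Act} (h : WeakAct P α P') (hb : Disjoint α.bn Q.fn) :
    WeakAct (.par P Q) α (.par P' Q) := by
  obtain ⟨P₁, P₂, h₁, h₂, h₃⟩ := h
  exact ⟨_, _, h₁.parL Q, .parL h₂ hb, h₃.parL Q⟩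

theorem WeakAct.parR {P Q Q' : Proc} {α : Act} (h : WeakAct Q α Q') (hb : Disjoint α.bn P.fn) :
    WeakAct (.par P Q) α (.par P Q') := by
  obtain ⟨P₁, P₂, h₁, h₂, h₃⟩ := h
  exact ⟨_, _, h₁.parR P, .parR h₂ hb, h₃.parR P⟩

theorem WeakAct.guard {P P' : Proc} {α : Act} {a : Name} (h : WeakAct P α P')
    (ha : a ∉ α.names) : WeakAct (nu a P) α (nu a P') := by
  obtain ⟨P₁, P₂, h₁, h₂, h₃⟩ := h
  exact ⟨_, _, h₁.nu a, .guard h₂ ha, h₃.nu a⟩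

theorem WeakAct.extr {P P' : Proc} {bs : List Name} {a c : Name} {M : Term}
    (h : WeakAct P (.out bs a M) P') (hca : c ≠ a) (hcM : c ∈ M.fn) (hcb : c ∉ bs) :
    WeakAct (nu c P) (.out (bs ++ [c]) a M) P' := by
  obtain ⟨P₁, P₂, h₁, h₂, h₃⟩ := h
  exact ⟨_, _, h₁.nu c, .extr h₂ hca hcM hcb, h₃⟩

theorem WeakAct.transp {P P' : Proc} {α : Act} {a : Name} (h : WeakAct P α P') (ha : a ∉ α.bn) :
    WeakAct (.loc (.free a) P) α (.loc (.free a) P') := by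
  obtain ⟨P₁, P₂, h₁, h₂, h₃⟩ := h
  exact ⟨_, _, h₁.loc a, .transp h₂ ha, h₃.loc a⟩

theorem Weak.reactL {P P' Q Q' : Proc} {bs : List Name} {a : Name} {M : Term}
    (h₁ : WeakAct P (.out bs a M) P') (h₂ : WeakAct Q (.inp a M) Q') (hb : ∀ b ∈ bs, b ∉ Q.fn) :
    Weak (.par P Q) (HOPiP.nus bs (.par P' Q')) := by
  obtain ⟨P₁, P₂, p₁, p₂, p₃⟩ := h₁
  obtain ⟨Q₁, Q₂, q₁, q₂, q₃⟩ := h₂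
  refine ((p₁.parL Q).trans (q₁.parR P₁)).trans (.head (.reactL p₂ q₂ fun b h h' => ?_)
    (Weak.nus ((p₃.parL Q₂).trans (q₃.parR P')) bs))
  exact hb b h (q₁.fn_subset h')

theorem Weak.reactR {P P' Q Q' : Proc} {bs : List Name} {a : Name} {M : Term}
    (h₁ : WeakAct P (.inp a M) P') (h₂ : WeakAct Q (.out bs a M) Q') (hb : ∀ b ∈ bs, b ∉ P.fn) :
    Weak (.par P Q) (HOPiP.nus bs (.par P' Q')) := by
  obtain ⟨P₁, P₂, p₁, p₂, p₃⟩ := h₁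
  obtain ⟨Q₁, Q₂, q₁, q₂, q₃⟩ := h₂
  refine ((p₁.parL Q).trans (q₁.parR P₁)).trans (.head (.reactR p₂ q₂ fun b h h' => ?_)
    (Weak.nus ((p₃.parL Q₂).trans (q₃.parR P')) bs))
  exact hb b h (p₁.fn_subset h')

theorem WeakAct.rep {P P' : Proc} {α : Act} (h : WeakAct (.par (.rep P) P) α P') :
    WeakAct (.rep P) α P' := by
  obtain ⟨P₁, P₂, h₁, h₂, h₃⟩ := h
  rcases h₁.cases_head with rfl | ⟨R, hR, h₁⟩
  · exact ⟨_, _, .refl, .rep h₂, h₃⟩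
  · exact ⟨_, _, .head (.rep hR) h₁, h₂, h₃⟩

/-! ### Contextual closure with capture -/

mutual
/-- The closure of a relation `B` on closed processes under all contexts with many holes, and under
adding `run` of a quotation on either side.  A hole below restrictions may refer to the names bound
there: it holds a pair of `B` after a renaming `f`, possibly of free names to bound ones, that has an
inverse `g` on the pair. -/
inductive Clo (B : Proc → Proc → Prop) : Proc → Proc → Prop
  | hole {P Q P₁ Q₁ : Proc} {f g : Chan → Chan} (h : B P₁ Q₁) (hP : P = P₁.ren f)
      (hQ : Q = Q₁.ren f) (gP : P.ren g = P₁) (gQ : Q.ren g = Q₁) : Clo B P Q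
  | nil : Clo B .nil .nil
  | inp (a : Chan) {P Q : Proc} (h : Clo B P Q) : Clo B (.inp a P) (.inp a Q)
  | out (a : Chan) {M N : Term} {P Q : Proc} (hM : TClo B M N) (h : Clo B P Q) :
      Clo B (.out a M P) (.out a N Q)
  | par {P P' Q Q' : Proc} (h₁ : Clo B P Q) (h₂ : Clo B P' Q') : Clo B (.par P P') (.par Q Q')
  | loc (a : Chan) {P Q : Proc} (h : Clo B P Q) : Clo B (.loc a P) (.loc a Q)
  | new {P Q : Proc} (h : Clo B P Q) : Clo B (.new P) (.new Q)
  | rep {P Q : Proc} (h : Clo B P Q) : Clo B (.rep P) (.rep Q)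
  | run {M N : Term} (h : TClo B M N) : Clo B (.run M) (.run N)
  | eraseL {P Q : Proc} (h : Clo B P Q) : Clo B (.run (.quote P)) Q
  | eraseR {P Q : Proc} (h : Clo B P Q) : Clo B P (.run (.quote Q))
/-- The contextual closure on terms. -/
inductive TClo (B : Proc → Proc → Prop) : Term → Term → Prop
  | var (i : ℕ) : TClo B (.var i) (.var i)
  | quote {P Q : Proc} (h : Clo B P Q) : TClo B (.quote P) (.quote Q)
end

variable {B : Proc → Proc → Prop}

mutual
theorem Clo.refl : ∀ P : Proc, Clo B P P
  | .nil => .nil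
  | .inp _ P => .inp _ (Clo.refl P)
  | .out _ M P => .out _ (TClo.refl M) (Clo.refl P)
  | .par P Q => .par (Clo.refl P) (Clo.refl Q)
  | .loc _ P => .loc _ (Clo.refl P)
  | .new P => .new (Clo.refl P)
  | .rep P => .rep (Clo.refl P)
  | .run M => .run (TClo.refl M)
theorem TClo.refl : ∀ M : Term, TClo B M M
  | .var i => .var i
  | .quote P => .quote (Clo.refl P)
end

mutual
theorem Clo.mono {B' : Proc → Proc → Prop} (hB : ∀ P Q, B P Q → B' P Q) {P Q : Proc} :
    Clo B P Q → Clo B' P Q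
  | .hole h hP hQ gP gQ => .hole (hB _ _ h) hP hQ gP gQ
  | .nil => .nil
  | .inp _ h => .inp _ (h.mono hB)
  | .out _ hM h => .out _ (hM.mono hB) (h.mono hB)
  | .par h₁ h₂ => .par (h₁.mono hB) (h₂.mono hB)
  | .loc _ h => .loc _ (h.mono hB)
  | .new h => .new (h.mono hB)
  | .rep h => .rep (h.mono hB)
  | .run h => .run (h.mono hB)
  | .eraseL h => .eraseL (h.mono hB)
  | .eraseR h => .eraseR (h.mono hB)
theorem TClo.mono {B' : Proc → Proc → Prop} (hB : ∀ P Q, B P Q → B' P Q) {M N : Term} :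
    TClo B M N → TClo B' M N
  | .var i => .var i
  | .quote h => .quote (h.mono hB)
end

mutual
theorem Clo.symm {P Q : Proc} : Clo B P Q → Clo (fun P Q => B Q P) Q P
  | .hole h hP hQ gP gQ => .hole h hQ hP gQ gP
  | .nil => .nil
  | .inp _ h => .inp _ h.symm
  | .out _ hM h => .out _ hM.symm h.symm
  | .par h₁ h₂ => .par h₁.symm h₂.symm
  | .loc _ h => .loc _ h.symm
  | .new h => .new h.symm
  | .rep h => .rep h.symm
  | .run h => .run h.symm
  | .eraseL h => .eraseR h.symm
  | .eraseR h => .eraseL h.symm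
theorem TClo.symm {M N : Term} : TClo B M N → TClo (fun P Q => B Q P) N M
  | .var i => .var i
  | .quote h => .quote h.symm
end

mutual
theorem Erase.clo {P Q : Proc} : Erase P Q → Clo B P Q
  | .erase h => .eraseR h.clo
  | .nil => .nil
  | .inp _ h => .inp _ h.clo
  | .out _ hM h => .out _ hM.clo h.clo
  | .par h₁ h₂ => .par h₁.clo h₂.clo
  | .loc _ h => .loc _ h.clo
  | .new h => .new h.clo
  | .rep h => .rep h.clo
  | .run h => .run h.clo
theorem TErase.clo {M N : Term} : TErase M N → TClo B M N
  | .var i => .var i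
  | .quote h => .quote h.clo
end

mutual
theorem Clo.ren {P Q : Proc} : Clo B P Q → ∀ f g : Chan → Chan, (P.ren f).ren g = P →
    (Q.ren f).ren g = Q → Clo B (P.ren f) (Q.ren f)
  | .hole (f := f₀) (g := g₀) h hP hQ gP gQ => fun f g h₁ h₂ => by
    refine .hole (f := f ∘ f₀) (g := g₀ ∘ g) h ?_ ?_ ?_ ?_
    · rw [hP, Proc.ren_ren]
    · rw [hQ, Proc.ren_ren]
    · rw [← Proc.ren_ren, h₁, gP]
    · rw [← Proc.ren_ren, h₂, gQ]
  | .nil => fun _ _ _ _ => .nil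
  | .inp c h => fun f g h₁ h₂ => by
    simp only [Proc.ren, Proc.inp.injEq] at h₁ h₂
    exact .inp _ (h.ren f g h₁.2 h₂.2)
  | .out c hM h => fun f g h₁ h₂ => by
    simp only [Proc.ren, Proc.out.injEq] at h₁ h₂
    exact .out _ (hM.ren f g h₁.2.1 h₂.2.1) (h.ren f g h₁.2.2 h₂.2.2)
  | .par h h' => fun f g h₁ h₂ => by
    simp only [Proc.ren, Proc.par.injEq] at h₁ h₂
    exact .par (h.ren f g h₁.1 h₂.1) (h'.ren f g h₁.2 h₂.2)
  | .loc c h => fun f g h₁ h₂ => by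
    simp only [Proc.ren, Proc.loc.injEq] at h₁ h₂
    exact .loc _ (h.ren f g h₁.2 h₂.2)
  | .new h => fun f g h₁ h₂ => by
    simp only [Proc.ren, Proc.new.injEq] at h₁ h₂
    exact .new (h.ren _ _ h₁ h₂)
  | .rep h => fun f g h₁ h₂ => by
    simp only [Proc.ren, Proc.rep.injEq] at h₁ h₂
    exact .rep (h.ren f g h₁ h₂)
  | .run h => fun f g h₁ h₂ => by
    simp only [Proc.ren, Proc.run.injEq] at h₁ h₂
    exact .run (h.ren f g h₁ h₂)
  | .eraseL h => fun f g h₁ h₂ => by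
    simp only [Proc.ren, Term.ren, Proc.run.injEq, Term.quote.injEq] at h₁
    exact .eraseL (h.ren f g h₁ h₂)
  | .eraseR h => fun f g h₁ h₂ => by
    simp only [Proc.ren, Term.ren, Proc.run.injEq, Term.quote.injEq] at h₂
    exact .eraseR (h.ren f g h₁ h₂)
theorem TClo.ren {M N : Term} : TClo B M N → ∀ f g : Chan → Chan, (M.ren f).ren g = M →
    (N.ren f).ren g = N → TClo B (M.ren f) (N.ren f)
  | .var _ => fun _ _ _ _ => .var _
  | .quote h => fun f g h₁ h₂ => by
    simp only [Term.ren, Term.quote.injEq] at h₁ h₂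
    exact .quote (h.ren f g h₁ h₂)
end

theorem Clo.perm {P Q : Proc} (h : Clo B P Q) (π : Equiv.Perm Name) :
    Clo B (P.perm π) (Q.perm π) :=
  h.ren _ (Chan.perm π⁻¹) (Proc.perm_inv_perm π P) (Proc.perm_inv_perm π Q)

theorem TClo.perm {M N : Term} (h : TClo B M N) (π : Equiv.Perm Name) :
    TClo B (M.perm π) (N.perm π) :=
  h.ren _ (Chan.perm π⁻¹) (Term.perm_inv_perm π M) (Term.perm_inv_perm π N)

theorem Clo.nu {P Q : Proc} (a : Name) (h : Clo B P Q) : Clo B (nu a P) (nu a Q) := by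
  rw [nu_eq, nu_eq]
  exact .new (h.ren _ (Chan.opn a) (Proc.opn_abs a P) (Proc.opn_abs a Q))

mutual
/-- The pairs of `B` are closed, so that substitutions do not reach into the holes. -/
theorem Clo.subst (hB : ∀ P Q, B P Q → P.Closed ∧ Q.Closed) {M N : Term} (hM : TClo B M N)
    {P Q : Proc} : Clo B P Q → ∀ k, Clo B (P.subst M k) (Q.subst N k)
  | .hole h hP hQ gP gQ => fun k => by
    have e₁ : P.subst M k = P := by
      rw [hP]; exact Proc.ren_subst_of_scoped M _ _ (hB _ _ h).1 (Nat.zero_le k)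
    have e₂ : Q.subst N k = Q := by
      rw [hQ]; exact Proc.ren_subst_of_scoped N _ _ (hB _ _ h).2 (Nat.zero_le k)
    rw [e₁, e₂]
    exact .hole h hP hQ gP gQ
  | .nil => fun _ => .nil
  | .inp c h => fun k => .inp _ (h.subst hB hM (k + 1))
  | .out c hL h => fun k => .out _ (TClo.subst hB hM hL k) (h.subst hB hM k)
  | .par h h' => fun k => .par (h.subst hB hM k) (h'.subst hB hM k)
  | .loc c h => fun k => .loc _ (h.subst hB hM k)
  | .new h => fun k => .new (h.subst hB hM k)
  | .rep h => fun k => .rep (h.subst hB hM k)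
  | .run h => fun k => .run (TClo.subst hB hM h k)
  | .eraseL h => fun k => .eraseL (h.subst hB hM k)
  | .eraseR h => fun k => .eraseR (h.subst hB hM k)
theorem TClo.subst (hB : ∀ P Q, B P Q → P.Closed ∧ Q.Closed) {M N : Term} (hM : TClo B M N)
    {L L' : Term} : TClo B L L' → ∀ k, TClo B (Term.subst M k L) (Term.subst N k L')
  | .var i => fun k => by
    simp only [Term.subst]
    split_ifs
    · exact hM
    · exact .var _
    · exact .var _
  | .quote h => fun k => .quote (h.subst hB hM k)
end

theorem Proc.mem_fn_ren_scoped {P : Proc} {m : ℕ} (hP : P.Scoped 0 m) (f : Chan → Chan) (b : Name) :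
    b ∈ (P.ren f).fn ↔ ∃ a ∈ P.fn, f (.free a) = .free b := by
  let f' : Chan → Chan := fun c => match c with
    | .free a => f (.free a)
    | .bound i => .bound i
  rw [Proc.ren_congr_scoped hP (f := f) (g := f') fun a _ => rfl,
    Proc.mem_fn_ren _ _ _ fun i c h => by cases h]

mutual
theorem Clo.fn_eq (hB : ∀ P Q, B P Q → P.Closed ∧ Q.Closed) (hfn : ∀ P Q, B P Q → P.fn = Q.fn)
    {P Q : Proc} : Clo B P Q → P.fn = Q.fn
  | .hole h hP hQ _ _ => by
    ext b
    rw [hP, hQ, Proc.mem_fn_ren_scoped (hB _ _ h).1, Proc.mem_fn_ren_scoped (hB _ _ h).2,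
      hfn _ _ h]
  | .nil => rfl
  | .inp c h => by simp only [Proc.fn, h.fn_eq hB hfn]
  | .out c hL h => by simp only [Proc.fn, h.fn_eq hB hfn, hL.fn_eq hB hfn]
  | .par h h' => by simp only [Proc.fn, h.fn_eq hB hfn, h'.fn_eq hB hfn]
  | .loc c h => by simp only [Proc.fn, h.fn_eq hB hfn]
  | .new h => by simp only [Proc.fn, h.fn_eq hB hfn]
  | .rep h => by simp only [Proc.fn, h.fn_eq hB hfn]
  | .run h => by simp only [Proc.fn, h.fn_eq hB hfn]
  | .eraseL h => by simp only [Proc.fn, Term.fn, h.fn_eq hB hfn]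
  | .eraseR h => by simp only [Proc.fn, Term.fn, h.fn_eq hB hfn]
theorem TClo.fn_eq (hB : ∀ P Q, B P Q → P.Closed ∧ Q.Closed) (hfn : ∀ P Q, B P Q → P.fn = Q.fn)
    {M N : Term} : TClo B M N → M.fn = N.fn
  | .var _ => rfl
  | .quote h => by simp only [Term.fn, h.fn_eq hB hfn]
end

/-- The contextual closure of `B` up to structural congruence. -/
def Cong (B : Proc → Proc → Prop) (P Q : Proc) : Prop :=
  ∃ P' Q', SCong P P' ∧ Clo B P' Q' ∧ SCong Q' Q

/-- The contextual closure of `B` up to structural congruence, on terms. -/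
def TCong (B : Proc → Proc → Prop) (M N : Term) : Prop :=
  ∃ M' N', TSCong M M' ∧ TClo B M' N' ∧ TSCong N' N

theorem Clo.cong {P Q : Proc} (h : Clo B P Q) : Cong B P Q := ⟨P, Q, .refl P, h, .refl Q⟩

theorem SCong.cong {P Q : Proc} (h : SCong P Q) : Cong B P Q := ⟨Q, Q, h, .refl Q, .refl Q⟩

theorem Cong.refl (P : Proc) : Cong B P P := (SCong.refl P).cong

theorem TCong.refl (M : Term) : TCong B M M := ⟨M, M, .refl M, .refl M, .refl M⟩

theorem SCong.trans_cong {P Q R : Proc} (h : SCong P Q) (h' : Cong B Q R) : Cong B P R := by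
  obtain ⟨Q', R', h₁, h₂, h₃⟩ := h'
  exact ⟨Q', R', h.trans h₁, h₂, h₃⟩

theorem Cong.trans_scong {P Q R : Proc} (h' : Cong B P Q) (h : SCong Q R) : Cong B P R := by
  obtain ⟨Q', R', h₁, h₂, h₃⟩ := h'
  exact ⟨Q', R', h₁, h₂, h₃.trans h⟩

theorem TSCong.trans_tcong {L M N : Term} (h : TSCong L M) (h' : TCong B M N) : TCong B L N := by
  obtain ⟨Q', R', h₁, h₂, h₃⟩ := h'
  exact ⟨Q', R', h.trans h₁, h₂, h₃⟩

theorem TCong.trans_tscong {L M N : Term} (h' : TCong B L M) (h : TSCong M N) : TCong B L N := by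
  obtain ⟨Q', R', h₁, h₂, h₃⟩ := h'
  exact ⟨Q', R', h₁, h₂, h₃.trans h⟩

theorem Cong.mono {B' : Proc → Proc → Prop} (hB : ∀ P Q, B P Q → B' P Q) {P Q : Proc}
    (h : Cong B P Q) : Cong B' P Q := by
  obtain ⟨Q', R', h₁, h₂, h₃⟩ := h
  exact ⟨Q', R', h₁, h₂.mono hB, h₃⟩

theorem TCong.mono {B' : Proc → Proc → Prop} (hB : ∀ P Q, B P Q → B' P Q) {M N : Term}
    (h : TCong B M N) : TCong B' M N := by
  obtain ⟨Q', R', h₁, h₂, h₃⟩ := h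
  exact ⟨Q', R', h₁, h₂.mono hB, h₃⟩

theorem Cong.symm (hB : ∀ P Q, B P Q → B Q P) {P Q : Proc} (h : Cong B P Q) : Cong B Q P := by
  obtain ⟨Q', R', h₁, h₂, h₃⟩ := h
  exact ⟨R', Q', h₃.symm, h₂.symm.mono fun P Q => hB Q P, h₁.symm⟩

theorem TCong.quote {P Q : Proc} (h : Cong B P Q) : TCong B (.quote P) (.quote Q) := by
  obtain ⟨P', Q', h₁, h₂, h₃⟩ := h
  exact ⟨_, _, .quote h₁, .quote h₂, .quote h₃⟩

theorem TCong.of_quote {P Q : Proc} (h : TCong B (.quote P) (.quote Q)) : Cong B P Q := by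
  obtain ⟨M', N', h₁, h₂, h₃⟩ := h
  cases h₁ with
  | quote h₁ =>
    cases h₂ with
    | quote h₂ =>
      cases h₃ with
      | quote h₃ => exact ⟨_, _, h₁, h₂, h₃⟩

theorem Cong.inp (c : Chan) {P Q : Proc} (h : Cong B P Q) : Cong B (.inp c P) (.inp c Q) := by
  obtain ⟨P', Q', h₁, h₂, h₃⟩ := h
  exact ⟨_, _, .inp c h₁, .inp c h₂, .inp c h₃⟩

theorem Cong.out (c : Chan) {M N : Term} {P Q : Proc} (hM : TCong B M N) (h : Cong B P Q) :
    Cong B (.out c M P) (.out c N Q) := by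
  obtain ⟨P', Q', h₁, h₂, h₃⟩ := h
  obtain ⟨M', N', k₁, k₂, k₃⟩ := hM
  exact ⟨_, _, .out c k₁ h₁, .out c k₂ h₂, .out c k₃ h₃⟩

theorem Cong.par {P Q P' Q' : Proc} (h : Cong B P Q) (h' : Cong B P' Q') :
    Cong B (.par P P') (.par Q Q') := by
  obtain ⟨P₁, Q₁, h₁, h₂, h₃⟩ := h
  obtain ⟨P₂, Q₂, k₁, k₂, k₃⟩ := h'
  exact ⟨_, _, .par h₁ k₁, .par h₂ k₂, .par h₃ k₃⟩

theorem Cong.loc (c : Chan) {P Q : Proc} (h : Cong B P Q) : Cong B (.loc c P) (.loc c Q) := by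
  obtain ⟨P', Q', h₁, h₂, h₃⟩ := h
  exact ⟨_, _, .loc c h₁, .loc c h₂, .loc c h₃⟩

theorem Cong.new {P Q : Proc} (h : Cong B P Q) : Cong B (.new P) (.new Q) := by
  obtain ⟨P', Q', h₁, h₂, h₃⟩ := h
  exact ⟨_, _, .new h₁, .new h₂, .new h₃⟩

theorem Cong.nu (a : Name) {P Q : Proc} (h : Cong B P Q) : Cong B (nu a P) (nu a Q) := by
  obtain ⟨P', Q', h₁, h₂, h₃⟩ := h
  exact ⟨_, _, .nu a h₁, .nu a h₂, .nu a h₃⟩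

theorem Cong.nus {P Q : Proc} (h : Cong B P Q) : ∀ bs : List Name, Cong B (nus bs P) (nus bs Q)
  | [] => h
  | b :: bs => (h.nus bs).nu b

theorem Cong.rep {P Q : Proc} (h : Cong B P Q) : Cong B (.rep P) (.rep Q) := by
  obtain ⟨P', Q', h₁, h₂, h₃⟩ := h
  exact ⟨_, _, .rep h₁, .rep h₂, .rep h₃⟩

theorem Cong.run {M N : Term} (h : TCong B M N) : Cong B (.run M) (.run N) := by
  obtain ⟨P', Q', h₁, h₂, h₃⟩ := h
  exact ⟨_, _, .run h₁, .run h₂, .run h₃⟩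

theorem Cong.perm {P Q : Proc} (h : Cong B P Q) (π : Equiv.Perm Name) :
    Cong B (P.perm π) (Q.perm π) := by
  obtain ⟨P', Q', h₁, h₂, h₃⟩ := h
  exact ⟨_, _, h₁.perm π, h₂.perm π, h₃.perm π⟩

theorem TCong.perm {M N : Term} (h : TCong B M N) (π : Equiv.Perm Name) :
    TCong B (M.perm π) (N.perm π) := by
  obtain ⟨P', Q', h₁, h₂, h₃⟩ := h
  exact ⟨_, _, h₁.perm π, h₂.perm π, h₃.perm π⟩

theorem Cong.subst (hB : ∀ P Q, B P Q → P.Closed ∧ Q.Closed) {M N : Term} (hMN : TCong B M N)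
    (hM : M.Closed) (hN : N.Closed) {P Q : Proc} (h : Cong B P Q) (k : ℕ) :
    Cong B (P.subst M k) (Q.subst N k) := by
  obtain ⟨P', Q', h₁, h₂, h₃⟩ := h
  obtain ⟨M', N', k₁, k₂, k₃⟩ := hMN
  exact ⟨_, _, (h₁.subst hM k).trans (P'.subst_scong k₁ k), h₂.subst hB k₂ k,
    (Q'.subst_scong k₃ k).trans (h₃.subst hN k)⟩

/-! ### Congruence of weak bisimulations that preserve free names -/

/-- `Q` answers the transition with action `α` of another process to `P'`: the residuals and the
messages sent are related up to context, and an input is answered for all related messages.  Bound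
names need not be renamed in the answer because the relations considered preserve free names. -/
def Matches (B : Proc → Proc → Prop) (P' Q : Proc) : Act → Prop
  | .tau => ∃ Q', Weak Q Q' ∧ Cong B P' Q'
  | .inp a M => ∀ N : Term, N.Closed → TCong B M N → ∃ Q', WeakAct Q (.inp a N) Q' ∧ Cong B P' Q'
  | .out bs a M => ∃ N Q', WeakAct Q (.out bs a N) Q' ∧ TCong B M N ∧ Cong B P' Q'

/-- Symmetric relations on closed processes that preserve free names and are weak bisimulations up to
context. -/
structure Progressing (B : Proc → Proc → Prop) : Prop where
  closed : ∀ P Q, B P Q → P.Closed ∧ Q.Closed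
  symm : ∀ P Q, B P Q → B Q P
  fn_eq : ∀ P Q, B P Q → P.fn = Q.fn
  progress : ∀ P Q, B P Q → ∀ α P', Step P α P' → Matches B P' Q α

theorem Matches.of_weak {P' Q Q₀ : Proc} {α : Act} (h : Weak Q Q₀) (hm : Matches B P' Q₀ α) :
    Matches B P' Q α := by
  cases α with
  | tau =>
    obtain ⟨Q', hQ, hc⟩ := hm
    exact ⟨Q', Relation.ReflTransGen.trans h hQ, hc⟩
  | inp a M =>
    intro N hN hMN
    obtain ⟨Q', hQ, hc⟩ := hm N hN hMN
    exact ⟨Q', h.weakAct hQ, hc⟩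
  | out bs a M =>
    obtain ⟨N, Q', hQ, hc⟩ := hm
    exact ⟨N, Q', h.weakAct hQ, hc⟩

theorem Matches.perm {P' Q : Proc} {α : Act} (π : Equiv.Perm Name) (hm : Matches B P' Q α) :
    Matches B (P'.perm π) (Q.perm π) (α.perm π) := by
  cases α with
  | tau =>
    obtain ⟨Q', hQ, hc⟩ := hm
    exact ⟨_, hQ.perm π, hc.perm π⟩
  | inp a M =>
    intro N hN hMN
    have h := hMN.perm π⁻¹
    rw [Term.perm_inv_perm] at h
    obtain ⟨Q', hQ, hc⟩ := hm _ (Term.scoped_perm.2 hN) h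
    have hQ := hQ.perm π
    rw [Act.perm, Term.perm_perm_inv] at hQ
    exact ⟨_, hQ, hc.perm π⟩
  | out bs a M =>
    obtain ⟨N, Q', hQ, hM, hc⟩ := hm
    exact ⟨_, _, hQ.perm π, hM.perm π, hc.perm π⟩

/-- An injection on a finite set of names extends to a permutation. -/
theorem exists_perm_extending (φ : Name → Name) (s : Finset Name) (hφ : Set.InjOn φ s) :
    ∃ π : Equiv.Perm Name, ∀ a ∈ s, π a = φ a := by
  induction s using Finset.induction_on with
  | empty => exact ⟨1, by simp⟩
  | insert a s ha ih =>
    obtain ⟨π, hπ⟩ := ih (hφ.mono (by simp))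
    refine ⟨Equiv.swap (π a) (φ a) * π, fun b hb => ?_⟩
    rcases Finset.mem_insert.1 hb with rfl | hb'
    · simp
    · have hba : b ≠ a := fun e => ha (e ▸ hb')
      rw [Equiv.Perm.mul_apply, Equiv.swap_apply_of_ne_of_ne, hπ b hb']
      · exact fun e => hba (π.injective e)
      · rw [hπ b hb']
        exact fun e => hba (hφ (by simp [hb']) (by simp) e)

theorem Chan.shift_eq_free {x : Chan} {c : Name} : x.shift = .free c ↔ x = .free c := by
  cases x <;> simp [Chan.shift]

mutual
theorem Proc.ren_eq_self : ∀ (P : Proc) (f : Chan → Chan), P.ren f = P →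
    ∀ a ∈ P.fn, f (.free a) = .free a
  | .nil, _, _, _, h => by simp [Proc.fn] at h
  | .inp c P, f, e, a, h => by
    simp only [Proc.ren, Proc.inp.injEq] at e
    rcases Finset.mem_union.1 h with h | h
    · exact Chan.map_eq_self c f e.1 a h
    · exact Proc.ren_eq_self P f e.2 a h
  | .out c M P, f, e, a, h => by
    simp only [Proc.ren, Proc.out.injEq] at e
    simp only [Proc.fn, Finset.mem_union] at h
    rcases h with (h | h) | h
    · exact Chan.map_eq_self c f e.1 a h
    · exact Term.ren_eq_self M f e.2.1 a h
    · exact Proc.ren_eq_self P f e.2.2 a h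
  | .par P Q, f, e, a, h => by
    simp only [Proc.ren, Proc.par.injEq] at e
    rcases Finset.mem_union.1 h with h | h
    · exact Proc.ren_eq_self P f e.1 a h
    · exact Proc.ren_eq_self Q f e.2 a h
  | .loc c P, f, e, a, h => by
    simp only [Proc.ren, Proc.loc.injEq] at e
    rcases Finset.mem_union.1 h with h | h
    · exact Chan.map_eq_self c f e.1 a h
    · exact Proc.ren_eq_self P f e.2 a h
  | .new P, f, e, a, h => by
    simp only [Proc.ren, Proc.new.injEq] at e
    exact Chan.shift_eq_free.1 (Proc.ren_eq_self P (Chan.lift f) e a h)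
  | .rep P, f, e, a, h => by
    simp only [Proc.ren, Proc.rep.injEq] at e
    exact Proc.ren_eq_self P f e a h
  | .run M, f, e, a, h => by
    simp only [Proc.ren, Proc.run.injEq] at e
    exact Term.ren_eq_self M f e a h
theorem Term.ren_eq_self : ∀ (M : Term) (f : Chan → Chan), M.ren f = M →
    ∀ a ∈ M.fn, f (.free a) = .free a
  | .var _, _, _, _, h => by simp [Term.fn] at h
  | .quote P, f, e, a, h => by
    simp only [Term.ren, Term.quote.injEq] at e
    exact Proc.ren_eq_self P f e a h
theorem Chan.map_eq_self : ∀ (c : Chan) (f : Chan → Chan), f c = c →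
    ∀ a ∈ c.fn, f (.free a) = .free a
  | .free b, f, e, a, h => by
    simp only [Chan.fn, Finset.mem_singleton] at h
    rw [h, e]
  | .bound _, _, _, _, h => by simp [Chan.fn] at h
end

theorem Chan.scoped_shift {k : ℕ} {x : Chan} : x.shift.Scoped (k + 1) ↔ x.Scoped k := by
  cases x <;> simp [Chan.shift, Chan.Scoped]

mutual
theorem Proc.scoped_of_ren : ∀ (P : Proc) (f : Chan → Chan) {k m : ℕ}, (P.ren f).Scoped k m →
    ∀ a ∈ P.fn, (f (.free a)).Scoped k
  | .nil, _, _, _, _, _, h => by simp [Proc.fn] at h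
  | .inp c P, f, _, _, e, a, h => by
    rcases Finset.mem_union.1 h with h | h
    · exact Chan.scoped_of_map c f e.1 a h
    · exact Proc.scoped_of_ren P f e.2 a h
  | .out c M P, f, _, _, e, a, h => by
    simp only [Proc.fn, Finset.mem_union] at h
    rcases h with (h | h) | h
    · exact Chan.scoped_of_map c f e.1 a h
    · exact Term.scoped_of_ren M f e.2.1 a h
    · exact Proc.scoped_of_ren P f e.2.2 a h
  | .par P Q, f, _, _, e, a, h => by
    rcases Finset.mem_union.1 h with h | h
    · exact Proc.scoped_of_ren P f e.1 a h
    · exact Proc.scoped_of_ren Q f e.2 a h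
  | .loc c P, f, _, _, e, a, h => by
    rcases Finset.mem_union.1 h with h | h
    · exact Chan.scoped_of_map c f e.1 a h
    · exact Proc.scoped_of_ren P f e.2 a h
  | .new P, f, k, m, e, a, h =>
    Chan.scoped_shift.1 (Proc.scoped_of_ren P (Chan.lift f) (k := k + 1) (m := m) e a h)
  | .rep P, f, k, m, e, a, h => Proc.scoped_of_ren P f (k := k) (m := m) e a h
  | .run M, f, k, m, e, a, h => Term.scoped_of_ren M f (k := k) (m := m) e a h
theorem Term.scoped_of_ren : ∀ (M : Term) (f : Chan → Chan) {k m : ℕ}, (M.ren f).Scoped k m →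
    ∀ a ∈ M.fn, (f (.free a)).Scoped k
  | .var _, _, _, _, _, _, h => by simp [Term.fn] at h
  | .quote P, f, k, m, e, a, h => Proc.scoped_of_ren P f (k := k) (m := m) e a h
theorem Chan.scoped_of_map : ∀ (c : Chan) (f : Chan → Chan) {k : ℕ}, (f c).Scoped k →
    ∀ a ∈ c.fn, (f (.free a)).Scoped k
  | .free b, f, _, e, a, h => by
    simp only [Chan.fn, Finset.mem_singleton] at h
    rwa [h]
  | .bound _, _, _, _, _, h => by simp [Chan.fn] at h
end

/-- On a closed process, an invertible renaming with closed result is a permutation of free names. -/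
theorem Proc.exists_perm_of_ren {P : Proc} {f g : Chan → Chan} (h : (P.ren f).Closed)
    (e : (P.ren f).ren g = P) : ∃ π : Equiv.Perm Name, ∀ a ∈ P.fn, f (.free a) = .free (π a) := by
  rw [Proc.ren_ren] at e
  have hf : ∀ a ∈ P.fn, ∃ b, f (.free a) = .free b := by
    intro a ha
    have := P.scoped_of_ren f h a ha
    cases hfa : f (.free a) with
    | free b => exact ⟨b, rfl⟩
    | bound i => rw [hfa] at this; exact absurd this (Nat.not_lt_zero i)
  choose! φ hφ using hf
  obtain ⟨π, hπ⟩ := exists_perm_extending φ P.fn fun a ha b hb hab => by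
    have h₁ := P.ren_eq_self _ e a ha
    have h₂ := P.ren_eq_self _ e b hb
    simp only [Function.comp, hφ a ha, hφ b hb, hab] at h₁ h₂
    simpa using h₁.symm.trans h₂
  exact ⟨π, fun a ha => by rw [hφ a ha, hπ a ha]⟩

/-- The renaming at a hole acts on a closed process as a permutation, and transitions are preserved by
permutations of names. -/
theorem Progressing.hole_matches (hB : Progressing B) {P Q P₁ Q₁ : Proc} {f g : Chan → Chan}
    (h : B P₁ Q₁) (hP : P = P₁.ren f) (hQ : Q = Q₁.ren f) (gP : P.ren g = P₁)
    (hPc : P.Closed) {α : Act} {P' : Proc} (hs : Step P α P') : Matches B P' Q α := by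
  rw [hP] at gP hPc
  obtain ⟨π, hπ⟩ := Proc.exists_perm_of_ren hPc gP
  have eP : P = P₁.perm π := by
    rw [hP]; exact Proc.ren_congr_scoped (hB.closed _ _ h).1 hπ
  have eQ : Q = Q₁.perm π := by
    rw [hQ]
    refine Proc.ren_congr_scoped (hB.closed _ _ h).2 fun a ha => hπ a ?_
    rwa [hB.fn_eq _ _ h]
  have hs' := hs.perm π⁻¹
  rw [eP, Proc.perm_inv_perm] at hs'
  have := (hB.progress _ _ h _ _ hs').perm π
  rwa [Proc.perm_perm_inv, Act.perm_perm_inv, ← eQ] at this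

/-- The pairs of the contextual closure without a superfluous `run` at the root on the right. -/
inductive CloHead (B : Proc → Proc → Prop) : Proc → Proc → Prop
  | hole {P Q P₁ Q₁ : Proc} {f g : Chan → Chan} (h : B P₁ Q₁) (hP : P = P₁.ren f)
      (hQ : Q = Q₁.ren f) (gP : P.ren g = P₁) : CloHead B P Q
  | nil : CloHead B .nil .nil
  | inp (a : Chan) {P Q : Proc} (h : Clo B P Q) : CloHead B (.inp a P) (.inp a Q)
  | out (a : Chan) {M N : Term} {P Q : Proc} (hM : TClo B M N) (h : Clo B P Q) :
      CloHead B (.out a M P) (.out a N Q)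
  | par {P P' Q Q' : Proc} (h₁ : Clo B P Q) (h₂ : Clo B P' Q') : CloHead B (.par P P') (.par Q Q')
  | loc (a : Chan) {P Q : Proc} (h : Clo B P Q) : CloHead B (.loc a P) (.loc a Q)
  | new {P Q : Proc} (h : Clo B P Q) : CloHead B (.new P) (.new Q)
  | rep {P Q : Proc} (h : Clo B P Q) : CloHead B (.rep P) (.rep Q)
  | run {M N : Term} (h : TClo B M N) : CloHead B (.run M) (.run N)
  | eraseL {P Q : Proc} (h : Clo B P Q) : CloHead B (.run (.quote P)) Q

/-- A `run` at the root on the right can be executed. -/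
theorem Clo.head {P Q : Proc} : Clo B P Q → ∃ Q₀, Weak Q Q₀ ∧ CloHead B P Q₀
  | .hole h hP hQ gP _ => ⟨_, .refl, .hole h hP hQ gP⟩
  | .nil => ⟨_, .refl, .nil⟩
  | .inp _ h => ⟨_, .refl, .inp _ h⟩
  | .out _ hM h => ⟨_, .refl, .out _ hM h⟩
  | .par h₁ h₂ => ⟨_, .refl, .par h₁ h₂⟩
  | .loc _ h => ⟨_, .refl, .loc _ h⟩
  | .new h => ⟨_, .refl, .new h⟩
  | .rep h => ⟨_, .refl, .rep h⟩
  | .run h => ⟨_, .refl, .run h⟩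
  | .eraseL h => ⟨_, .refl, .eraseL h⟩
  | .eraseR h => by
    obtain ⟨Q₀, hw, hd⟩ := h.head
    exact ⟨Q₀, .head (.run _) hw, hd⟩

/-- The name bound by two related restrictions can be the same on both sides, as related processes have
the same free names. -/
theorem Clo.new_inv (hB : Progressing B) {a : Name} {P Q : Proc} (h : Clo B (P.abs a 0) Q) :
    ∃ Q', Proc.new Q = HOPiP.nu a Q' ∧ Clo B P Q' := by
  rw [Proc.abs_eq_ren] at h
  have ha : a ∉ Q.fn := by
    rw [← h.fn_eq hB.closed hB.fn_eq]
    have : a ∉ (HOPiP.nu a P).fn := by simp [mem_fn_nu]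
    rwa [nu_eq] at this
  refine ⟨_, new_eq_nu ha, ?_⟩
  have := h.ren (Chan.opn a) (Chan.abs a 0) (by rw [Proc.opn_abs]) (Proc.abs_opn ha)
  rwa [Proc.opn_abs] at this

theorem TCong.fn_eq (hB : Progressing B) {M N : Term} (h : TCong B M N) : M.fn = N.fn := by
  obtain ⟨M', N', h₁, h₂, h₃⟩ := h
  rw [h₁.fn_eq, h₂.fn_eq hB.closed hB.fn_eq, h₃.fn_eq]

/-- The contextual closure of a progressing relation is a weak bisimulation up to structural
congruence. -/
theorem Clo.matches (hB : Progressing B) {P P' : Proc} {α : Act} (hs : Step P α P') :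
    ∀ Q, Clo B P Q → P.Closed → Q.Closed → Matches B P' Q α := by
  have fnB : ∀ {P Q : Proc}, Clo B P Q → P.fn = Q.fn := fun h => h.fn_eq hB.closed hB.fn_eq
  induction hs with
  | inp a P M hM =>
    intro Q hK hP hQ
    obtain ⟨Q₀, hw, hd⟩ := hK.head
    refine Matches.of_weak hw ?_
    cases hd with
    | hole h e₁ e₂ gP => exact hB.hole_matches h e₁ e₂ gP hP (.inp a P M hM)
    | inp _ h =>
      intro N hN hMN
      exact ⟨_, (Step.inp a _ N hN).weakAct, h.cong.subst hB.closed hMN hM hN 0⟩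
  | out a M P =>
    intro Q hK hP hQ
    obtain ⟨Q₀, hw, hd⟩ := hK.head
    refine Matches.of_weak hw ?_
    cases hd with
    | hole h e₁ e₂ gP => exact hB.hole_matches h e₁ e₂ gP hP (.out a M P)
    | out _ hM h => exact ⟨_, _, (Step.out a _ _).weakAct, ⟨_, _, .refl _, hM, .refl _⟩, h.cong⟩
  | @parL P₁ P₂ P₁' α hs hb ih =>
    intro Q hK hP hQ
    obtain ⟨Q₀, hw, hd⟩ := hK.head
    have hQ₀ := hw.closed hQ
    refine Matches.of_weak hw ?_
    cases hd with
    | hole h e₁ e₂ gP => exact hB.hole_matches h e₁ e₂ gP hP (.parL hs hb)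
    | par h₁ h₂ =>
      have hm := ih _ h₁ hP.1 hQ₀.1
      rw [fnB h₂] at hb
      cases α with
      | tau =>
        obtain ⟨Q', hQ', hc⟩ := hm
        exact ⟨_, hQ'.parL _, hc.par h₂.cong⟩
      | inp a M =>
        intro N hN hMN
        obtain ⟨Q', hQ', hc⟩ := hm N hN hMN
        exact ⟨_, hQ'.parL hb, hc.par h₂.cong⟩
      | out bs a M =>
        obtain ⟨N, Q', hQ', hMN, hc⟩ := hm
        exact ⟨N, _, hQ'.parL hb, hMN, hc.par h₂.cong⟩
  | @parR P₁ P₂ P₂' α hs hb ih =>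
    intro Q hK hP hQ
    obtain ⟨Q₀, hw, hd⟩ := hK.head
    have hQ₀ := hw.closed hQ
    refine Matches.of_weak hw ?_
    cases hd with
    | hole h e₁ e₂ gP => exact hB.hole_matches h e₁ e₂ gP hP (.parR hs hb)
    | par h₁ h₂ =>
      have hm := ih _ h₂ hP.2 hQ₀.2
      rw [fnB h₁] at hb
      cases α with
      | tau =>
        obtain ⟨Q', hQ', hc⟩ := hm
        exact ⟨_, hQ'.parR _, h₁.cong.par hc⟩
      | inp a M =>
        intro N hN hMN
        obtain ⟨Q', hQ', hc⟩ := hm N hN hMN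
        exact ⟨_, hQ'.parR hb, h₁.cong.par hc⟩
      | out bs a M =>
        obtain ⟨N, Q', hQ', hMN, hc⟩ := hm
        exact ⟨N, _, hQ'.parR hb, hMN, h₁.cong.par hc⟩
  | @rep P P' α hs ih =>
    intro Q hK hP hQ
    obtain ⟨Q₀, hw, hd⟩ := hK.head
    have hQ₀ := hw.closed hQ
    refine Matches.of_weak hw ?_
    cases hd with
    | hole h e₁ e₂ gP => exact hB.hole_matches h e₁ e₂ gP hP (.rep hs)
    | rep h =>
      have hm := ih _ (.par (.rep h) h) ⟨hP, hP⟩ ⟨hQ₀, hQ₀⟩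
      cases α with
      | tau =>
        obtain ⟨Q', hQ', hc⟩ := hm
        rcases hQ'.cases_head with rfl | ⟨R, hR, hQ'⟩
        · exact ⟨_, .refl, hc.trans_scong (SCong.rep_absorb _)⟩
        · exact ⟨_, .head (.rep hR) hQ', hc⟩
      | inp a M =>
        intro N hN hMN
        obtain ⟨Q', hQ', hc⟩ := hm N hN hMN
        exact ⟨_, hQ'.rep, hc⟩
      | out bs a M =>
        obtain ⟨N, Q', hQ', hMN, hc⟩ := hm
        exact ⟨N, _, hQ'.rep, hMN, hc⟩
  | reactL hs₁ hs₂ hb ih₁ ih₂ =>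
    intro Q hK hP hQ
    obtain ⟨Q₀, hw, hd⟩ := hK.head
    have hQ₀ := hw.closed hQ
    refine Matches.of_weak hw ?_
    cases hd with
    | hole h e₁ e₂ gP => exact hB.hole_matches h e₁ e₂ gP hP (.reactL hs₁ hs₂ hb)
    | par h₁ h₂ =>
      obtain ⟨N, Q₁', hQ₁', hMN, hc⟩ := ih₁ _ h₁ hP.1 hQ₀.1
      obtain ⟨Q₂', hQ₂', hc'⟩ := ih₂ _ h₂ hP.2 hQ₀.2 N ((hQ₁'.closed hQ₀.1).2 _ _ _ rfl) hMN
      rw [fnB h₂] at hb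
      exact ⟨_, .reactL hQ₁' hQ₂' hb, (hc.par hc').nus _⟩
  | reactR hs₁ hs₂ hb ih₁ ih₂ =>
    intro Q hK hP hQ
    obtain ⟨Q₀, hw, hd⟩ := hK.head
    have hQ₀ := hw.closed hQ
    refine Matches.of_weak hw ?_
    cases hd with
    | hole h e₁ e₂ gP => exact hB.hole_matches h e₁ e₂ gP hP (.reactR hs₁ hs₂ hb)
    | par h₁ h₂ =>
      obtain ⟨N, Q₂', hQ₂', hMN, hc⟩ := ih₂ _ h₂ hP.2 hQ₀.2
      obtain ⟨Q₁', hQ₁', hc'⟩ := ih₁ _ h₁ hP.1 hQ₀.1 N ((hQ₂'.closed hQ₀.2).2 _ _ _ rfl) hMN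
      rw [fnB h₁] at hb
      exact ⟨_, .reactR hQ₁' hQ₂' hb, (hc'.par hc).nus _⟩
  | @guard P P' α a hs ha ih =>
    intro Q hK hP hQ
    obtain ⟨Q₀, hw, hd⟩ := hK.head
    have hQ₀ := hw.closed hQ
    refine Matches.of_weak hw ?_
    generalize hX : HOPiP.nu a P = X at hd
    cases hd with
    | hole h e₁ e₂ gP =>
      subst hX
      exact hB.hole_matches h e₁ e₂ gP hP (.guard hs ha)
    | new h =>
      cases hX
      obtain ⟨Q₁, e, h⟩ := h.new_inv hB
      rw [e] at hQ₀ ⊢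
      have hm := ih _ h (scoped_nu.1 hP) (scoped_nu.1 hQ₀)
      cases α with
      | tau =>
        obtain ⟨Q', hQ', hc⟩ := hm
        exact ⟨_, hQ'.nu a, hc.nu a⟩
      | inp b M =>
        intro N hN hMN
        obtain ⟨Q', hQ', hc⟩ := hm N hN hMN
        exact ⟨_, hQ'.guard (by rwa [Act.names, ← hMN.fn_eq hB]), hc.nu a⟩
      | out bs b M =>
        obtain ⟨N, Q', hQ', hMN, hc⟩ := hm
        exact ⟨N, _, hQ'.guard (by rwa [Act.names, ← hMN.fn_eq hB]), hMN, hc.nu a⟩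
    | _ => cases hX
  | @extr P P' bs a c M hs hca hcM hcb ih =>
    intro Q hK hP hQ
    obtain ⟨Q₀, hw, hd⟩ := hK.head
    have hQ₀ := hw.closed hQ
    refine Matches.of_weak hw ?_
    generalize hX : HOPiP.nu c P = X at hd
    cases hd with
    | hole h e₁ e₂ gP =>
      subst hX
      exact hB.hole_matches h e₁ e₂ gP hP (.extr hs hca hcM hcb)
    | new h =>
      cases hX
      obtain ⟨Q₁, e, h⟩ := h.new_inv hB
      rw [e] at hQ₀ ⊢
      obtain ⟨N, Q', hQ', hMN, hc⟩ := ih _ h (scoped_nu.1 hP) (scoped_nu.1 hQ₀)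
      exact ⟨N, _, hQ'.extr hca (by rwa [← hMN.fn_eq hB]) hcb, hMN, hc⟩
    | _ => cases hX
  | @transp P P' α a hs ha ih =>
    intro Q hK hP hQ
    obtain ⟨Q₀, hw, hd⟩ := hK.head
    have hQ₀ := hw.closed hQ
    refine Matches.of_weak hw ?_
    cases hd with
    | hole h e₁ e₂ gP => exact hB.hole_matches h e₁ e₂ gP hP (.transp hs ha)
    | loc _ h =>
      have hm := ih _ h hP.2 hQ₀.2
      cases α with
      | tau =>
        obtain ⟨Q', hQ', hc⟩ := hm
        exact ⟨_, hQ'.loc a, hc.loc _⟩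
      | inp b M =>
        intro N hN hMN
        obtain ⟨Q', hQ', hc⟩ := hm N hN hMN
        exact ⟨_, hQ'.transp ha, hc.loc _⟩
      | out bs b M =>
        obtain ⟨N, Q', hQ', hMN, hc⟩ := hm
        exact ⟨N, _, hQ'.transp ha, hMN, hc.loc _⟩
  | passiv a P =>
    intro Q hK hP hQ
    obtain ⟨Q₀, hw, hd⟩ := hK.head
    refine Matches.of_weak hw ?_
    cases hd with
    | hole h e₁ e₂ gP => exact hB.hole_matches h e₁ e₂ gP hP (.passiv a P)
    | loc _ h => exact ⟨_, _, (Step.passiv a _).weakAct, .quote h.cong, .refl _⟩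
  | run P =>
    intro Q hK hP hQ
    obtain ⟨Q₀, hw, hd⟩ := hK.head
    refine Matches.of_weak hw ?_
    cases hd with
    | hole h e₁ e₂ gP => exact hB.hole_matches h e₁ e₂ gP hP (.run P)
    | run h =>
      cases h with
      | quote h => exact ⟨_, .single (.run _), h.cong⟩
    | eraseL h => exact ⟨_, .refl, h.cong⟩

/-! ### From bisimulations to barbed congruence -/

/-- The contextual closure up to structural congruence, on closed processes. -/
def ClosedCong (B : Proc → Proc → Prop) (P Q : Proc) : Prop :=
  Cong B P Q ∧ P.Closed ∧ Q.Closed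

theorem ClosedCong.weak (hB : Progressing B) {P Q P' : Proc} (h : ClosedCong B P Q)
    (hP : Weak P P') : ∃ Q', Weak Q Q' ∧ ClosedCong B P' Q' := by
  induction hP with
  | refl => exact ⟨Q, .refl, h⟩
  | tail _ hs ih =>
    obtain ⟨Q₁, hQ₁, ⟨R, R', h₁, h₂, h₃⟩, hc, hc'⟩ := ih
    obtain ⟨S, hS, e⟩ := h₁.sim.tau hs
    obtain ⟨S', hS', hcong⟩ := h₂.matches hB hS _ (h₁.closed_iff.1 hc) (h₃.closed_iff.2 hc')
    obtain ⟨Q', hQ', e'⟩ := h₃.weak hS'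
    exact ⟨Q', Relation.ReflTransGen.trans hQ₁ hQ',
      e.trans_cong (hcong.trans_scong e'), (hs.closed hc).1, hQ'.closed hc'⟩

theorem ClosedCong.weakAct_out (hB : Progressing B) {P Q P' : Proc} {bs : List Name} {a : Name}
    {M : Term} (h : ClosedCong B P Q) (hP : WeakAct P (.out bs a M) P') :
    ∃ cs N Q', WeakAct Q (.out cs a N) Q' ∧ TCong B M N := by
  obtain ⟨P₁, P₂, hw, hs, -⟩ := hP
  obtain ⟨Q₁, hQ₁, ⟨R, R', h₁, h₂, h₃⟩, hc, hc'⟩ := h.weak hB hw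
  obtain ⟨cs, N, S, -, hN, hS, -⟩ := h₁.sim.out hs
  obtain ⟨N', S', hS', hNN', -⟩ := h₂.matches hB hS _ (h₁.closed_iff.1 hc) (h₃.closed_iff.2 hc')
  obtain ⟨cs', N'', Q', -, hN', hQ', -⟩ := h₃.weakAct_out hS'
  exact ⟨cs', N'', Q', hQ₁.weakAct hQ', hN.trans_tcong (hNN'.trans_tscong hN')⟩

theorem ClosedCong.inBarb (hB : Progressing B) {P Q : Proc} {a : Name} (h : ClosedCong B P Q)
    (hP : InBarb P a) : ∃ Q', Weak Q Q' ∧ InBarb Q' a := by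
  obtain ⟨M, P', hs⟩ := hP
  obtain ⟨⟨R, R', h₁, h₂, h₃⟩, hc, hc'⟩ := h
  obtain ⟨S, hS, -⟩ := h₁.sim.inp hs (.refl M)
  obtain ⟨S', hS', -⟩ := h₂.matches hB hS _ (h₁.closed_iff.1 hc) (h₃.closed_iff.2 hc') M
    hs.inp_closed (.refl M)
  obtain ⟨Q', ⟨Q₁, Q₂, hQ₁, hQ₂, -⟩, -⟩ := h₃.weakAct_inp hS' (.refl M)
  exact ⟨Q₁, hQ₁, M, Q₂, hQ₂⟩

theorem ClosedCong.outBarb (hB : Progressing B) {P Q : Proc} {a : Name} (h : ClosedCong B P Q)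
    (hP : OutBarb P a) : ∃ Q', Weak Q Q' ∧ OutBarb Q' a := by
  obtain ⟨bs, M, P', hs⟩ := hP
  obtain ⟨cs, N, Q', ⟨Q₁, Q₂, hQ₁, hQ₂, -⟩, -⟩ := h.weakAct_out hB hs.weakAct
  exact ⟨Q₁, hQ₁, cs, N, Q₂, hQ₂⟩

theorem Cong.fill {P Q : Proc} (h : Cong B P Q) : ∀ C : Ctx, Cong B (C.fill P) (C.fill Q)
  | .hole => h
  | .inp _ C => (h.fill C).inp _
  | .outCont _ M C => (h.fill C).out _ (.refl M)
  | .outMsg _ C R => (Cong.refl R).out _ (.quote (h.fill C))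
  | .parL C R => (h.fill C).par (.refl R)
  | .parR R C => (Cong.refl R).par (h.fill C)
  | .loc _ C => (h.fill C).loc _
  | .nu a C => (h.fill C).nu a
  | .rep C => (h.fill C).rep
  | .run C => .run (.quote (h.fill C))

theorem Ctx.scoped_fill {P Q : Proc} (hQ : Q.Closed) : ∀ (C : Ctx) {k m : ℕ},
    (C.fill P).Scoped k m → (C.fill Q).Scoped k m
  | .hole, _, _, _ => Q.scoped_mono (Nat.zero_le _) (Nat.zero_le _) hQ
  | .inp _ C, _, _, h => ⟨h.1, C.scoped_fill hQ h.2⟩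
  | .outCont _ _ C, _, _, h => ⟨h.1, h.2.1, C.scoped_fill hQ h.2.2⟩
  | .outMsg _ C _, k, m, h => ⟨h.1, C.scoped_fill hQ (k := k) (m := m) h.2.1, h.2.2⟩
  | .parL C _, _, _, h => ⟨C.scoped_fill hQ h.1, h.2⟩
  | .parR _ C, _, _, h => ⟨h.1, C.scoped_fill hQ h.2⟩
  | .loc _ C, _, _, h => ⟨h.1, C.scoped_fill hQ h.2⟩
  | .nu _ C, _, _, h => scoped_nu.2 (C.scoped_fill hQ (scoped_nu.1 h))
  | .rep C, k, m, h => C.scoped_fill hQ (k := k) (m := m) h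
  | .run C, k, m, h => C.scoped_fill hQ (k := k) (m := m) h

open Relation in
/-- The relation is closed under transitivity so that chains of related processes can be used. -/
theorem Progressing.isBarbedCong (hB : Progressing B) : IsBarbedCong (TransGen (ClosedCong B)) := by
  have closed : ∀ {P Q : Proc}, TransGen (ClosedCong B) P Q → P.Closed ∧ Q.Closed := by
    intro P Q h
    induction h with
    | single h => exact h.2
    | tail _ h ih => exact ⟨ih.1, h.2.2⟩
  have weak : ∀ {P Q : Proc}, TransGen (ClosedCong B) P Q → ∀ {P'}, Weak P P' →
      ∃ Q', Weak Q Q' ∧ TransGen (ClosedCong B) P' Q' := by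
    intro P Q h P' hP
    induction h with
    | single h =>
      obtain ⟨Q', hQ, h⟩ := h.weak hB hP
      exact ⟨Q', hQ, .single h⟩
    | tail _ h ih =>
      obtain ⟨R, hR, h'⟩ := ih
      obtain ⟨Q', hQ, h⟩ := h.weak hB hR
      exact ⟨Q', hQ, h'.tail h⟩
  refine ⟨closed, fun h => ?_, fun h hs => weak h (.single hs), fun h hb => ?_, fun h hb => ?_,
    fun h C hP hQ => ?_⟩
  · induction h with
    | single h => exact .single ⟨h.1.symm hB.symm, h.2.2, h.2.1⟩
    | tail _ h ih => exact .head ⟨h.1.symm hB.symm, h.2.2, h.2.1⟩ ih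
  · induction h with
    | single h => exact h.inBarb hB hb
    | tail _ h ih =>
      obtain ⟨R, hR, hb⟩ := ih
      obtain ⟨Q₁, hQ₁, h₁⟩ := h.weak hB hR
      obtain ⟨Q₂, hQ₂, hb⟩ := h₁.inBarb hB hb
      exact ⟨Q₂, ReflTransGen.trans hQ₁ hQ₂, hb⟩
  · induction h with
    | single h => exact h.outBarb hB hb
    | tail _ h ih =>
      obtain ⟨R, hR, hb⟩ := ih
      obtain ⟨Q₁, hQ₁, h₁⟩ := h.weak hB hR
      obtain ⟨Q₂, hQ₂, hb⟩ := h₁.outBarb hB hb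
      exact ⟨Q₂, ReflTransGen.trans hQ₁ hQ₂, hb⟩
  · induction h with
    | single h => exact .single ⟨h.1.fill C, hP, hQ⟩
    | tail _ h ih =>
      have hR := C.scoped_fill h.2.1 hQ
      exact (ih hR).tail ⟨h.1.fill C, hR, hQ⟩

/-! ### Invariants of structural congruence -/

mutual
/-- The nesting depth of quotations. -/
def Proc.quoteDepth : Proc → ℕ
  | .nil => 0
  | .inp _ P => P.quoteDepth
  | .out _ M P => max M.quoteDepth P.quoteDepth
  | .par P Q => max P.quoteDepth Q.quoteDepth
  | .loc _ P => P.quoteDepth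
  | .new P => P.quoteDepth
  | .rep P => P.quoteDepth
  | .run M => M.quoteDepth
/-- The nesting depth of quotations in a term, the outermost one included. -/
def Term.quoteDepth : Term → ℕ
  | .var _ => 0
  | .quote P => P.quoteDepth + 1
end

mutual
theorem Proc.quoteDepth_ren : ∀ (P : Proc) (f : Chan → Chan), (P.ren f).quoteDepth = P.quoteDepth
  | .nil, _ => rfl
  | .inp _ P, f => P.quoteDepth_ren f
  | .out _ M P, f => by simp [Proc.ren, Proc.quoteDepth, M.quoteDepth_ren f, P.quoteDepth_ren f]
  | .par P Q, f => by simp [Proc.ren, Proc.quoteDepth, P.quoteDepth_ren f, Q.quoteDepth_ren f]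
  | .loc _ P, f => P.quoteDepth_ren f
  | .new P, f => P.quoteDepth_ren (Chan.lift f)
  | .rep P, f => P.quoteDepth_ren f
  | .run M, f => M.quoteDepth_ren f
theorem Term.quoteDepth_ren : ∀ (M : Term) (f : Chan → Chan), (M.ren f).quoteDepth = M.quoteDepth
  | .var _, _ => rfl
  | .quote P, f => congrArg (· + 1) (P.quoteDepth_ren f)
end

theorem quoteDepth_nu (a : Name) (P : Proc) : (nu a P).quoteDepth = P.quoteDepth := by
  rw [nu_eq]; exact P.quoteDepth_ren _

mutual
theorem SCong.quoteDepth_eq {P Q : Proc} : SCong P Q → P.quoteDepth = Q.quoteDepth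
  | .refl _ => rfl
  | .symm h => h.quoteDepth_eq.symm
  | .trans h₁ h₂ => h₁.quoteDepth_eq.trans h₂.quoteDepth_eq
  | .parNil _ => by simp [Proc.quoteDepth]
  | .parComm _ _ => max_comm _ _
  | .parAssoc _ _ _ => max_assoc _ _ _
  | .repUnfold _ => by simp [Proc.quoteDepth]
  | .nuNil a => quoteDepth_nu a .nil
  | .nuSwap _ _ _ => by simp only [quoteDepth_nu]
  | .nuPar _ _ _ _ => by simp only [quoteDepth_nu, Proc.quoteDepth]
  | .inp _ h => h.quoteDepth_eq
  | .out _ hM h => by simp only [Proc.quoteDepth, hM.quoteDepth_eq, h.quoteDepth_eq]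
  | .par h₁ h₂ => by simp only [Proc.quoteDepth, h₁.quoteDepth_eq, h₂.quoteDepth_eq]
  | .loc _ h => h.quoteDepth_eq
  | .nu _ h => by simp only [quoteDepth_nu, h.quoteDepth_eq]
  | .rep h => h.quoteDepth_eq
  | .run h => h.quoteDepth_eq
theorem TSCong.quoteDepth_eq {M N : Term} : TSCong M N → M.quoteDepth = N.quoteDepth
  | .var _ => rfl
  | .quote h => congrArg (· + 1) h.quoteDepth_eq
end

/-- The number of top-level components of a process other than `0`, not looking under prefixes,
locations and `run`; a replication counts as infinitely many, even that of `0`. -/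
noncomputable def Proc.count : Proc → ℕ∞
  | .nil => 0
  | .par P Q => P.count + Q.count
  | .new P => P.count
  | .rep _ => ⊤
  | .inp _ _ | .out _ _ _ | .loc _ _ | .run _ => 1

theorem Proc.count_ren : ∀ (P : Proc) (f : Chan → Chan), (P.ren f).count = P.count
  | .par P Q, f => by simp [Proc.ren, Proc.count, P.count_ren f, Q.count_ren f]
  | .new P, f => P.count_ren (Chan.lift f)
  | .nil, _ | .rep _, _ | .inp _ _, _ | .out _ _ _, _ | .loc _ _, _ | .run _, _ => rfl

theorem count_nu (a : Name) (P : Proc) : (nu a P).count = P.count := by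
  rw [nu_eq]; exact P.count_ren _

theorem SCong.count_eq {P Q : Proc} : SCong P Q → P.count = Q.count
  | .refl _ => rfl
  | .symm h => h.count_eq.symm
  | .trans h₁ h₂ => h₁.count_eq.trans h₂.count_eq
  | .parNil _ => add_zero _
  | .parComm _ _ => add_comm _ _
  | .parAssoc _ _ _ => add_assoc _ _ _
  | .repUnfold _ => (add_top _).symm
  | .nuNil a => count_nu a .nil
  | .nuSwap _ _ _ => by simp only [count_nu]
  | .nuPar _ _ _ _ => by simp only [count_nu, Proc.count]
  | .par h₁ h₂ => by simp only [Proc.count, h₁.count_eq, h₂.count_eq]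
  | .nu _ h => by simp only [count_nu, h.count_eq]
  | .rep _ | .inp _ _ | .out _ _ _ | .loc _ _ | .run _ => rfl

theorem Proc.scong_nil_of_count : ∀ P : Proc, P.count = 0 → SCong P .nil
  | .nil, _ => .refl _
  | .par P Q, h => by
    simp only [Proc.count, add_eq_zero] at h
    exact (SCong.par (P.scong_nil_of_count h.1) (Q.scong_nil_of_count h.2)).trans (.parNil _)
  | .new P, h => by
    refine (SCong.new (P.scong_nil_of_count h)).trans ?_
    rw [← nu_nil 0]
    exact .nuNil 0
  | .rep _, h => by simp [Proc.count] at h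
  | .inp _ _, h | .out _ _ _, h | .loc _ _, h | .run _, h => by simp [Proc.count] at h

/-- No top-level component refers to a restriction above it, that is, all top-level restrictions are
vacuous.  Variables may be dangling. -/
def Proc.Visible : Proc → Prop
  | .nil => True
  | .par P Q => P.Visible ∧ Q.Visible
  | .new P => P.Visible
  | .rep P => P.Visible
  | .inp a P => ∃ m, (Proc.inp a P).Scoped 0 m
  | .out a M P => ∃ m, (Proc.out a M P).Scoped 0 m
  | .loc a P => ∃ m, (Proc.loc a P).Scoped 0 m
  | .run M => ∃ m, (Proc.run M).Scoped 0 m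

theorem Chan.abs_injective (a : Name) (k : ℕ) : Function.Injective (Chan.abs a k) := by
  rintro (b | i) (c | j) h <;> simp only [Chan.abs] at h <;> grind

/-- Abstraction of a name that does not occur is the identity on a process without dangling references. -/
theorem Proc.ren_abs_of_scoped {a : Name} {k m : ℕ} {P : Proc} (hP : P.Scoped 0 m)
    (ha : a ∉ P.fn) : P.ren (Chan.abs a k) = P := by
  conv_rhs => rw [← P.ren_id]
  refine Proc.ren_congr_scoped hP fun b hb => ?_
  have : b ≠ a := fun e => ha (e ▸ hb)
  simp [Chan.abs, this]

theorem Proc.scoped_ren_abs {a : Name} {k m : ℕ} {P : Proc} :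
    (P.ren (Chan.abs a k)).Scoped 0 m ↔ P.Scoped 0 m ∧ a ∉ P.fn := by
  refine ⟨fun h => ?_, fun h => by rw [ren_abs_of_scoped h.1 h.2]; exact h.1⟩
  have ha : a ∉ P.fn := fun ha => by
    have := P.scoped_of_ren _ h a ha
    simp [Chan.abs, Chan.Scoped] at this
  refine ⟨?_, ha⟩
  have : Nonempty Chan := ⟨.bound 0⟩
  obtain ⟨g, hg⟩ := (Chan.abs_injective a k).hasLeftInverse
  have e : (P.ren (Chan.abs a k)).ren g = P := by
    rw [Proc.ren_ren, hg.comp_eq_id, Proc.ren_id]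
  rw [Proc.ren_congr_scoped h (g := id) fun b hb => ?_, Proc.ren_id] at e
  · rwa [e] at h
  · rw [Proc.mem_fn_ren _ _ _ fun i c => by simp [Chan.abs]; grind] at hb
    obtain ⟨c, -, hc⟩ := hb
    have : b ≠ a := by rintro rfl; simp [Chan.abs] at hc; grind
    have := hg (.free b)
    rwa [show Chan.abs a k (.free b) = .free b by simp [Chan.abs, *]] at this

theorem Proc.exists_scoped_ren_abs {a : Name} {k : ℕ} {P : Proc} :
    (∃ m, (P.ren (Chan.abs a k)).Scoped 0 m) ↔ (∃ m, P.Scoped 0 m) ∧ a ∉ P.fn := by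
  simp only [scoped_ren_abs, exists_and_right]

theorem Proc.visible_ren_abs {a : Name} : ∀ (P : Proc) (k : ℕ),
    (P.ren (Chan.abs a k)).Visible ↔ P.Visible ∧ a ∉ P.fn
  | .nil, _ => by simp [Proc.ren, Proc.Visible, Proc.fn]
  | .par P Q, k => by
    simp only [Proc.ren, Proc.Visible, Proc.fn, P.visible_ren_abs k, Q.visible_ren_abs k,
      Finset.mem_union]
    tauto
  | .new P, k => by
    simpa only [Proc.ren, Proc.Visible, Proc.fn, Chan.lift_abs] using P.visible_ren_abs (k + 1)
  | .rep P, k => P.visible_ren_abs k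
  | .inp c P, _ => Proc.exists_scoped_ren_abs (P := .inp c P)
  | .out c M P, _ => Proc.exists_scoped_ren_abs (P := .out c M P)
  | .loc c P, _ => Proc.exists_scoped_ren_abs (P := .loc c P)
  | .run M, _ => Proc.exists_scoped_ren_abs (P := .run M)

theorem visible_nu {a : Name} {P : Proc} : (nu a P).Visible ↔ P.Visible ∧ a ∉ P.fn := by
  rw [nu_eq]; exact P.visible_ren_abs 0

theorem visible_nus {P : Proc} : ∀ {bs : List Name},
    (nus bs P).Visible ↔ P.Visible ∧ ∀ b ∈ bs, b ∉ P.fn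
  | [] => by simp [nus]
  | b :: bs => by
    rw [nus_cons, visible_nu, visible_nus, mem_fn_nus]
    simp only [List.mem_cons, forall_eq_or_imp]
    constructor
    · rintro ⟨⟨h₁, h₂⟩, h₃⟩
      exact ⟨h₁, fun hb => h₃ ⟨fun hb' => h₂ b hb' hb, hb⟩, h₂⟩
    · rintro ⟨h₁, h₂, h₃⟩
      exact ⟨⟨h₁, h₃⟩, fun h => h₂ h.2⟩

theorem SCong.visible_iff {P Q : Proc} : SCong P Q → (P.Visible ↔ Q.Visible)
  | .refl _ => .rfl
  | .symm h => h.visible_iff.symm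
  | .trans h₁ h₂ => h₁.visible_iff.trans h₂.visible_iff
  | .parNil _ => by simp [Proc.Visible]
  | .parComm _ _ => and_comm
  | .parAssoc _ _ _ => and_assoc
  | .repUnfold _ => by simp [Proc.Visible]
  | .nuNil a => by simp [visible_nu, Proc.Visible, Proc.fn]
  | .nuSwap a b P => by
    simp only [visible_nu, mem_fn_nu]
    by_cases e : a = b
    · rw [e]
    · have : b ≠ a := fun h => e h.symm
      tauto
  | .nuPar a P Q ha => by
    simp only [visible_nu, Proc.Visible, Proc.fn, Finset.mem_union]
    tauto
  | .par h₁ h₂ => and_congr h₁.visible_iff h₂.visible_iff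
  | .nu _ h => by rw [visible_nu, visible_nu, h.visible_iff, h.fn_eq]
  | .rep h => h.visible_iff
  | .inp c h => exists_congr fun m => (SCong.inp c h).scoped_iff 0 m
  | .out c hM h => exists_congr fun m => (SCong.out c hM h).scoped_iff 0 m
  | .loc c h => exists_congr fun m => (SCong.loc c h).scoped_iff 0 m
  | .run h => exists_congr fun m => (SCong.run h).scoped_iff 0 m

/-- `P.HasLoc c R`: one of the top-level components of `P` is the location `c[R]`. -/
def Proc.HasLoc : Proc → Chan → Proc → Prop
  | .loc d P, c, R => d = c ∧ P = R
  | .par P Q, c, R => P.HasLoc c R ∨ Q.HasLoc c R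
  | .new P, c, R => P.HasLoc c R
  | .rep P, c, R => P.HasLoc c R
  | .nil, _, _ | .inp _ _, _, _ | .out _ _ _, _, _ | .run _, _, _ => False

theorem hasLoc_ren_abs {a : Name} {c : Chan} {R : Proc} : ∀ (P : Proc) (k : ℕ),
    (P.ren (Chan.abs a k)).Visible → ((P.ren (Chan.abs a k)).HasLoc c R ↔ P.HasLoc c R)
  | .par P Q, k, h => or_congr (hasLoc_ren_abs P k h.1) (hasLoc_ren_abs Q k h.2)
  | .new P, k, h => by
    simp only [Proc.ren, Proc.Visible, Proc.HasLoc, Chan.lift_abs] at h ⊢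
    exact hasLoc_ren_abs P (k + 1) h
  | .rep P, k, h => hasLoc_ren_abs P k h
  | .loc d P, k, h => by
    obtain ⟨⟨m, h⟩, ha⟩ := Proc.exists_scoped_ren_abs (P := .loc d P).1 h
    rw [Proc.ren_abs_of_scoped h ha]
  | .nil, _, _ | .inp _ _, _, _ | .out _ _ _, _, _ | .run _, _, _ => .rfl

theorem hasLoc_nu {a : Name} {P : Proc} {c : Chan} {R : Proc} (h : (nu a P).Visible) :
    (nu a P).HasLoc c R ↔ P.HasLoc c R := by
  rw [nu_eq] at h ⊢
  exact hasLoc_ren_abs P 0 h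

/-- Both directions are stated at once because of the symmetry rule. -/
theorem SCong.hasLoc {P Q : Proc} : SCong P Q → P.Visible → ∀ c,
    (∀ R, P.HasLoc c R → ∃ R', SCong R R' ∧ Q.HasLoc c R') ∧
    (∀ R, Q.HasLoc c R → ∃ R', SCong R R' ∧ P.HasLoc c R')
  | .refl _, _, _ => ⟨fun R h => ⟨R, .refl R, h⟩, fun R h => ⟨R, .refl R, h⟩⟩
  | .symm h, hv, c => (h.hasLoc (h.visible_iff.2 hv) c).symm
  | .trans h₁ h₂, hv, c => by
    obtain ⟨f₁, g₁⟩ := h₁.hasLoc hv c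
    obtain ⟨f₂, g₂⟩ := h₂.hasLoc (h₁.visible_iff.1 hv) c
    constructor <;> intro R h
    · obtain ⟨R₁, e₁, h⟩ := f₁ R h
      obtain ⟨R₂, e₂, h⟩ := f₂ R₁ h
      exact ⟨R₂, e₁.trans e₂, h⟩
    · obtain ⟨R₁, e₁, h⟩ := g₂ R h
      obtain ⟨R₂, e₂, h⟩ := g₁ R₁ h
      exact ⟨R₂, e₁.trans e₂, h⟩
  | .parNil _, _, _ =>
    ⟨fun R h => ⟨R, .refl R, h.resolve_right id⟩, fun R h => ⟨R, .refl R, .inl h⟩⟩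
  | .parComm _ _, _, _ => ⟨fun R h => ⟨R, .refl R, h.symm⟩, fun R h => ⟨R, .refl R, h.symm⟩⟩
  | .parAssoc _ _ _, _, _ =>
    ⟨fun R h => ⟨R, .refl R, or_assoc.1 h⟩, fun R h => ⟨R, .refl R, or_assoc.2 h⟩⟩
  | .repUnfold _, _, _ =>
    ⟨fun R h => ⟨R, .refl R, .inl h⟩, fun R h => ⟨R, .refl R, (or_self _).mp h⟩⟩
  | .nuNil _, hv, _ => ⟨fun R h => ((hasLoc_nu hv).1 h).elim, fun _ h => h.elim⟩
  | .nuSwap a b P, hv, _ => by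
    have hv' := (SCong.nuSwap a b P).visible_iff.1 hv
    constructor <;> intro R h <;> refine ⟨R, .refl R, ?_⟩
    · rw [hasLoc_nu hv, hasLoc_nu (visible_nu.1 hv).1] at h
      rwa [hasLoc_nu hv', hasLoc_nu (visible_nu.1 hv').1]
    · rw [hasLoc_nu hv', hasLoc_nu (visible_nu.1 hv').1] at h
      rwa [hasLoc_nu hv, hasLoc_nu (visible_nu.1 hv).1]
  | .nuPar a P Q ha, hv, _ => by
    have hv' := (SCong.nuPar a P Q ha).visible_iff.1 hv
    constructor <;> intro R h <;> refine ⟨R, .refl R, ?_⟩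
    · rw [hasLoc_nu hv] at h
      exact h.imp_right (hasLoc_nu hv'.2).2
    · rw [hasLoc_nu hv]
      exact Or.imp_right (hasLoc_nu hv'.2).1 h
  | .par h₁ h₂, hv, c => by
    obtain ⟨f₁, g₁⟩ := h₁.hasLoc hv.1 c
    obtain ⟨f₂, g₂⟩ := h₂.hasLoc hv.2 c
    constructor <;> rintro R (h | h)
    · obtain ⟨R', e, h⟩ := f₁ R h; exact ⟨R', e, .inl h⟩
    · obtain ⟨R', e, h⟩ := f₂ R h; exact ⟨R', e, .inr h⟩
    · obtain ⟨R', e, h⟩ := g₁ R h; exact ⟨R', e, .inl h⟩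
    · obtain ⟨R', e, h⟩ := g₂ R h; exact ⟨R', e, .inr h⟩
  | .nu a h, hv, c => by
    have hv' := (SCong.nu a h).visible_iff.1 hv
    obtain ⟨f, g⟩ := h.hasLoc (visible_nu.1 hv).1 c
    constructor <;> intro R hR
    · obtain ⟨R', e, h⟩ := f R ((hasLoc_nu hv).1 hR)
      exact ⟨R', e, (hasLoc_nu hv').2 h⟩
    · obtain ⟨R', e, h⟩ := g R ((hasLoc_nu hv').1 hR)
      exact ⟨R', e, (hasLoc_nu hv).2 h⟩
  | .rep h, hv, c => h.hasLoc hv c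
  | .loc c h, _, _ =>
    ⟨fun _ e => ⟨_, e.2 ▸ h, e.1, rfl⟩, fun _ e => ⟨_, e.2 ▸ h.symm, e.1, rfl⟩⟩
  | .inp _ _, _, _ | .out _ _ _, _, _ | .run _, _, _ => ⟨fun _ h => h.elim, fun _ h => h.elim⟩

/-- A process congruent to a location `c[R]` has a top-level location congruent to it, and no
other. -/
theorem SCong.hasLoc_loc {c : Chan} {P R : Proc} {m : ℕ} (h : SCong P (.loc c R))
    (hR : (Proc.loc c R).Scoped 0 m) :
    (∃ R', SCong R R' ∧ P.HasLoc c R') ∧ ∀ R', P.HasLoc c R' → SCong R R' := by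
  obtain ⟨f, g⟩ := h.hasLoc (h.visible_iff.2 ⟨m, hR⟩) c
  refine ⟨g R ⟨rfl, rfl⟩, fun R' h' => ?_⟩
  obtain ⟨R'', e, -, e'⟩ := f R' h'
  exact (e' ▸ e).symm

theorem PCtxRel.count_eq {r : Finset Name} {E : Env} : ∀ {P Q : Proc}, PCtxRel r E P Q →
    P.count = Q.count
  | _, _, .par h₁ h₂ => by simp only [Proc.count, h₁.count_eq, h₂.count_eq]
  | _, _, .new h => h.count_eq
  | _, _, .nil | _, _, .inp _ _ | _, _, .out _ _ _ | _, _, .loc _ _ | _, _, .rep _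
  | _, _, .run _ => rfl

theorem PCtxRel.hasLoc {r : Finset Name} {E : Env} {c : Chan} {R : Proc} : ∀ {P Q : Proc},
    PCtxRel r E P Q → P.HasLoc c R → ∃ S, Q.HasLoc c S ∧ PCtxRel r E R S
  | _, _, .par h₁ h₂, h => by
    rcases h with h | h
    · obtain ⟨S, hS, e⟩ := h₁.hasLoc h; exact ⟨S, .inl hS, e⟩
    · obtain ⟨S, hS, e⟩ := h₂.hasLoc h; exact ⟨S, .inr hS, e⟩
  | _, _, .new h, h' => h.hasLoc h'
  | _, _, .rep h, h' => h.hasLoc h'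
  | _, _, .loc _ h, e => ⟨_, ⟨e.1, rfl⟩, e.2 ▸ h⟩
  | _, _, .nil, h | _, _, .inp _ _, h | _, _, .out _ _ _, h | _, _, .run _, h => h.elim

/-! ### Simple processes -/

mutual
theorem Proc.scoped_of_not_occurs : ∀ (P : Proc) {k m : ℕ}, P.Scoped k (m + 1) → ¬ P.Occurs m →
    P.Scoped k m
  | .nil, _, _, _, _ => trivial
  | .inp _ P, _, _, h, ho => ⟨h.1, P.scoped_of_not_occurs h.2 ho⟩
  | .out _ M P, _, _, h, ho => ⟨h.1, M.scoped_of_not_occurs h.2.1 fun o => ho (.inl o),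
      P.scoped_of_not_occurs h.2.2 fun o => ho (.inr o)⟩
  | .par P Q, _, _, h, ho => ⟨P.scoped_of_not_occurs h.1 fun o => ho (.inl o),
      Q.scoped_of_not_occurs h.2 fun o => ho (.inr o)⟩
  | .loc _ P, _, _, h, ho => ⟨h.1, P.scoped_of_not_occurs h.2 ho⟩
  | .new P, k, m, h, ho => P.scoped_of_not_occurs (k := k + 1) (m := m) h ho
  | .rep P, k, m, h, ho => P.scoped_of_not_occurs (k := k) (m := m) h ho
  | .run M, k, m, h, ho => M.scoped_of_not_occurs (k := k) (m := m) h ho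
theorem Term.scoped_of_not_occurs : ∀ (M : Term) {k m : ℕ}, M.Scoped k (m + 1) → ¬ M.Occurs m →
    M.Scoped k m
  | .var _, _, _, h, ho => lt_of_le_of_ne (Nat.lt_succ_iff.1 h) ho
  | .quote P, k, m, h, ho => P.scoped_of_not_occurs (k := k) (m := m) h ho
end

/-- What a closed simple process `P` can do: it extrudes no names, its inputs ignore the message
received, and it stays simple. -/
def Act.SimpleSpec (P P' : Proc) : Act → Prop
  | .tau => P'.Simple
  | .inp a _ => P'.Simple ∧ ∀ N : Term, N.Closed → Step P (.inp a N) P'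
  | .out bs _ M => bs = [] ∧ M.Simple ∧ P'.Simple

theorem Step.simpleSpec {P P' : Proc} {α : Act} (h : Step P α P') :
    P.Closed → P.Simple → α.SimpleSpec P P' := by
  induction h with
  | inp a P M hM =>
    intro hc hs
    have hP := P.scoped_of_not_occurs hc.2 hs.1
    have e : ∀ N : Term, P.subst N 0 = P := fun N => P.subst_of_scoped N hP le_rfl
    simp only [Act.SimpleSpec, e]
    refine ⟨hs.2, fun N hN => ?_⟩
    have := Step.inp a P N hN
    rwa [e] at this
  | out a M P => exact fun _ hs => ⟨rfl, hs.1, hs.2⟩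
  | @parL P₁ P₂ P₁' α h hb ih =>
    intro hc hs
    replace ih := ih hc.1 hs.1
    cases α with
    | tau => exact ⟨ih, hs.2⟩
    | inp a M => exact ⟨⟨ih.1, hs.2⟩, fun N hN => .parL (ih.2 N hN) (by simp [Act.bn])⟩
    | out bs a M => exact ⟨ih.1, ih.2.1, ih.2.2, hs.2⟩
  | @parR P₁ P₂ P₂' α h hb ih =>
    intro hc hs
    replace ih := ih hc.2 hs.2
    cases α with
    | tau => exact ⟨hs.1, ih⟩
    | inp a M => exact ⟨⟨hs.1, ih.1⟩, fun N hN => .parR (ih.2 N hN) (by simp [Act.bn])⟩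
    | out bs a M => exact ⟨ih.1, ih.2.1, hs.1, ih.2.2⟩
  | @rep P P' α h ih =>
    intro hc hs
    replace ih := ih ⟨hc, hc⟩ ⟨hs, hs⟩
    cases α with
    | tau => exact ih
    | inp a M => exact ⟨ih.1, fun N hN => .rep (ih.2 N hN)⟩
    | out bs a M => exact ih
  | reactL h₁ h₂ hb ih₁ ih₂ =>
    intro hc hs
    obtain ⟨rfl, -, hs₁⟩ := ih₁ hc.1 hs.1
    exact ⟨hs₁, (ih₂ hc.2 hs.2).1⟩
  | reactR h₁ h₂ hb ih₁ ih₂ =>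
    intro hc hs
    obtain ⟨rfl, -, hs₁⟩ := ih₂ hc.2 hs.2
    exact ⟨(ih₁ hc.1 hs.1).1, hs₁⟩
  | guard _ _ _ => exact fun _ hs => hs.elim
  | extr _ _ _ _ _ => exact fun _ hs => hs.elim
  | @transp P P' α a h ha ih =>
    intro hc hs
    replace ih := ih hc.2 hs
    cases α with
    | tau => exact ih
    | inp b M => exact ⟨ih.1, fun N hN => .transp (ih.2 N hN) (by simp [Act.bn])⟩
    | out bs b M => exact ih
  | passiv a P => exact fun _ hs => ⟨rfl, hs, trivial⟩
  | run P => exact fun _ hs => hs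

theorem Weak.simple {P P' : Proc} (h : Weak P P') (hc : P.Closed) (hs : P.Simple) : P'.Simple := by
  induction h with
  | refl => exact hs
  | tail h₁ h₂ ih => exact h₂.simpleSpec (Weak.closed h₁ hc) ih

theorem WeakAct.simple_inp {P P' : Proc} {a : Name} {M : Term} (h : WeakAct P (.inp a M) P')
    (hc : P.Closed) (hs : P.Simple) :
    P'.Simple ∧ ∀ N : Term, N.Closed → WeakAct P (.inp a N) P' := by
  obtain ⟨P₁, P₂, h₁, h₂, h₃⟩ := h
  have hP₁ := h₁.closed hc
  have hs₂ := h₂.simpleSpec hP₁ (h₁.simple hc hs)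
  exact ⟨h₃.simple (h₂.closed hP₁).1 hs₂.1, fun N hN => ⟨P₁, P₂, h₁, hs₂.2 N hN, h₃⟩⟩

theorem WeakAct.simple_out {P P' : Proc} {bs : List Name} {a : Name} {M : Term}
    (h : WeakAct P (.out bs a M) P') (hc : P.Closed) (hs : P.Simple) :
    bs = [] ∧ M.Simple ∧ P'.Simple := by
  obtain ⟨P₁, P₂, h₁, h₂, h₃⟩ := h
  have hP₁ := h₁.closed hc
  obtain ⟨e, hM, hs₂⟩ := h₂.simpleSpec hP₁ (h₁.simple hc hs)
  exact ⟨e, hM, h₃.simple (h₂.closed hP₁).1 hs₂⟩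

/-! ### Truncation of processes -/

mutual
/-- Truncation of a process below `k` prefixes, locations and `run`s. -/
def Proc.trunc : ℕ → Proc → Proc
  | _, .nil => .nil
  | k, .par P Q => .par (P.trunc k) (Q.trunc k)
  | k, .new P => .new (P.trunc k)
  | k, .rep P => .rep (P.trunc k)
  | 0, .inp _ _ => .nil
  | 0, .out _ _ _ => .nil
  | 0, .loc _ _ => .nil
  | 0, .run _ => .nil
  | k + 1, .inp a P => .inp a (P.trunc k)
  | k + 1, .out a M P => .out a (M.trunc k) (P.trunc k)
  | k + 1, .loc a P => .loc a (P.trunc k)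
  | k + 1, .run M => .run (M.trunc k)
/-- Truncation of the quoted process. -/
def Term.trunc : ℕ → Term → Term
  | _, .var i => .var i
  | k, .quote P => .quote (P.trunc k)
end

mutual
theorem Proc.trunc_ren : ∀ (P : Proc) (k : ℕ) (f : Chan → Chan),
    (P.ren f).trunc k = (P.trunc k).ren f
  | .nil, _, _ => by simp [Proc.trunc, Proc.ren]
  | .par P Q, k, f => by simp [Proc.trunc, Proc.ren, P.trunc_ren k f, Q.trunc_ren k f]
  | .new P, k, f => by simp [Proc.trunc, Proc.ren, P.trunc_ren k]
  | .rep P, k, f => by simp [Proc.trunc, Proc.ren, P.trunc_ren k f]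
  | .inp _ _, 0, _ | .out _ _ _, 0, _ | .loc _ _, 0, _ | .run _, 0, _ => by
    simp [Proc.trunc, Proc.ren]
  | .inp _ P, k + 1, f => by simp [Proc.trunc, Proc.ren, P.trunc_ren k f]
  | .out _ M P, k + 1, f => by simp [Proc.trunc, Proc.ren, M.trunc_ren k f, P.trunc_ren k f]
  | .loc _ P, k + 1, f => by simp [Proc.trunc, Proc.ren, P.trunc_ren k f]
  | .run M, k + 1, f => by simp [Proc.trunc, Proc.ren, M.trunc_ren k f]
theorem Term.trunc_ren : ∀ (M : Term) (k : ℕ) (f : Chan → Chan),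
    (M.ren f).trunc k = (M.trunc k).ren f
  | .var _, _, _ => by simp [Term.trunc, Term.ren]
  | .quote P, k, f => by simp [Term.trunc, Term.ren, P.trunc_ren k f]
end

theorem trunc_nu (k : ℕ) (a : Name) (P : Proc) : (nu a P).trunc k = nu a (P.trunc k) := by
  simp only [nu_eq, Proc.trunc, Proc.trunc_ren]

mutual
theorem Proc.fn_trunc_subset : ∀ (P : Proc) (k : ℕ), (P.trunc k).fn ⊆ P.fn
  | .nil, _ => by simp [Proc.trunc]
  | .par P Q, k => by
    simpa only [Proc.trunc, Proc.fn] using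
      Finset.union_subset_union (P.fn_trunc_subset k) (Q.fn_trunc_subset k)
  | .new P, k => by simpa only [Proc.trunc, Proc.fn] using P.fn_trunc_subset k
  | .rep P, k => by simpa only [Proc.trunc, Proc.fn] using P.fn_trunc_subset k
  | .inp _ _, 0 | .out _ _ _, 0 | .loc _ _, 0 | .run _, 0 => by simp [Proc.trunc, Proc.fn]
  | .inp _ P, k + 1 => by
    simpa only [Proc.trunc, Proc.fn] using
      Finset.union_subset_union subset_rfl (P.fn_trunc_subset k)
  | .out _ M P, k + 1 => by
    simpa only [Proc.trunc, Proc.fn] using Finset.union_subset_union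
      (Finset.union_subset_union subset_rfl (M.fn_trunc_subset k)) (P.fn_trunc_subset k)
  | .loc _ P, k + 1 => by
    simpa only [Proc.trunc, Proc.fn] using
      Finset.union_subset_union subset_rfl (P.fn_trunc_subset k)
  | .run M, k + 1 => by simpa only [Proc.trunc, Proc.fn] using M.fn_trunc_subset k
theorem Term.fn_trunc_subset : ∀ (M : Term) (k : ℕ), (M.trunc k).fn ⊆ M.fn
  | .var _, _ => by simp [Term.trunc]
  | .quote P, k => by simpa only [Term.trunc, Term.fn] using P.fn_trunc_subset k
end

mutual
theorem Proc.exists_trunc_eq : ∀ P : Proc, ∃ K, ∀ k ≥ K, P.trunc k = P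
  | .nil => ⟨0, fun _ _ => by simp [Proc.trunc]⟩
  | .par P Q => by
    obtain ⟨K, h⟩ := P.exists_trunc_eq
    obtain ⟨L, h'⟩ := Q.exists_trunc_eq
    exact ⟨max K L, fun k hk => by
      simp [Proc.trunc, h k (le_of_max_le_left hk), h' k (le_of_max_le_right hk)]⟩
  | .new P => by
    obtain ⟨K, h⟩ := P.exists_trunc_eq
    exact ⟨K, fun k hk => by simp [Proc.trunc, h k hk]⟩
  | .rep P => by
    obtain ⟨K, h⟩ := P.exists_trunc_eq
    exact ⟨K, fun k hk => by simp [Proc.trunc, h k hk]⟩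
  | .inp _ P => by
    obtain ⟨K, h⟩ := P.exists_trunc_eq
    refine ⟨K + 1, fun k hk => ?_⟩
    obtain ⟨k, rfl⟩ := Nat.exists_eq_add_of_le' (Nat.le_of_add_left_le hk)
    simp [Proc.trunc, h k (by omega)]
  | .out _ M P => by
    obtain ⟨K, h⟩ := M.exists_trunc_eq
    obtain ⟨L, h'⟩ := P.exists_trunc_eq
    refine ⟨max K L + 1, fun k hk => ?_⟩
    obtain ⟨k, rfl⟩ := Nat.exists_eq_add_of_le' (Nat.le_of_add_left_le hk)
    simp [Proc.trunc, h k (by omega), h' k (by omega)]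
  | .loc _ P => by
    obtain ⟨K, h⟩ := P.exists_trunc_eq
    refine ⟨K + 1, fun k hk => ?_⟩
    obtain ⟨k, rfl⟩ := Nat.exists_eq_add_of_le' (Nat.le_of_add_left_le hk)
    simp [Proc.trunc, h k (by omega)]
  | .run M => by
    obtain ⟨K, h⟩ := M.exists_trunc_eq
    refine ⟨K + 1, fun k hk => ?_⟩
    obtain ⟨k, rfl⟩ := Nat.exists_eq_add_of_le' (Nat.le_of_add_left_le hk)
    simp [Proc.trunc, h k (by omega)]
theorem Term.exists_trunc_eq : ∀ M : Term, ∃ K, ∀ k ≥ K, M.trunc k = M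
  | .var _ => ⟨0, fun _ _ => by simp [Term.trunc]⟩
  | .quote P => by
    obtain ⟨K, h⟩ := P.exists_trunc_eq
    exact ⟨K, fun k hk => by simp [Term.trunc, h k hk]⟩
end

mutual
theorem Proc.scoped_trunc : ∀ (P : Proc) (n : ℕ) {k m : ℕ}, P.Scoped k m → (P.trunc n).Scoped k m
  | .nil, _, _, _, _ => by simp [Proc.trunc, Proc.Scoped]
  | .par P Q, n, _, _, h => by
    simpa only [Proc.trunc] using ⟨P.scoped_trunc n h.1, Q.scoped_trunc n h.2⟩
  | .new P, n, k, m, h => by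
    rw [Proc.trunc]; exact P.scoped_trunc n (k := k + 1) (m := m) h
  | .rep P, n, k, m, h => by
    rw [Proc.trunc]; exact P.scoped_trunc n (k := k) (m := m) h
  | .inp _ _, 0, _, _, _ | .out _ _ _, 0, _, _, _ | .loc _ _, 0, _, _, _ | .run _, 0, _, _, _ => by
    simp [Proc.trunc, Proc.Scoped]
  | .inp _ P, n + 1, _, _, h => by
    simpa only [Proc.trunc] using ⟨h.1, P.scoped_trunc n h.2⟩
  | .out _ M P, n + 1, _, _, h => by
    simpa only [Proc.trunc] using ⟨h.1, M.scoped_trunc n h.2.1, P.scoped_trunc n h.2.2⟩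
  | .loc _ P, n + 1, _, _, h => by
    simpa only [Proc.trunc] using ⟨h.1, P.scoped_trunc n h.2⟩
  | .run M, n + 1, k, m, h => by
    rw [Proc.trunc]; exact M.scoped_trunc n (k := k) (m := m) h
theorem Term.scoped_trunc : ∀ (M : Term) (n : ℕ) {k m : ℕ}, M.Scoped k m → (M.trunc n).Scoped k m
  | .var _, _, _, _, h => by simpa only [Term.trunc] using h
  | .quote P, n, k, m, h => by
    rw [Term.trunc]; exact P.scoped_trunc n (k := k) (m := m) h
end

mutual
theorem SCong.trunc {P Q : Proc} : SCong P Q → ∀ k, SCong (P.trunc k) (Q.trunc k)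
  | .refl _, _ => .refl _
  | .symm h, k => (h.trunc k).symm
  | .trans h₁ h₂, k => (h₁.trunc k).trans (h₂.trunc k)
  | .parNil _, _ => by simpa only [Proc.trunc] using SCong.parNil _
  | .parComm _ _, _ => by simpa only [Proc.trunc] using SCong.parComm _ _
  | .parAssoc _ _ _, _ => by simpa only [Proc.trunc] using SCong.parAssoc _ _ _
  | .repUnfold _, _ => by simpa only [Proc.trunc] using SCong.repUnfold _
  | .nuNil _, _ => by simpa only [trunc_nu, Proc.trunc] using SCong.nuNil _
  | .nuSwap _ _ _, _ => by simpa only [trunc_nu] using SCong.nuSwap _ _ _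
  | .nuPar _ P Q ha, k => by
    simpa only [trunc_nu, Proc.trunc] using
      SCong.nuPar _ (P.trunc k) (Q.trunc k) fun h => ha (P.fn_trunc_subset k h)
  | .par h₁ h₂, k => by simpa only [Proc.trunc] using SCong.par (h₁.trunc k) (h₂.trunc k)
  | .nu _ h, k => by simpa only [trunc_nu] using SCong.nu _ (h.trunc k)
  | .rep h, k => by simpa only [Proc.trunc] using SCong.rep (h.trunc k)
  | .inp _ _, 0 | .out _ _ _, 0 | .loc _ _, 0 | .run _, 0 => by
    simpa only [Proc.trunc] using SCong.refl _
  | .inp _ h, k + 1 => by simpa only [Proc.trunc] using SCong.inp _ (h.trunc k)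
  | .out _ hM h, k + 1 => by simpa only [Proc.trunc] using SCong.out _ (hM.trunc k) (h.trunc k)
  | .loc _ h, k + 1 => by simpa only [Proc.trunc] using SCong.loc _ (h.trunc k)
  | .run h, k + 1 => by simpa only [Proc.trunc] using SCong.run (h.trunc k)
theorem TSCong.trunc {M N : Term} : TSCong M N → ∀ k, TSCong (M.trunc k) (N.trunc k)
  | .var _, _ => by simpa only [Term.trunc] using TSCong.var _
  | .quote h, k => by simpa only [Term.trunc] using TSCong.quote (h.trunc k)
end

/-- A name that occurs at depth at most `k + 1` in a closed simple process is the subject of a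
transition, or occurs at depth at most `k` in the message sent or in the residual. -/
theorem Proc.exists_step_of_mem_trunc {n : Name} {k : ℕ} : ∀ P : Proc, P.Closed → P.Simple →
    n ∈ (P.trunc (k + 1)).fn →
    (∃ P', Step P .tau P' ∧ n ∈ (P'.trunc k).fn) ∨
    (∃ a P', Step P (.inp a (.quote .nil)) P' ∧ (n = a ∨ n ∈ (P'.trunc k).fn)) ∨
    ∃ a M P', Step P (.out [] a M) P' ∧ (n = a ∨ n ∈ (M.trunc k).fn ∨ n ∈ (P'.trunc k).fn)
  | .nil, _, _, h => by simp [Proc.trunc, Proc.fn] at h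
  | .par P Q, hc, hs, h => by
    simp only [Proc.trunc, Proc.fn, Finset.mem_union] at h
    rcases h with h | h
    · rcases P.exists_step_of_mem_trunc hc.1 hs.1 h with
        ⟨P', h, hn⟩ | ⟨a, P', h, hn⟩ | ⟨a, M, P', h, hn⟩
      · exact .inl ⟨_, .parL h (by simp [Act.bn]), by simp [Proc.trunc, Proc.fn, hn]⟩
      · exact .inr (.inl ⟨a, _, .parL h (by simp [Act.bn]), by
          simp only [Proc.trunc, Proc.fn, Finset.mem_union]; tauto⟩)
      · exact .inr (.inr ⟨a, M, _, .parL h (by simp [Act.bn]), by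
          simp only [Proc.trunc, Proc.fn, Finset.mem_union]; tauto⟩)
    · rcases Q.exists_step_of_mem_trunc hc.2 hs.2 h with
        ⟨P', h, hn⟩ | ⟨a, P', h, hn⟩ | ⟨a, M, P', h, hn⟩
      · exact .inl ⟨_, .parR h (by simp [Act.bn]), by simp [Proc.trunc, Proc.fn, hn]⟩
      · exact .inr (.inl ⟨a, _, .parR h (by simp [Act.bn]), by
          simp only [Proc.trunc, Proc.fn, Finset.mem_union]; tauto⟩)
      · exact .inr (.inr ⟨a, M, _, .parR h (by simp [Act.bn]), by
          simp only [Proc.trunc, Proc.fn, Finset.mem_union]; tauto⟩)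
  | .rep P, hc, hs, h => by
    simp only [Proc.trunc, Proc.fn] at h
    rcases P.exists_step_of_mem_trunc hc hs h with
      ⟨P', h, hn⟩ | ⟨a, P', h, hn⟩ | ⟨a, M, P', h, hn⟩
    · exact .inl ⟨_, h.rep_copy, by simp [Proc.trunc, Proc.fn, hn]⟩
    · exact .inr (.inl ⟨a, _, h.rep_copy, by
        simp only [Proc.trunc, Proc.fn, Finset.mem_union]; tauto⟩)
    · exact .inr (.inr ⟨a, M, _, h.rep_copy, by
        simp only [Proc.trunc, Proc.fn, Finset.mem_union]; tauto⟩)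
  | .inp (.free a) P, hc, hs, h => by
    have hP := P.scoped_of_not_occurs hc.2 hs.1
    refine .inr (.inl ⟨a, _, .inp a P _ trivial, ?_⟩)
    rw [P.subst_of_scoped _ hP le_rfl]
    simpa [Proc.trunc, Proc.fn, Chan.fn] using h
  | .out (.free a) M P, _, _, h =>
    .inr (.inr ⟨a, M, P, .out a M P, by simpa [Proc.trunc, Proc.fn, Chan.fn, or_assoc] using h⟩)
  | .loc (.free a) P, _, _, h =>
    .inr (.inr ⟨a, .quote P, .nil, .passiv a P, by
      simpa [Proc.trunc, Term.trunc, Proc.fn, Term.fn, Chan.fn] using h⟩)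
  | .run (.quote P), _, _, h =>
    .inl ⟨P, .run P, by simpa [Proc.trunc, Term.trunc, Proc.fn, Term.fn] using h⟩
  | .run (.var i), hc, _, _ => absurd hc (Nat.not_lt_zero i)
  | .inp (.bound i) _, hc, _, _ | .out (.bound i) _ _, hc, _, _ | .loc (.bound i) _, hc, _, _ =>
    absurd hc.1 (Nat.not_lt_zero i)
  | .new _, _, hs, _ => hs.elim

mutual
theorem Clo.fn_trunc_subset (hB : ∀ P Q, B P Q → P.Closed ∧ Q.Closed)
    {P Q : Proc} : Clo B P Q → ∀ k, (∀ j ≤ k, ∀ P Q, B P Q → (P.trunc j).fn ⊆ Q.fn) →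
      (P.trunc k).fn ⊆ Q.fn
  | .hole (P₁ := P₁) (f := f) h hP hQ _ _, k, H => by
    intro a ha
    rw [hP, Proc.trunc_ren, Proc.mem_fn_ren_scoped (P₁.scoped_trunc k (hB _ _ h).1)] at ha
    rw [hQ, Proc.mem_fn_ren_scoped (hB _ _ h).2]
    obtain ⟨b, hb, e⟩ := ha
    exact ⟨b, H k le_rfl _ _ h hb, e⟩
  | .nil, k, _ => by simp [Proc.trunc]
  | .par h₁ h₂, k, H => by
    simpa only [Proc.trunc, Proc.fn] using
      Finset.union_subset_union (h₁.fn_trunc_subset hB k H) (h₂.fn_trunc_subset hB k H)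
  | .new h, k, H => by simpa only [Proc.trunc, Proc.fn] using h.fn_trunc_subset hB k H
  | .rep h, k, H => by simpa only [Proc.trunc, Proc.fn] using h.fn_trunc_subset hB k H
  | .eraseR h, k, H => by simpa only [Proc.fn, Term.fn] using h.fn_trunc_subset hB k H
  | .inp _ _, 0, _ | .out _ _ _, 0, _ | .loc _ _, 0, _ | .run _, 0, _ | .eraseL _, 0, _ => by
    simp [Proc.trunc, Proc.fn]
  | .inp _ h, k + 1, H => by
    simpa only [Proc.trunc, Proc.fn] using Finset.union_subset_union subset_rfl
      (h.fn_trunc_subset hB k fun j hj => H j (Nat.le_succ_of_le hj))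
  | .out _ hM h, k + 1, H => by
    simpa only [Proc.trunc, Proc.fn] using Finset.union_subset_union
      (Finset.union_subset_union subset_rfl
        (hM.fn_trunc_subset hB k fun j hj => H j (Nat.le_succ_of_le hj)))
      (h.fn_trunc_subset hB k fun j hj => H j (Nat.le_succ_of_le hj))
  | .loc _ h, k + 1, H => by
    simpa only [Proc.trunc, Proc.fn] using Finset.union_subset_union subset_rfl
      (h.fn_trunc_subset hB k fun j hj => H j (Nat.le_succ_of_le hj))
  | .run h, k + 1, H => by
    simpa only [Proc.trunc, Proc.fn] using
      h.fn_trunc_subset hB k fun j hj => H j (Nat.le_succ_of_le hj)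
  | .eraseL h, k + 1, H => by
    simpa only [Proc.trunc, Term.trunc, Proc.fn, Term.fn] using
      h.fn_trunc_subset hB k fun j hj => H j (Nat.le_succ_of_le hj)
theorem TClo.fn_trunc_subset (hB : ∀ P Q, B P Q → P.Closed ∧ Q.Closed)
    {M N : Term} : TClo B M N → ∀ k, (∀ j ≤ k, ∀ P Q, B P Q → (P.trunc j).fn ⊆ Q.fn) →
      (M.trunc k).fn ⊆ N.fn
  | .var _, _, _ => by simp [Term.trunc]
  | .quote h, k, H => by simpa only [Term.trunc, Term.fn] using h.fn_trunc_subset hB k H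
end

theorem Cong.fn_trunc_subset (hB : ∀ P Q, B P Q → P.Closed ∧ Q.Closed)
    {P Q : Proc} (h : Cong B P Q) {k : ℕ} (H : ∀ j ≤ k, ∀ P Q, B P Q → (P.trunc j).fn ⊆ Q.fn) :
    (P.trunc k).fn ⊆ Q.fn := by
  obtain ⟨P', Q', h₁, h₂, h₃⟩ := h
  rw [(h₁.trunc k).fn_eq, ← h₃.fn_eq]
  exact h₂.fn_trunc_subset hB k H

theorem TCong.fn_trunc_subset (hB : ∀ P Q, B P Q → P.Closed ∧ Q.Closed)
    {M N : Term} (h : TCong B M N) {k : ℕ}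
    (H : ∀ j ≤ k, ∀ P Q, B P Q → (P.trunc j).fn ⊆ Q.fn) : (M.trunc k).fn ⊆ N.fn := by
  obtain ⟨M', N', h₁, h₂, h₃⟩ := h
  rw [(h₁.trunc k).fn_eq, ← h₃.fn_eq]
  exact h₂.fn_trunc_subset hB k H

/-! ### Converses of environmental relations -/

/-- The converse of an environment. -/
def convEnv (E : Env) : Env := {p | (p.2, p.1) ∈ E}

/-- The converse of a set of quadruples. -/
def convRel (Y : QuadRel) : QuadRel := fun r E P Q => Y r (convEnv E) Q P

theorem fnFst_convEnv (E : Env) : fnFst (convEnv E) = fnSnd E := by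
  ext n
  exact ⟨fun ⟨p, hp, h⟩ => ⟨(p.2, p.1), hp, h⟩, fun ⟨p, hp, h⟩ => ⟨(p.2, p.1), hp, h⟩⟩

theorem fnSnd_convEnv (E : Env) : fnSnd (convEnv E) = fnFst E := by
  ext n
  exact ⟨fun ⟨p, hp, h⟩ => ⟨(p.2, p.1), hp, h⟩, fun ⟨p, hp, h⟩ => ⟨(p.2, p.1), hp, h⟩⟩

theorem fnEnv_convEnv (E : Env) : fnEnv (convEnv E) = fnEnv E := by
  rw [fnEnv, fnFst_convEnv, fnSnd_convEnv, Set.union_comm, fnEnv]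

theorem convEnv_insert (M N : Term) (E : Env) :
    convEnv (insert (M, N) E) = insert (N, M) (convEnv E) := by
  ext ⟨K, L⟩
  simp [convEnv, and_comm]

mutual
theorem PCtxRel.conv {r : Finset Name} {E : Env} : ∀ {P Q : Proc}, PCtxRel r E P Q →
    PCtxRel r (convEnv E) Q P
  | _, _, .nil => .nil
  | _, _, .inp ha h => .inp ha h.conv
  | _, _, .out ha hM h => .out ha hM.conv h.conv
  | _, _, .par h₁ h₂ => .par h₁.conv h₂.conv
  | _, _, .loc ha h => .loc ha h.conv
  | _, _, .new h => .new h.conv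
  | _, _, .rep h => .rep h.conv
  | _, _, .run h => .run h.conv
theorem TCtxRel.conv {r : Finset Name} {E : Env} : ∀ {M N : Term}, TCtxRel r E M N →
    TCtxRel r (convEnv E) N M
  | _, _, .hole h => .hole h
  | _, _, .var i => .var i
  | _, _, .quote h => .quote h.conv
end

theorem TermClosure.conv {r : Finset Name} {E : Env} {M N : Term} (h : TermClosure r E M N) :
    TermClosure r (convEnv E) N M := by
  rcases h with h | ⟨P, Q, rfl, rfl, h, hP, hQ⟩
  · exact .inl h
  · exact .inr ⟨Q, P, rfl, rfl, h.conv, hQ, hP⟩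

theorem UpTo.conv {Y : QuadRel} {r : Finset Name} {E : Env} {P Q : Proc}
    (h : UpTo Y r (convEnv E) Q P) : UpTo (convRel Y) r E P Q := by
  obtain ⟨cs, ds, P₀, Q₀, P₁, Q₁, r', E', hP, hQ, hY, ⟨h, h₁, h₂⟩, hE, hr, hc, hd⟩ := h
  rw [fnFst_convEnv] at hc
  rw [fnSnd_convEnv] at hd
  exact ⟨ds, cs, Q₀, P₀, Q₁, P₁, r', convEnv E', hQ, hP, hY, ⟨h.conv, h₂, h₁⟩,
    fun p hp => (hE (p.2, p.1) hp).conv, hr, hd, hc⟩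

theorem IsBisimUpTo.conv {Y : QuadRel} (hY : IsBisimUpTo Y) : IsBisimUpTo (convRel Y) where
  envRel r E P Q h := by
    obtain ⟨h₁, h₂, h₃, h₄⟩ := hY.envRel _ _ _ _ h
    rw [fnEnv_convEnv] at h₂
    exact ⟨fun p hp => (h₁ (p.2, p.1) hp).symm, h₂, h₄, h₃⟩
  tau h _ hs := by
    obtain ⟨Q', hw, hu⟩ := hY.tau_conv h hs
    exact ⟨Q', hw, hu.conv⟩
  tau_conv h _ hs := by
    obtain ⟨Q', hw, hu⟩ := hY.tau h hs
    exact ⟨Q', hw, hu.conv⟩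
  input h _ _ _ _ hs ha hM := by
    obtain ⟨Q', hw, hu⟩ := hY.input_conv h hs ha hM.conv
    exact ⟨Q', hw, hu.conv⟩
  input_conv h _ _ _ _ hs ha hM := by
    obtain ⟨Q', hw, hu⟩ := hY.input h hs ha hM.conv
    exact ⟨Q', hw, hu.conv⟩
  output h _ _ _ _ hs ha hb := by
    obtain ⟨cs, N, Q', hw, hc, hu⟩ := hY.output_conv h hs ha (by rwa [fnSnd_convEnv])
    rw [fnFst_convEnv] at hc
    rw [← convEnv_insert] at hu
    exact ⟨cs, N, Q', hw, hc, hu.conv⟩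
  output_conv h _ _ _ _ hs ha hb := by
    obtain ⟨cs, N, Q', hw, hc, hu⟩ := hY.output h hs ha (by rwa [fnFst_convEnv])
    rw [fnSnd_convEnv] at hc
    rw [← convEnv_insert] at hu
    exact ⟨cs, N, Q', hw, hc, hu.conv⟩
  spawn h _ _ _ hp ha := (hY.spawn h hp ha).conv
  fresh h _ hE hP hQ := hY.fresh h (by rwa [fnEnv_convEnv]) hQ hP

theorem IsSimpleRel.conv {Y : QuadRel} (hY : IsSimpleRel Y) : IsSimpleRel (convRel Y) :=
  fun _ _ _ _ h p hp => (hY _ _ _ _ h (p.2, p.1) hp).symm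

/-! ### Decomposing the up-to context closure -/

mutual
theorem PCtxRel.closure {r r' : Finset Name} {E E' : Env} (hr : r ⊆ r')
    (hE : ∀ p ∈ E, TCtxRel r' E' p.1 p.2) : ∀ {P Q : Proc}, PCtxRel r E P Q → PCtxRel r' E' P Q
  | _, _, .nil => .nil
  | _, _, .inp ha h => .inp (ha.trans hr) (h.closure hr hE)
  | _, _, .out ha hM h => .out (ha.trans hr) (hM.closure hr hE) (h.closure hr hE)
  | _, _, .par h₁ h₂ => .par (h₁.closure hr hE) (h₂.closure hr hE)
  | _, _, .loc ha h => .loc (ha.trans hr) (h.closure hr hE)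
  | _, _, .new h => .new (h.closure hr hE)
  | _, _, .rep h => .rep (h.closure hr hE)
  | _, _, .run h => .run (h.closure hr hE)
theorem TCtxRel.closure {r r' : Finset Name} {E E' : Env} (hr : r ⊆ r')
    (hE : ∀ p ∈ E, TCtxRel r' E' p.1 p.2) : ∀ {M N : Term}, TCtxRel r E M N → TCtxRel r' E' M N
  | _, _, .hole h => hE _ h
  | _, _, .var i => .var i
  | _, _, .quote h => .quote (h.closure hr hE)
end

theorem TermClosure.tctxRel {r : Finset Name} {E : Env} {M N : Term} (h : TermClosure r E M N) :
    TCtxRel r E M N := by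
  rcases h with h | ⟨P, Q, rfl, rfl, h, -⟩
  · exact .hole h
  · exact .quote h

theorem UpTo.of_scong {Y : QuadRel} {r : Finset Name} {E : Env} {P P' Q Q' : Proc}
    (h : UpTo Y r E P Q) (hP : SCong P P') (hQ : SCong Q Q') : UpTo Y r E P' Q' := by
  obtain ⟨cs, ds, P₀, Q₀, P₁, Q₁, r', E', h₁, h₂, h⟩ := h
  exact ⟨cs, ds, P₀, Q₀, P₁, Q₁, r', E', hP.symm.trans h₁, hQ.symm.trans h₂, h⟩

theorem eq_zero_of_add_le_one {m n : ℕ∞} (h : m + n ≤ 1) (hm : m ≠ 0) : n = 0 := by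
  have h₁ : 1 + n ≤ 1 + 0 := (add_le_add_left (Order.one_le_iff_ne_zero.2 hm) n).trans h
  simpa using (ENat.add_le_add_iff_left ENat.one_ne_top).1 h₁

/-- Processes with at most one top-level component, which no restriction reaches, cannot be split:
when the up-to context closure relates them, either the relation itself relates them, or it relates
null processes and they are in the context closure of the environment. -/
theorem UpTo.split {Y : QuadRel} {r : Finset Name} {E : Env} {P Q : Proc} (h : UpTo Y r E P Q)
    (vP : P.Visible) (vQ : Q.Visible) (cP : P.count ≤ 1) (cQ : Q.count ≤ 1) :
    ∃ r' E' P₀ Q₀, Y r' E' P₀ Q₀ ∧ r ⊆ r' ∧ (∀ p ∈ E, TCtxRel r' E' p.1 p.2) ∧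
      (SCong P₀ P ∧ SCong Q₀ Q ∨ SCong P₀ .nil ∧ SCong Q₀ .nil ∧
        ∃ P₁ Q₁, PCtxRel r' E' P₁ Q₁ ∧ SCong P₁ P ∧ SCong Q₁ Q) := by
  obtain ⟨cs, ds, P₀, Q₀, P₁, Q₁, r', E', hP, hQ, hY, ⟨h, -⟩, hE, hr, -⟩ := h
  replace hP := hP.trans (.nus_of_notMem (visible_nus.1 (hP.visible_iff.1 vP)).2)
  replace hQ := hQ.trans (.nus_of_notMem (visible_nus.1 (hQ.visible_iff.1 vQ)).2)
  rw [hP.count_eq, Proc.count, add_comm] at cP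
  rw [hQ.count_eq, Proc.count, add_comm] at cQ
  refine ⟨r', E', P₀, Q₀, hY, hr, fun p hp => (hE p hp).tctxRel, ?_⟩
  by_cases h₀ : P₁.count = 0
  · have h₁ := Q₁.scong_nil_of_count (h.count_eq ▸ h₀)
    replace h₀ := P₁.scong_nil_of_count h₀
    exact .inl ⟨((hP.trans (.par (.refl _) h₀)).trans (.parNil _)).symm,
      ((hQ.trans (.par (.refl _) h₁)).trans (.parNil _)).symm⟩
  · have h₁ : Q₁.count ≠ 0 := h.count_eq ▸ h₀
    replace h₀ := P₀.scong_nil_of_count (eq_zero_of_add_le_one cP h₀)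
    replace h₁ := Q₀.scong_nil_of_count (eq_zero_of_add_le_one cQ h₁)
    exact .inr ⟨h₀, h₁, P₁, Q₁, h, ((hP.trans (.par h₀ (.refl _))).trans (.nilPar _)).symm,
      ((hQ.trans (.par h₁ (.refl _))).trans (.nilPar _)).symm⟩

/-! ### Processes related inside a fresh location -/

/-- Simple processes that an environmental relation relates, up to structural congruence, inside a
location whose name is known and occurs in neither of them. -/
structure LocRel (Y : QuadRel) (P Q : Proc) : Prop where
  simpleL : P.Simple
  simpleR : Q.Simple
  closedL : P.Closed
  closedR : Q.Closed
  related : ∃ r E P₀ Q₀ l, Y r E P₀ Q₀ ∧ SCong P₀ (.loc (.free l) P) ∧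
    SCong Q₀ (.loc (.free l) Q) ∧ l ∈ r ∧ l ∉ P.fn ∧ l ∉ Q.fn ∧ P.fn ⊆ r ∧ Q.fn ⊆ r

theorem LocRel.conv {Y : QuadRel} {P Q : Proc} (h : LocRel Y Q P) : LocRel (convRel Y) P Q := by
  obtain ⟨hQ, hP, hQ', hP', r, E, Q₀, P₀, l, hY, h₁, h₂, hl, l₁, l₂, f₁, f₂⟩ := h
  exact ⟨hP, hQ, hP', hQ', r, convEnv E, P₀, Q₀, l, hY, h₂, h₁, hl, l₂, l₁, f₂, f₁⟩

mutual
theorem PCtxRel.cong_of_hole {r s : Finset Name} {E : Env} {n : ℕ}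
    (hE : ∀ M N, (M, N) ∈ E → M.quoteDepth ≤ n → M.fn ⊆ s → N.fn ⊆ s → TCong B M N) :
    ∀ {P Q : Proc}, PCtxRel r E P Q → P.quoteDepth ≤ n → P.fn ⊆ s → Q.fn ⊆ s → Cong B P Q
  | _, _, .nil, _, _, _ => .refl _
  | _, _, .inp _ h, hn, hP, hQ =>
    (h.cong_of_hole hE hn (Finset.union_subset_right hP) (Finset.union_subset_right hQ)).inp _
  | _, _, .out _ hM h, hn, hP, hQ =>
    (h.cong_of_hole hE (le_of_max_le_right hn) (Finset.union_subset_right hP)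
      (Finset.union_subset_right hQ)).out _ (hM.cong_of_hole hE (le_of_max_le_left hn)
        (Finset.union_subset_right (Finset.union_subset_left hP))
        (Finset.union_subset_right (Finset.union_subset_left hQ)))
  | _, _, .par h₁ h₂, hn, hP, hQ =>
    (h₁.cong_of_hole hE (le_of_max_le_left hn) (Finset.union_subset_left hP)
      (Finset.union_subset_left hQ)).par (h₂.cong_of_hole hE (le_of_max_le_right hn)
        (Finset.union_subset_right hP) (Finset.union_subset_right hQ))
  | _, _, .loc _ h, hn, hP, hQ =>
    (h.cong_of_hole hE hn (Finset.union_subset_right hP) (Finset.union_subset_right hQ)).loc _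
  | _, _, .new h, hn, hP, hQ => (h.cong_of_hole hE hn hP hQ).new
  | _, _, .rep h, hn, hP, hQ => (h.cong_of_hole hE hn hP hQ).rep
  | _, _, .run h, hn, hP, hQ => .run (h.cong_of_hole hE hn hP hQ)
theorem TCtxRel.cong_of_hole {r s : Finset Name} {E : Env} {n : ℕ}
    (hE : ∀ M N, (M, N) ∈ E → M.quoteDepth ≤ n → M.fn ⊆ s → N.fn ⊆ s → TCong B M N) :
    ∀ {M N : Term}, TCtxRel r E M N → M.quoteDepth ≤ n → M.fn ⊆ s → N.fn ⊆ s → TCong B M N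
  | _, _, .hole h, hn, hP, hQ => hE _ _ h hn hP hQ
  | _, _, .var i, _, _, _ => .refl _
  | _, _, .quote h, hn, hP, hQ => .quote (h.cong_of_hole hE ((Nat.le_succ _).trans hn) hP hQ)
end

theorem Term.Closed.exists_quote {M : Term} (h : M.Closed) : ∃ P, M = .quote P ∧ P.Closed := by
  cases M with
  | var i => exact absurd h (Nat.not_lt_zero i)
  | quote P => exact ⟨P, rfl, h⟩

theorem visible_loc {c : Chan} {P : Proc} (h : (Proc.loc c P).Closed) : (Proc.loc c P).Visible :=
  ⟨0, h⟩

/-- When the up-to context closure relates `l[P]` to `l[Q]`, either `P` and `Q` are related inside a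
fresh location, or they are in the context closure of an environment of related null processes. -/
theorem UpTo.split_loc {Y : QuadRel} {r : Finset Name} {E : Env} {l : Name} {P Q : Proc}
    (h : UpTo Y r E (.loc (.free l) P) (.loc (.free l) Q)) (sP : P.Simple) (sQ : Q.Simple)
    (cP : P.Closed) (cQ : Q.Closed) (hl : l ∈ r) (lP : l ∉ P.fn) (lQ : l ∉ Q.fn) (fP : P.fn ⊆ r)
    (fQ : Q.fn ⊆ r) :
    LocRel Y P Q ∨ ∃ r' E' P₀ Q₀ P₁ Q₁, Y r' E' P₀ Q₀ ∧ r ⊆ r' ∧ SCong P₀ .nil ∧ SCong Q₀ .nil ∧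
      PCtxRel r' E' P₁ Q₁ ∧ SCong P P₁ ∧ SCong Q₁ Q := by
  have cP' : (Proc.loc (.free l) P).Closed := ⟨trivial, cP⟩
  have cQ' : (Proc.loc (.free l) Q).Closed := ⟨trivial, cQ⟩
  obtain ⟨r', E', P₀, Q₀, hY, hr, -, ⟨h₁, h₂⟩ | ⟨h₁, h₂, P₁, Q₁, h, h₃, h₄⟩⟩ :=
    h.split (visible_loc cP') (visible_loc cQ') le_rfl le_rfl
  · exact .inl ⟨sP, sQ, cP, cQ, r', E', P₀, Q₀, l, hY, h₁, h₂, hr hl, lP, lQ, fP.trans hr,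
      fQ.trans hr⟩
  · obtain ⟨P₂, e, hP₂⟩ := (h₃.hasLoc_loc cP').1
    obtain ⟨Q₂, hQ₂, h⟩ := h.hasLoc hP₂
    exact .inr ⟨r', E', P₀, Q₀, P₂, Q₂, hY, hr, h₁, h₂, h, e, ((h₄.hasLoc_loc cQ').2 _ hQ₂).symm⟩

theorem LocRel.cong {Y : QuadRel} {P Q : Proc} (h : LocRel Y P Q) : Cong (LocRel Y) P Q :=
  Clo.cong (.hole (f := id) (g := id) h P.ren_id.symm Q.ren_id.symm P.ren_id Q.ren_id)

/-- Terms in an environment of related null processes are contextually related: the quoted processes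
can be spawned inside a fresh location.  The induction is on the quotation depth, which decreases
when the spawned processes turn out to be in the context closure of a new environment. -/
theorem tcong_of_mem_env {Y : QuadRel} (hY : IsBisimUpTo Y) (hs : IsSimpleRel Y) (n : ℕ) :
    ∀ {r E P₀ Q₀}, Y r E P₀ Q₀ → SCong P₀ .nil → SCong Q₀ .nil → ∀ M N, (M, N) ∈ E →
      M.quoteDepth ≤ n → M.fn ⊆ r → N.fn ⊆ r → TCong (LocRel Y) M N := by
  induction n with
  | zero =>
    intro r E P₀ Q₀ h _ _ M N hMN hn
    obtain ⟨P, rfl, -⟩ := ((hY.envRel _ _ _ _ h).1 _ hMN).1.exists_quote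
    exact absurd hn (Nat.not_succ_le_zero _)
  | succ n ih =>
    intro r E P₀ Q₀ h eP eQ M N hMN hn fM fN
    obtain ⟨hE, hfin, -, -⟩ := hY.envRel _ _ _ _ h
    obtain ⟨sM, sN⟩ := hs _ _ _ _ h _ hMN
    obtain ⟨cM, cN⟩ := hE _ hMN
    obtain ⟨P, rfl, cP⟩ := Term.Closed.exists_quote cM
    obtain ⟨Q, rfl, cQ⟩ := Term.Closed.exists_quote cN
    obtain ⟨l, hl⟩ := exists_fresh (hfin.toFinset ∪ (P₀.fn ∪ Q₀.fn))
    simp only [Finset.mem_union, Set.Finite.mem_toFinset, not_or] at hl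
    obtain ⟨hlE, hlP, hlQ⟩ := hl
    have hu := (hY.spawn (hY.fresh h hlE hlP hlQ) hMN (Finset.mem_insert_self l r)).of_scong
      ((SCong.par eP (.refl _)).trans (.nilPar _)) ((SCong.par eQ (.refl _)).trans (.nilPar _))
    rcases hu.split_loc sM sN cP cQ (Finset.mem_insert_self l r)
      (fun h => hlE (.inl ⟨_, hMN, h⟩)) (fun h => hlE (.inr ⟨_, hMN, h⟩))
      (fM.trans (Finset.subset_insert l r)) (fN.trans (Finset.subset_insert l r)) with
      h | ⟨r', E', P', Q', P₁, Q₁, h, hr, eP', eQ', hc, e₁, e₂⟩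
    · exact .quote h.cong
    · refine .quote (e₁.trans_cong (Cong.trans_scong ?_ e₂))
      replace hr := (Finset.subset_insert l r).trans hr
      refine hc.cong_of_hole (s := r') (n := n) (ih h eP' eQ') ?_ ?_ ?_
      · rw [← e₁.quoteDepth_eq]
        exact Nat.le_of_succ_le_succ hn
      · rw [← e₁.fn_eq]
        exact Finset.Subset.trans fM hr
      · rw [e₂.fn_eq]
        exact Finset.Subset.trans fN hr

/-- The context closure of an environment of related null processes is contained in the contextual
closure of `LocRel Y`. -/
theorem PCtxRel.cong_of_null {Y : QuadRel} (hY : IsBisimUpTo Y) (hs : IsSimpleRel Y)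
    {r : Finset Name} {E : Env} {P₀ Q₀ : Proc} (h : Y r E P₀ Q₀) (eP : SCong P₀ .nil)
    (eQ : SCong Q₀ .nil) {P Q : Proc} (hc : PCtxRel r E P Q) (hP : P.fn ⊆ r) (hQ : Q.fn ⊆ r) :
    Cong (LocRel Y) P Q :=
  hc.cong_of_hole (tcong_of_mem_env hY hs _ h eP eQ) le_rfl hP hQ

theorem TCtxRel.cong_of_null {Y : QuadRel} (hY : IsBisimUpTo Y) (hs : IsSimpleRel Y)
    {r : Finset Name} {E : Env} {P₀ Q₀ : Proc} (h : Y r E P₀ Q₀) (eP : SCong P₀ .nil)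
    (eQ : SCong Q₀ .nil) {M N : Term} (hc : TCtxRel r E M N) (hM : M.fn ⊆ r) (hN : N.fn ⊆ r) :
    TCong (LocRel Y) M N :=
  hc.cong_of_hole (tcong_of_mem_env hY hs _ h eP eQ) le_rfl hM hN

/-- When the up-to context closure relates two locations with the same fresh name, their simple contents
are related by the contextual closure of `LocRel Y`. -/
theorem UpTo.cong_loc {Y : QuadRel} (hY : IsBisimUpTo Y) (hs : IsSimpleRel Y) {r : Finset Name}
    {E : Env} {l : Name} {P Q : Proc} (h : UpTo Y r E (.loc (.free l) P) (.loc (.free l) Q))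
    (sP : P.Simple) (sQ : Q.Simple) (cP : P.Closed) (cQ : Q.Closed) (hl : l ∈ r) (lP : l ∉ P.fn)
    (lQ : l ∉ Q.fn) (fP : P.fn ⊆ r) (fQ : Q.fn ⊆ r) : Cong (LocRel Y) P Q := by
  rcases h.split_loc sP sQ cP cQ hl lP lQ fP fQ with
    h | ⟨r', E', P', Q', P₁, Q₁, h, hr, eP', eQ', hc, e₁, e₂⟩
  · exact h.cong
  · refine e₁.trans_cong ((hc.cong_of_null hY hs h eP' eQ' ?_ ?_).trans_scong e₂)
    · rw [← e₁.fn_eq]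
      exact fP.trans hr
    · rw [e₂.fn_eq]
      exact fQ.trans hr

/-! ### Transitions of a process inside a location -/

theorem Weak.loc_inv {c : Chan} {P R : Proc} (h : Weak (.loc c P) R) :
    ∃ P', R = .loc c P' ∧ Weak P P' := by
  induction h with
  | refl => exact ⟨P, rfl, .refl⟩
  | tail _ hs ih =>
    obtain ⟨P', rfl, hw⟩ := ih
    cases hs with
    | transp h => exact ⟨_, rfl, hw.tail h⟩

theorem WeakAct.loc_inp_inv {l a : Name} {P R : Proc} {M : Term}
    (h : WeakAct (.loc (.free l) P) (.inp a M) R) :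
    ∃ P', R = .loc (.free l) P' ∧ WeakAct P (.inp a M) P' := by
  obtain ⟨_, _, h₁, h₂, h₃⟩ := h
  obtain ⟨P₁, rfl, w₁⟩ := h₁.loc_inv
  cases h₂ with
  | transp h₂ =>
    obtain ⟨P₂, rfl, w₃⟩ := h₃.loc_inv
    exact ⟨P₂, rfl, _, _, w₁, h₂, w₃⟩

theorem WeakAct.loc_out_inv {l a : Name} {P R : Proc} {bs : List Name} {M : Term} (hal : a ≠ l)
    (h : WeakAct (.loc (.free l) P) (.out bs a M) R) :
    ∃ P', R = .loc (.free l) P' ∧ WeakAct P (.out bs a M) P' := by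
  obtain ⟨_, _, h₁, h₂, h₃⟩ := h
  obtain ⟨P₁, rfl, w₁⟩ := h₁.loc_inv
  cases h₂ with
  | transp h₂ =>
    obtain ⟨P₂, rfl, w₃⟩ := h₃.loc_inv
    exact ⟨P₂, rfl, _, _, w₁, h₂, w₃⟩
  | passiv => exact absurd rfl hal

theorem Weak.nil_inv {R : Proc} (h : Weak .nil R) : R = .nil := by
  induction h with
  | refl => rfl
  | tail _ hs ih => subst ih; cases hs

theorem WeakAct.loc_passiv_inv {l : Name} {P R : Proc} {bs : List Name} {M : Term} (hl : l ∉ P.fn)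
    (h : WeakAct (.loc (.free l) P) (.out bs l M) R) : R = .nil := by
  obtain ⟨_, _, h₁, h₂, h₃⟩ := h
  obtain ⟨P₁, rfl, w₁⟩ := h₁.loc_inv
  cases h₂ with
  | transp h₂ => exact absurd (w₁.fn_subset h₂.fnSpec.1) hl
  | passiv => exact h₃.nil_inv

theorem WeakAct.fn_inp {P P' : Proc} {a : Name} {M : Term} (h : WeakAct P (.inp a M) P') :
    a ∈ P.fn ∧ P'.fn ⊆ P.fn ∪ M.fn := by
  obtain ⟨P₁, P₂, h₁, h₂, h₃⟩ := h
  obtain ⟨ha, hf⟩ := h₂.fnSpec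
  exact ⟨h₁.fn_subset ha, h₃.fn_subset.trans
    (hf.trans (Finset.union_subset_union h₁.fn_subset subset_rfl))⟩

theorem WeakAct.fn_out {P P' : Proc} {a : Name} {M : Term} (h : WeakAct P (.out [] a M) P') :
    a ∈ P.fn ∧ M.fn ⊆ P.fn ∧ P'.fn ⊆ P.fn := by
  obtain ⟨P₁, P₂, h₁, h₂, h₃⟩ := h
  obtain ⟨ha, -, hM, hf⟩ := h₂.fnSpec
  simp only [List.not_mem_nil, or_false] at hM hf
  exact ⟨h₁.fn_subset ha, fun x hx => h₁.fn_subset (hM x hx),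
    h₃.fn_subset.trans fun x hx => h₁.fn_subset (hf x hx)⟩

theorem Step.fn_tau {P P' : Proc} (h : Step P .tau P') : P'.fn ⊆ P.fn := h.fnSpec

theorem LocRel.tau {Y : QuadRel} (hY : IsBisimUpTo Y) (hs : IsSimpleRel Y) {P Q P' : Proc}
    (h : LocRel Y P Q) (hP : Step P .tau P') : ∃ Q', Weak Q Q' ∧ Cong (LocRel Y) P' Q' := by
  obtain ⟨sP, sQ, cP, cQ, r, E, P₀, Q₀, l, h, h₁, h₂, hl, lP, lQ, fP, fQ⟩ := h
  obtain ⟨P₀', hP₀, e₁⟩ := h₁.symm.sim.tau (.transp hP (by simp [Act.bn]) : Step (.loc (.free l) P) _ _)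
  obtain ⟨Q₀', hQ₀, hu⟩ := hY.tau h hP₀
  obtain ⟨_, hw, e₂⟩ := h₂.weak hQ₀
  obtain ⟨Q', rfl, hQ⟩ := hw.loc_inv
  have gP := hP.fn_tau
  have gQ := hQ.fn_subset
  exact ⟨Q', hQ, (hu.of_scong e₁.symm e₂).cong_loc hY hs (hP.simpleSpec cP sP) (hQ.simple cQ sQ)
    (hP.closed cP).1 (hQ.closed cQ) hl (fun x => lP (gP x)) (fun x => lQ (gQ x)) (gP.trans fP)
    (gQ.trans fQ)⟩

/-- The answer to an input does not depend on the messages received. -/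
theorem LocRel.inp {Y : QuadRel} (hY : IsBisimUpTo Y) (hs : IsSimpleRel Y) {P Q P' : Proc}
    {a : Name} {M : Term} (h : LocRel Y P Q) (hP : Step P (.inp a M) P') :
    ∃ Q', (∀ N : Term, N.Closed → WeakAct Q (.inp a N) Q') ∧ Cong (LocRel Y) P' Q' := by
  obtain ⟨sP, sQ, cP, cQ, r, E, P₀, Q₀, l, h, h₁, h₂, hl, lP, lQ, fP, fQ⟩ := h
  -- The residual does not depend on the message, so the message may be taken to be a quoted `0`.
  replace hP := (hP.simpleSpec cP sP).2 (.quote .nil) trivial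
  have ha := fP hP.fnSpec.1
  obtain ⟨P₀', hP₀, e₁⟩ := h₁.symm.sim.inp
    (.transp hP (by simp [Act.bn]) : Step (.loc (.free l) P) _ _) (.refl _)
  obtain ⟨Q₀', hQ₀, hu⟩ := hY.input h hP₀ ha (.inr ⟨.nil, .nil, rfl, rfl, .nil, trivial, trivial⟩)
  obtain ⟨_, hw, e₂⟩ := h₂.weakAct_inp hQ₀ (.refl _)
  obtain ⟨Q', rfl, hQ⟩ := hw.loc_inp_inv
  obtain ⟨sQ', hQ'⟩ := hQ.simple_inp cQ sQ
  have gP : P'.fn ⊆ P.fn := by simpa [Term.fn, Proc.fn] using hP.fnSpec.2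
  have gQ : Q'.fn ⊆ Q.fn := by simpa [Term.fn, Proc.fn] using hQ.fn_inp.2
  exact ⟨Q', hQ', (hu.of_scong e₁.symm e₂).cong_loc hY hs (hP.simpleSpec cP sP).1 sQ'
    (hP.closed cP).1 (hQ.closed cQ).1 hl (fun x => lP (gP x)) (fun x => lQ (gQ x)) (gP.trans fP)
    (gQ.trans fQ)⟩

/-- Messages added to the environment by the up-to context closure of a pair of locations with a fresh
name are contextually related: when the locations themselves are related, they can be passivated to
reach null processes. -/
theorem UpTo.tcong_of_loc {Y : QuadRel} (hY : IsBisimUpTo Y) (hs : IsSimpleRel Y) {r : Finset Name}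
    {E : Env} {l : Name} {P Q : Proc} {M N : Term}
    (h : UpTo Y r (insert (M, N) E) (.loc (.free l) P) (.loc (.free l) Q))
    (cP : P.Closed) (cQ : Q.Closed) (hl : l ∈ r) (lQ : l ∉ Q.fn) (fM : M.fn ⊆ r) (fN : N.fn ⊆ r) :
    TCong (LocRel Y) M N := by
  have cP' : (Proc.loc (.free l) P).Closed := ⟨trivial, cP⟩
  have cQ' : (Proc.loc (.free l) Q).Closed := ⟨trivial, cQ⟩
  obtain ⟨r', E', P₀, Q₀, h, hr, hE, ⟨h₁, h₂⟩ | ⟨h₁, h₂, -⟩⟩ :=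
    h.split (visible_loc cP') (visible_loc cQ') le_rfl le_rfl
  · obtain ⟨bs, L, P₁, hbs, -, hP, e₁⟩ := h₁.symm.sim.out (.passiv l P)
    obtain rfl := List.nil_perm.1 hbs
    obtain ⟨cs, L', Q₁, hQ, -, hu⟩ := hY.output h hP (hr hl) (by simp)
    obtain ⟨ds, L'', Q₂, -, -, hQ', e₂⟩ := h₂.weakAct_out hQ
    obtain rfl := hQ'.loc_passiv_inv lQ
    obtain ⟨r'', E'', P₂, Q₂, h, hr', hE', h'⟩ :=
      (hu.of_scong e₁.symm e₂).split trivial trivial zero_le_one zero_le_one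
    have hn : SCong P₂ .nil ∧ SCong Q₂ .nil := h'.elim id fun h => ⟨h.1, h.2.1⟩
    exact ((hE _ (Set.mem_insert _ _)).closure hr'
      fun p hp => hE' p (Set.mem_insert_of_mem _ hp)).cong_of_null hY hs h hn.1 hn.2
      (fM.trans (hr.trans hr')) (fN.trans (hr.trans hr'))
  · exact (hE _ (Set.mem_insert _ _)).cong_of_null hY hs h h₁ h₂ (fM.trans hr) (fN.trans hr)

theorem LocRel.out {Y : QuadRel} (hY : IsBisimUpTo Y) (hs : IsSimpleRel Y) {P Q P' : Proc}
    {bs : List Name} {a : Name} {M : Term} (h : LocRel Y P Q) (hP : Step P (.out bs a M) P') :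
    bs = [] ∧ ∃ N Q', WeakAct Q (.out [] a N) Q' ∧ TCong (LocRel Y) M N ∧
      Cong (LocRel Y) P' Q' := by
  obtain ⟨sP, sQ, cP, cQ, r, E, P₀, Q₀, l, h, h₁, h₂, hl, lP, lQ, fP, fQ⟩ := h
  obtain ⟨rfl, -, sP'⟩ := hP.simpleSpec cP sP
  obtain ⟨ha, gM, gP⟩ := hP.weakAct.fn_out
  refine ⟨rfl, ?_⟩
  obtain ⟨bs, M₀, P₀', hbs, eM, hP₀, e₁⟩ := h₁.symm.sim.out
    (.transp hP (by simp [Act.bn]) : Step (.loc (.free l) P) _ _)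
  obtain rfl := List.nil_perm.1 hbs
  obtain ⟨cs, N₀, Q₀', hQ₀, -, hu⟩ := hY.output h hP₀ (fP ha) (by simp)
  obtain ⟨ds, N, _, -, eN, hw, e₂⟩ := h₂.weakAct_out hQ₀
  have hal : a ≠ l := by
    rintro rfl
    exact lP ha
  obtain ⟨Q', rfl, hQ⟩ := hw.loc_out_inv hal
  obtain ⟨rfl, -, sQ'⟩ := hQ.simple_out cQ sQ
  obtain ⟨-, gN, gQ⟩ := hQ.fn_out
  replace hu := hu.of_scong e₁.symm e₂
  have cP' := (hP.closed cP).1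
  have cQ' := (hQ.closed cQ).1
  have lP' : l ∉ P'.fn := fun x => lP (gP x)
  have lQ' : l ∉ Q'.fn := fun x => lQ (gQ x)
  refine ⟨N, Q', hQ, eM.trans_tcong (TCong.trans_tscong ?_ eN),
    hu.cong_loc hY hs sP' sQ' cP' cQ' hl lP' lQ' (gP.trans fP) (gQ.trans fQ)⟩
  refine hu.tcong_of_loc hY hs cP' cQ' hl lQ' ?_ ?_
  · rw [← eM.fn_eq]
    exact gM.trans fP
  · rw [eN.fn_eq]
    exact gN.trans fQ

theorem Proc.fn_trunc_zero : ∀ P : Proc, (P.trunc 0).fn = ∅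
  | .par P Q => by simp [Proc.trunc, Proc.fn, P.fn_trunc_zero, Q.fn_trunc_zero]
  | .new P => by simpa [Proc.trunc, Proc.fn] using P.fn_trunc_zero
  | .rep P => by simpa [Proc.trunc, Proc.fn] using P.fn_trunc_zero
  | .nil | .inp _ _ | .out _ _ _ | .loc _ _ | .run _ => by simp [Proc.trunc, Proc.fn]

/-- Every free name of a simple process becomes observable after finitely many transitions, so that
related simple processes have the same free names; the induction is on the depth of the name. -/
theorem LocRel.fn_trunc_subset {Y : QuadRel} (hY : IsBisimUpTo Y) (hs : IsSimpleRel Y) (k : ℕ) :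
    ∀ j ≤ k, ∀ P Q, LocRel Y P Q → (P.trunc j).fn ⊆ Q.fn := by
  induction k with
  | zero =>
    intro j hj P Q _
    rw [Nat.le_zero.1 hj, P.fn_trunc_zero]
    exact Finset.empty_subset _
  | succ k ih =>
    intro j hj P Q h
    rcases Nat.le_succ_iff.1 hj with hj | rfl
    · exact ih j hj P Q h
    have closed : ∀ P Q, LocRel Y P Q → P.Closed ∧ Q.Closed := fun _ _ h => ⟨h.closedL, h.closedR⟩
    intro n hn
    rcases P.exists_step_of_mem_trunc h.closedL h.simpleL hn with
      ⟨P', hP, hn⟩ | ⟨a, P', hP, hn⟩ | ⟨a, M, P', hP, hn⟩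
    · obtain ⟨Q', hQ, hc⟩ := h.tau hY hs hP
      exact hQ.fn_subset (hc.fn_trunc_subset closed ih hn)
    · obtain ⟨Q', hQ, hc⟩ := h.inp hY hs hP
      obtain ⟨ha, hQ'⟩ := (hQ (.quote .nil) trivial).fn_inp
      rcases hn with rfl | hn
      · exact ha
      · simpa [Term.fn, Proc.fn] using hQ' (hc.fn_trunc_subset closed ih hn)
    · obtain ⟨-, N, Q', hQ, hM, hc⟩ := h.out hY hs hP
      obtain ⟨ha, hN, hQ'⟩ := hQ.fn_out
      rcases hn with rfl | hn | hn
      · exact ha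
      · exact hN (hM.fn_trunc_subset closed ih hn)
      · exact hQ' (hc.fn_trunc_subset closed ih hn)

theorem LocRel.fn_subset {Y : QuadRel} (hY : IsBisimUpTo Y) (hs : IsSimpleRel Y) {P Q : Proc}
    (h : LocRel Y P Q) : P.fn ⊆ Q.fn := by
  obtain ⟨K, hK⟩ := P.exists_trunc_eq
  have := LocRel.fn_trunc_subset hY hs K K le_rfl P Q h
  rwa [hK K le_rfl] at this

/-- The symmetric closure of `LocRel Y`. -/
def SymLocRel (Y : QuadRel) (P Q : Proc) : Prop := LocRel Y P Q ∨ LocRel Y Q P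

theorem LocRel.matches {Y : QuadRel} (hY : IsBisimUpTo Y) (hs : IsSimpleRel Y)
    (hB : ∀ P Q, LocRel Y P Q → B P Q) {P Q P' : Proc} {α : Act}
    (h : LocRel Y P Q) (hP : Step P α P') : Matches B P' Q α := by
  cases α with
  | tau =>
    obtain ⟨Q', hQ, hc⟩ := h.tau hY hs hP
    exact ⟨Q', hQ, hc.mono hB⟩
  | inp a M =>
    obtain ⟨Q', hQ, hc⟩ := h.inp hY hs hP
    exact fun N hN _ => ⟨Q', hQ N hN, hc.mono hB⟩
  | out bs a M =>
    obtain ⟨rfl, N, Q', hQ, hM, hc⟩ := h.out hY hs hP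
    exact ⟨N, Q', hQ, hM.mono hB, hc.mono hB⟩

theorem progressing_symLocRel {Y : QuadRel} (hY : IsBisimUpTo Y) (hs : IsSimpleRel Y) :
    Progressing (SymLocRel Y) where
  closed _ _ h := h.elim (fun h => ⟨h.closedL, h.closedR⟩) fun h => ⟨h.closedR, h.closedL⟩
  symm _ _ h := h.symm
  fn_eq P Q h := by
    have eq : ∀ {P Q}, LocRel Y P Q → P.fn = Q.fn := fun h =>
      (h.fn_subset hY hs).antisymm
        (LocRel.fn_subset hY.conv hs.conv (LocRel.conv (Y := Y) h))
    exact h.elim eq fun h => (eq h).symm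
  progress P Q h α P' hP := by
    rcases h with h | h
    · exact h.matches hY hs (fun _ _ => .inl) hP
    · exact (LocRel.conv h).matches hY.conv hs.conv (fun _ _ h => .inr (LocRel.conv h)) hP

/-! ### Processes under `run` -/

/-- `P` under `k` nested `run`s. -/
def runs : ℕ → Proc → Proc
  | 0, P => P
  | k + 1, P => .run (.quote (runs k P))

mutual
theorem Erase.scoped_iff {P Q : Proc} : Erase P Q → ∀ k m, P.Scoped k m ↔ Q.Scoped k m
  | .erase h, k, m => h.scoped_iff k m
  | .nil, _, _ => .rfl
  | .inp _ h, k, m => and_congr .rfl (h.scoped_iff k (m + 1))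
  | .out _ hM h, k, m => and_congr .rfl (and_congr (hM.scoped_iff k m) (h.scoped_iff k m))
  | .par h₁ h₂, k, m => and_congr (h₁.scoped_iff k m) (h₂.scoped_iff k m)
  | .loc _ h, k, m => and_congr .rfl (h.scoped_iff k m)
  | .new h, k, m => h.scoped_iff (k + 1) m
  | .rep h, k, m => h.scoped_iff k m
  | .run h, k, m => h.scoped_iff k m
theorem TErase.scoped_iff {M N : Term} : TErase M N → ∀ k m, M.Scoped k m ↔ N.Scoped k m
  | .var _, _, _ => .rfl
  | .quote h, k, m => h.scoped_iff k m
end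

theorem TErase.fn_eq {M N : Term} (h : TErase M N) : M.fn = N.fn :=
  (h.clo (B := fun _ _ => False)).fn_eq (fun _ _ h => h.elim) fun _ _ h => h.elim

theorem Erase.nil_inv {Q : Proc} (h : Erase .nil Q) : ∃ k, Q = runs k .nil :=
  match h with
  | .erase h => by
    obtain ⟨k, rfl⟩ := h.nil_inv
    exact ⟨k + 1, rfl⟩
  | .nil => ⟨0, rfl⟩

theorem Erase.out_inv {c : Chan} {M : Term} {P Q : Proc} (h : Erase (.out c M P) Q) :
    ∃ k N R, Q = runs k (.out c N R) ∧ TErase M N ∧ Erase P R :=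
  match h with
  | .erase h => by
    obtain ⟨k, N, R, rfl, h'⟩ := h.out_inv
    exact ⟨k + 1, N, R, rfl, h'⟩
  | .out _ hM h => ⟨0, _, _, rfl, hM, h⟩

theorem fn_runs (P : Proc) : ∀ k, (runs k P).fn = P.fn
  | 0 => rfl
  | k + 1 => fn_runs P k

theorem Weak.runs_self (k : ℕ) (P : Proc) : Weak (runs k P) P := by
  induction k with
  | zero => exact .refl
  | succ k ih => exact .head (.run _) ih

theorem Weak.runs_inv {k : ℕ} {P R : Proc} (h : Weak (runs k P) R) :
    (∃ j ≤ k, R = runs j P) ∨ Weak P R := by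
  induction h with
  | refl => exact .inl ⟨k, le_rfl, rfl⟩
  | tail _ hs ih =>
    rcases ih with ⟨_ | j, hj, rfl⟩ | h
    · exact .inr (.single hs)
    · cases hs
      exact .inl ⟨j, Nat.le_of_succ_le hj, rfl⟩
    · exact .inr (h.tail hs)

theorem Weak.runs_nil_inv {k : ℕ} {R : Proc} (h : Weak (runs k .nil) R) :
    ∃ j ≤ k, R = runs j .nil := by
  rcases h.runs_inv with h | h
  · exact h
  · exact ⟨0, Nat.zero_le k, h.nil_inv⟩

theorem Weak.out_inv {c : Chan} {M : Term} {P R : Proc} (h : Weak (.out c M P) R) :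
    R = .out c M P := by
  induction h with
  | refl => rfl
  | tail _ hs ih => subst ih; cases hs

theorem Weak.runs_out_inv {k : ℕ} {c : Chan} {M : Term} {P R : Proc}
    (h : Weak (runs k (.out c M P)) R) : ∃ j ≤ k, R = runs j (.out c M P) := by
  rcases h.runs_inv with h | h
  · exact h
  · exact ⟨0, Nat.zero_le k, h.out_inv⟩

theorem WeakAct.runs_out_inv {k : ℕ} {a b : Name} {M N : Term} {P R : Proc} {bs : List Name}
    (h : WeakAct (runs k (.out (.free a) M P)) (.out bs b N) R) : N = M ∧ Weak P R := by
  obtain ⟨P₁, P₂, h₁, h₂, h₃⟩ := h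
  obtain ⟨_ | j, -, rfl⟩ := h₁.runs_out_inv
  · cases h₂
    exact ⟨rfl, h₃⟩
  · cases h₂

theorem visible_runs {k : ℕ} {P : Proc} (h : (runs k P).Closed) (hP : P.Closed → P.Visible) :
    (runs k P).Visible :=
  match k with
  | 0 => hP h
  | _ + 1 => ⟨0, h⟩

theorem count_runs_le {P : Proc} (hP : P.count ≤ 1) : ∀ k, (runs k P).count ≤ 1
  | 0 => hP
  | _ + 1 => le_rfl

theorem UpTo.closed {Y : QuadRel} (hY : IsBisimUpTo Y) {r : Finset Name} {E : Env} {P Q : Proc}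
    (h : UpTo Y r E P Q) : P.Closed ∧ Q.Closed := by
  obtain ⟨cs, ds, P₀, Q₀, P₁, Q₁, r', E', hP, hQ, h, ⟨-, cP, cQ⟩, -⟩ := h
  obtain ⟨-, -, cP', cQ'⟩ := hY.envRel _ _ _ _ h
  exact ⟨hP.closed_iff.2 (scoped_nus.2 ⟨cP', cP⟩), hQ.closed_iff.2 (scoped_nus.2 ⟨cQ', cQ⟩)⟩

/-- Superfluous `run`s of `0` can be executed until related null processes are reached. -/
theorem UpTo.exists_null {Y : QuadRel} (hY : IsBisimUpTo Y) (n : ℕ) : ∀ {k j : ℕ}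
    {r : Finset Name} {E : Env}, k + j ≤ n → UpTo Y r E (runs k .nil) (runs j .nil) →
    ∃ r' E' P₀ Q₀, Y r' E' P₀ Q₀ ∧ r ⊆ r' ∧ (∀ p ∈ E, TCtxRel r' E' p.1 p.2) ∧
      SCong P₀ .nil ∧ SCong Q₀ .nil := by
  induction n with
  | zero =>
    intro k j r E hn h
    obtain ⟨rfl, rfl⟩ := Nat.add_eq_zero_iff.1 (Nat.le_zero.1 hn)
    obtain ⟨r', E', P₀, Q₀, h, hr, hE, h'⟩ := h.split trivial trivial zero_le_one zero_le_one
    exact ⟨r', E', P₀, Q₀, h, hr, hE, h'.elim id fun h => ⟨h.1, h.2.1⟩⟩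
  | succ n ih =>
    intro k j r E hn h
    obtain ⟨cP, cQ⟩ := h.closed hY
    obtain ⟨r', E', P₀, Q₀, h₀, hr, hE, ⟨h₁, h₂⟩ | ⟨h₁, h₂, -⟩⟩ :=
      h.split (visible_runs cP fun _ => trivial) (visible_runs cQ fun _ => trivial)
        (count_runs_le zero_le_one k) (count_runs_le zero_le_one j)
    · have key : ∀ {k' j'}, k' + j' ≤ n → UpTo Y r' E' (runs k' .nil) (runs j' .nil) →
          ∃ r' E' P₀ Q₀, Y r' E' P₀ Q₀ ∧ r ⊆ r' ∧ (∀ p ∈ E, TCtxRel r' E' p.1 p.2) ∧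
            SCong P₀ .nil ∧ SCong Q₀ .nil := by
        intro k' j' hn' hu
        obtain ⟨r'', E'', P₁, Q₁, h, hr', hE', h'⟩ := ih hn' hu
        exact ⟨r'', E'', P₁, Q₁, h, hr.trans hr', fun p hp => (hE p hp).closure hr' hE', h'⟩
      match k, j with
      | 0, 0 => exact ⟨r', E', P₀, Q₀, h₀, hr, hE, h₁, h₂⟩
      | k + 1, j =>
        obtain ⟨P', hP, e₁⟩ := h₁.symm.sim.tau (.run (runs k .nil))
        obtain ⟨Q', hQ, hu⟩ := hY.tau h₀ hP
        obtain ⟨_, hw, e₂⟩ := h₂.weak hQ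
        obtain ⟨j', hj, rfl⟩ := hw.runs_nil_inv
        exact key (by omega) (hu.of_scong e₁.symm e₂)
      | k, j + 1 =>
        obtain ⟨Q', hQ, e₁⟩ := h₂.symm.sim.tau (.run (runs j .nil))
        obtain ⟨P', hP, hu⟩ := hY.tau_conv h₀ hQ
        obtain ⟨_, hw, e₂⟩ := h₁.weak hP
        obtain ⟨k', hk, rfl⟩ := hw.runs_nil_inv
        exact key (by omega) (hu.of_scong e₂ e₁.symm)
    · exact ⟨r', E', P₀, Q₀, h₀, hr, hE, h₁, h₂⟩

/-- The messages of two outputs related by the up-to context closure, possibly under `run`s, are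
contextually related. -/
theorem UpTo.tcong_of_out {Y : QuadRel} (hY : IsBisimUpTo Y) (hs : IsSimpleRel Y) {a : Name}
    {M N : Term} {m n : ℕ} (k : ℕ) : ∀ {j : ℕ} {r : Finset Name} {E : Env}, a ∈ r → M.fn ⊆ r →
    N.fn ⊆ r → UpTo Y r E (runs k (.out (.free a) M (runs m .nil)))
      (runs j (.out (.free a) N (runs n .nil))) → TCong (SymLocRel Y) M N := by
  induction k using Nat.strong_induction_on with
  | _ k ih =>
  intro j r E ha fM fN h
  obtain ⟨cP, cQ⟩ := h.closed hY
  obtain ⟨r', E', P₀, Q₀, h₀, hr, -, ⟨h₁, h₂⟩ | ⟨h₁, h₂, P₁, Q₁, hc, h₃, h₄⟩⟩ :=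
    h.split (visible_runs cP fun h => ⟨0, h⟩) (visible_runs cQ fun h => ⟨0, h⟩)
      (count_runs_le le_rfl k) (count_runs_le le_rfl j)
  · cases k with
    | zero =>
      obtain ⟨bs, M', P', hbs, eM, hP, e₁⟩ := h₁.symm.sim.out (.out a M (runs m .nil))
      obtain rfl := List.nil_perm.1 hbs
      obtain ⟨cs, N', Q', hQ, -, hu⟩ := hY.output h₀ hP (hr ha) (by simp)
      obtain ⟨ds, N'', R, -, eN, hw, e₂⟩ := h₂.weakAct_out hQ
      obtain ⟨rfl, hR⟩ := hw.runs_out_inv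
      obtain ⟨i, -, rfl⟩ := hR.runs_nil_inv
      obtain ⟨r'', E'', P'', Q'', h', hr', hE, e₃, e₄⟩ :=
        (hu.of_scong e₁.symm e₂).exists_null hY _ le_rfl
      refine TCong.mono (fun _ _ => .inl) (eM.trans_tcong (TCong.trans_tscong ?_ eN))
      refine (hE _ (Set.mem_insert _ _)).cong_of_null hY hs h' e₃ e₄ ?_ ?_
      · rw [← eM.fn_eq]
        exact fM.trans (hr.trans hr')
      · rw [eN.fn_eq]
        exact fN.trans (hr.trans hr')
    | succ k =>
      obtain ⟨P', hP, e₁⟩ := h₁.symm.sim.tau (.run _)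
      obtain ⟨Q', hQ, hu⟩ := hY.tau h₀ hP
      obtain ⟨_, hw, e₂⟩ := h₂.weak hQ
      obtain ⟨i, -, rfl⟩ := hw.runs_out_inv
      exact ih k (Nat.lt_succ_self k) (hr ha) (fM.trans hr) (fN.trans hr)
        (hu.of_scong e₁.symm e₂)
  · have fn_le : ∀ {L : Term} {i l : ℕ}, L.fn ⊆ r →
        (runs i (.out (.free a) L (runs l .nil))).fn ⊆ r' := by
      intro L i l hL
      simpa [fn_runs, Proc.fn, Chan.fn, Finset.insert_subset_iff, hr ha] using hL.trans hr
    have hc' := hc.cong_of_null hY hs h₀ h₁ h₂ (h₃.fn_eq ▸ fn_le fM) (h₄.fn_eq ▸ fn_le fN)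
    have hPQ : ClosedCong (SymLocRel Y) _ _ :=
      ⟨(h₃.symm.trans_cong (hc'.trans_scong h₄)).mono fun _ _ => .inl, cP, cQ⟩
    obtain ⟨cs, N', Q', hQ, hMN⟩ := hPQ.weakAct_out (progressing_symLocRel hY hs)
      ((Weak.runs_self k _).weakAct (Step.out a M _).weakAct)
    obtain ⟨rfl, -⟩ := hQ.runs_out_inv
    exact hMN

/-- The chain from `P` to `Q` passes through the messages `P₁` and `Q₁` of the outputs that `UpTo` relates,
which are `P` and `Q` with added `run`s. -/
theorem barbedCong_of_upTo {Y : QuadRel} (hY : IsBisimUpTo Y) (hs : IsSimpleRel Y) {a : Name}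
    {P Q : Proc} {r : Finset Name} {E : Env} (ha : a ∈ r) (hP : P.fn ⊆ r) (hQ : Q.fn ⊆ r)
    {P' Q' : Proc} (h₁ : Erase (.out (.free a) (.quote P) .nil) P')
    (h₂ : Erase (.out (.free a) (.quote Q) .nil) Q') (h : UpTo Y r E P' Q') : BarbedCong P Q := by
  obtain ⟨cP, cQ⟩ := h.closed hY
  replace cP := ((h₁.scoped_iff 0 0).2 cP).2.1
  replace cQ := ((h₂.scoped_iff 0 0).2 cQ).2.1
  obtain ⟨k, M, R, rfl, hM, hR⟩ := h₁.out_inv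
  obtain ⟨j, N, S, rfl, hN, hS⟩ := h₂.out_inv
  obtain ⟨m, rfl⟩ := hR.nil_inv
  obtain ⟨n, rfl⟩ := hS.nil_inv
  have hMN := h.tcong_of_out hY hs k ha (hM.fn_eq ▸ hP) (hN.fn_eq ▸ hQ)
  cases hM with
  | @quote _ P₁ hP₁ =>
    cases hN with
    | @quote _ Q₁ hQ₁ =>
      have cP₁ := (hP₁.scoped_iff 0 0).1 cP
      have cQ₁ := (hQ₁.scoped_iff 0 0).1 cQ
      have hB := progressing_symLocRel hY hs
      exact ⟨_, hB.isBarbedCong, .head ⟨hP₁.clo.cong, cP, cP₁⟩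
        (.head ⟨hMN.of_quote, cP₁, cQ₁⟩ (.single ⟨hQ₁.clo.cong.symm hB.symm, cQ₁, cQ⟩))⟩

end HOPiP

theorem corollary1 (Y : HOPiP.QuadRel) (hY : HOPiP.IsBisimUpTo Y) (hsimple : HOPiP.IsSimpleRel Y)
    (a : HOPiP.Name) (P Q : HOPiP.Proc)
    (h : HOPiP.UpToRun Y (insert a (P.fn ∪ Q.fn)) ∅
      (HOPiP.Proc.out (HOPiP.Chan.free a) (HOPiP.Term.quote P) HOPiP.Proc.nil)
      (HOPiP.Proc.out (HOPiP.Chan.free a) (HOPiP.Term.quote Q) HOPiP.Proc.nil)) :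
    HOPiP.BarbedCong P Q := by
  obtain ⟨P', Q', hP, hQ, h⟩ := h
  exact HOPiP.barbedCong_of_upTo hY hsimple (Finset.mem_insert_self _ _)
    (Finset.subset_union_left.trans (Finset.subset_insert _ _))
    (Finset.subset_union_right.trans (Finset.subset_insert _ _)) hP hQ h
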